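/- Let $p$ be a prime, let $k$ be a perfect field of characteristic $p$, and let $S$ be a reduced scheme over $k$. Write $\mathrm{Frob}$ for the absolute Frobenius of $S$, and $\mathbf W_2$ for Witt vectors of length two. **Square-zero extensions.** Let $B$ be one of the rings $k$, $\mathbf W_2(k)$, and let $M$ be an $\mathcal O_S$-module. A square-zero extension of $S$ by $M$ over $B$ is an extension $$\mathcal E:\ 0\to M\xrightarrow{\ j\ }\mathcal O_{\mathcal E}\xrightarrow{\ \pi\ }\mathcal O_S\to 0,$$ where $\mathcal O_{\mathcal E}$ is a sheaf of $B$-algebras on the space of $S$, $\pi$ is a surjection of sheaves of $B$-algebras, $j$ identifies $M$ with $\ker\pi$, and $j(\pi(t)m)=t\,j(m)$ (so that $\ker \pi$ has square zero). Morphisms are the homomorphisms of sheaves of $B$-algebras that induce the identity of $M$ and of $\mathcal O_S$; they are isomorphisms. These form a category $\mathbf{Exal}_B(S,M)$, and restriction of scalars along $\mathbf W_2(k)\to k$ gives $\mathbf{Exal}_k(S,M)\to\mathbf{Exal}_{\mathbf W_2(k)}(S,M)$. For an $\mathcal O_S$-linear map $\varphi:M\to M'$, the pushforward $\varphi_*\mathcal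 E\in\mathbf{Exal}_B(S,M')$ has middle term $(\mathcal O_{\mathcal E}\oplus M')/\{(j(m),-\varphi(m))\}$. The Baer difference $\mathcal E_1-\mathcal E_2$ of two extensions by $M$ is the pushforward of $\mathcal O_{\mathcal E_1}\times_{\mathcal O_S}\mathcal O_{\mathcal E_2}$, an extension by $M\oplus M$, along $(m_1,m_2)\mapsto m_1-m_2$; for local sections $t_1,t_2$ with the same image in $\mathcal O_S$, write $t_1-t_2$ for the section of $\mathcal E_1-\mathcal E_2$ which $(t_1,t_2)$ defines. **The extensions attached to $S$.** The map $\mathrm{Frob}:\mathcal O_S\to\mathrm{Frob}_*\mathcal O_S$, $x\mapsto x^p$, is $\mathcal O_S$-linear; let $d:\mathrm{Frob}_*\mathcal O_S\to\mathrm{Frob}_*B^1_S$ be its cokernel. Let $\mathcal E\mathbf W_2(S)\in\mathbf{Exal}_{\mathbf W_2(k)}(S,\mathrm{Frob}_*\mathcal O_S)$ be the extension $0\to\mathrm{Frob}_*\mathcal O_S\to\mathbf W_2(\mathcal O_S)\to\mathcal O_S\to0$, with maps $a\mapsto(0,a)$ and $(x_0,x_1)\mapsto x_0$. Its pushforward $d_*\mathcal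 E\mathbf W_2(S)$ is an extension over $k$, denoted $C\mathbf W_2(S)\in\mathbf{Exal}_k(S,\mathrm{Frob}_*B^1_S)$. **The two categories.** Let $\mathcal L_2(S)$ be the category of lifts of $S$ to a scheme that is flat over $\mathbf W_2(k)$, i.e. the full subcategory of $\mathbf{Exal}_{\mathbf W_2(k)}(S,\mathcal O_S)$ of the extensions $\mathcal E$ for which $(|S|,\mathcal O_{\mathcal E})$ is a scheme and multiplication by $p$ on $\mathcal O_{\mathcal E}$ induces the identity $\mathcal O_S\to\mathcal O_S$, that is, $p\,t=j(\pi(t))$ for all local sections $t$. Let $\tilde{\mathcal L}_2(S)$ be the category of pairs $(\mathcal F,f)$ of an extension $\mathcal F\in\mathbf{Exal}_k(S,\mathrm{Frob}_*\mathcal O_S)$ for which $(|S|,\mathcal O_{\mathcal F})$ is a scheme, and an isomorphism $f:d_*\mathcal F\xrightarrow{\sim}C\mathbf W_2(S)$ in $\mathbf{Exal}_k(S,\mathrm{Frob}_*B^1_S)$; the morphisms $(\mathcal F,f)\to(\mathcal F',f')$ are the morphisms $h:\mathcal F\to\mathcal F'$ with $f'\circ d_*(h)=f$. **Theorem.** There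 are an equivalence of categories $\Phi:\mathcal L_2(S)\to\tilde{\mathcal L}_2(S)$ with a quasi-inverse $\Psi$, and natural isomorphisms over $\mathbf W_2(k)$ as follows. 1. For $\mathcal E\in\mathcal L_2(S)$, with $\Phi(\mathcal E)=(\mathcal F,f)$, there is a natural isomorphism $\alpha_{\mathcal E}:\mathcal E\mathbf W_2(S)-\mathrm{Frob}_*(\mathcal E)\xrightarrow{\sim}\mathcal F$, where $\mathrm{Frob}_*(\mathcal E)$ is the pushforward of $\mathcal E$ along $\mathrm{Frob}:\mathcal O_S\to\mathrm{Frob}_*\mathcal O_S$. Under it, $f$ is the canonical isomorphism that comes from $d\circ\mathrm{Frob}=0$: for $w\in\mathbf W_2(\mathcal O_S)(U)$ and $y\in\mathcal O_{\mathcal E}(U)$ with the same image in $\mathcal O_S(U)$, the image of $\alpha_{\mathcal E}(w-\bar y)$ under $\mathcal O_{\mathcal F}\to\mathcal O_{d_*\mathcal F}\xrightarrow{f}\mathcal O_{C\mathbf W_2(S)}$ is the image of $w$, where $\bar y$ is the image of $y$ in $\mathrm{Frob}_*(\mathcal E)$. 2. For $X=(\mathcal F,f)\in\tilde{\mathcal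 L}_2(S)$, there is a natural isomorphism $\beta_X:\mathrm{Frob}_*(\Psi(X))\xrightarrow{\sim}\mathcal E\mathbf W_2(S)-\mathcal F$. It maps $\Psi(X)$ into the trivialization of $d_*(\mathcal E\mathbf W_2(S)-\mathcal F)$ that $f$ induces: if $y\in\mathcal O_{\Psi(X)}(U)$ satisfies $\beta_X(\bar y)=w-x$ with $w\in\mathbf W_2(\mathcal O_S)(U)$ and $x\in\mathcal O_{\mathcal F}(U)$ having the same image in $\mathcal O_S(U)$, then $x$ (through $\mathcal F\to d_*\mathcal F\xrightarrow{f}C\mathbf W_2(S)$) and $w$ have the same image in $\mathcal O_{C\mathbf W_2(S)}(U)$. -/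

import Mathlib

open CategoryTheory AlgebraicGeometry Opposite TopologicalSpace
universe u
noncomputable section
namespace WittLift

/-- The trivial square-zero extension `A ⊕ N` of a ring `A` by an `A`-module `N`, where `A` acts on
`N` through a ring homomorphism `f : A → B` and the product is
`(a, n) (a', n') = (a a', f a • n' + f a' • n)`. -/
@[ext] structure TrivExt {A B : Type u} [CommRing A] [CommRing B] (f : A →+* B) (N : Type u)
    [AddCommGroup N] [Module B N] where
  fst : A
  snd : N

namespace TrivExt
variable {A B : Type u} [CommRing A] [CommRing B] (f : A →+* B) (N : Type u)
    [AddCommGroup N] [Module B N]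

instance : Zero (TrivExt f N) := ⟨⟨0, 0⟩⟩
instance : One (TrivExt f N) := ⟨⟨1, 0⟩⟩
instance : Add (TrivExt f N) := ⟨fun x y => ⟨x.fst + y.fst, x.snd + y.snd⟩⟩
instance : Neg (TrivExt f N) := ⟨fun x => ⟨-x.fst, -x.snd⟩⟩
instance : Mul (TrivExt f N) :=
  ⟨fun x y => ⟨x.fst * y.fst, f x.fst • y.snd + f y.fst • x.snd⟩⟩

variable {f N}
@[simp] lemma fst_zero : (0 : TrivExt f N).fst = 0 := rfl
@[simp] lemma snd_zero : (0 : TrivExt f N).snd = 0 := rfl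
@[simp] lemma fst_one : (1 : TrivExt f N).fst = 1 := rfl
@[simp] lemma snd_one : (1 : TrivExt f N).snd = 0 := rfl
@[simp] lemma fst_add (x y : TrivExt f N) : (x + y).fst = x.fst + y.fst := rfl
@[simp] lemma snd_add (x y : TrivExt f N) : (x + y).snd = x.snd + y.snd := rfl
@[simp] lemma fst_neg (x : TrivExt f N) : (-x).fst = -x.fst := rfl
@[simp] lemma snd_neg (x : TrivExt f N) : (-x).snd = -x.snd := rfl
@[simp] lemma fst_mul (x y : TrivExt f N) : (x * y).fst = x.fst * y.fst := rfl
@[simp] lemma snd_mul (x y : TrivExt f N) :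
    (x * y).snd = f x.fst • y.snd + f y.fst • x.snd := rfl

instance : CommRing (TrivExt f N) where
  add_assoc x y z := by ext <;> simp [add_assoc]
  zero_add x := by ext <;> simp
  add_zero x := by ext <;> simp
  add_comm x y := by ext <;> simp [add_comm]
  neg_add_cancel x := by ext <;> simp
  nsmul := nsmulRec
  zsmul := zsmulRec
  mul_assoc x y z := by ext <;> simp [mul_assoc, mul_smul, smul_comm (f z.fst), add_assoc]
  one_mul x := by ext <;> simp
  mul_one x := by ext <;> simp
  mul_comm x y := by ext <;> simp [mul_comm, add_comm]
  left_distrib x y z := by ext <;> simp [mul_add, add_smul]; abel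
  right_distrib x y z := by ext <;> simp [add_mul, add_smul]; abel
  zero_mul x := by ext <;> simp
  mul_zero x := by ext <;> simp

/-- Functoriality of the trivial square-zero extension. -/
def map {A' B' : Type u} [CommRing A'] [CommRing B'] {f' : A' →+* B'} {N' : Type u}
    [AddCommGroup N'] [Module B' N'] (a : A →+* A') (b : B →+* B') (n : N →+ N')
    (h : ∀ x, f' (a x) = b (f x)) (hn : ∀ (x : B) y, n (x • y) = b x • n y) :
    TrivExt f N →+* TrivExt f' N' where
  toFun x := ⟨a x.fst, n x.snd⟩
  map_one' := by ext <;> simp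
  map_mul' x y := by ext <;> simp [h, hn]
  map_zero' := by ext <;> simp
  map_add' x y := by ext <;> simp

end TrivExt

lemma toSheafify_locInjective {X : TopCat.{u}} (P : TopCat.Presheaf CommRingCat.{u} X) :
    Presheaf.IsLocallyInjective (Opens.grothendieckTopology X)
      (toSheafify (Opens.grothendieckTopology X) P) := inferInstance

lemma toSheafify_locSurjective {X : TopCat.{u}} (P : TopCat.Presheaf CommRingCat.{u} X) :
    Presheaf.IsLocallySurjective (Opens.grothendieckTopology X)
      (toSheafify (Opens.grothendieckTopology X) P) := inferInstance

/-- Let `S` be a scheme, `ρ : R → Γ(S, 𝒪_S)` a ring homomorphism (so `S` is a scheme over `Spec R`)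
and `M` a module over `𝒪_S`. A square-zero extension `0 → M → O → 𝒪_S → 0` of sheaves of
`R`-algebras on the space of `S`: a sheaf of commutative rings `O` with an `R`-algebra structure
`base`, an epimorphism of sheaves of `R`-algebras `π : O → 𝒪_S`, and an isomorphism `ι` of `M` with
the kernel of `π`. The law `ι (π t • m) = t * ι m` says that the kernel has square zero (see
`SqZeroExt.ι_mul_ι`) and that `ι` is linear over `𝒪_S`. -/
structure SqZeroExt {R : Type u} [CommRing R] {S : Scheme.{u}} (ρ : R →+* Γ(S, ⊤))
    (M : S.Modules) where
  /-- the sheaf of rings in the middle -/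
  O : TopCat.Sheaf CommRingCat.{u} S.carrier
  /-- the projection to the structure sheaf -/
  π : O.presheaf ⟶ S.presheaf
  /-- the structure of `R`-algebra -/
  base : R →+* O.presheaf.obj (op ⊤)
  π_base : ∀ r, π.app (op ⊤) (base r) = ρ r
  π_surj : TopCat.Presheaf.IsLocallySurjective π
  /-- the inclusion of the ideal `M` -/
  ι : ∀ U : S.Opens, Γ(M, U) →+ O.presheaf.obj (op U)
  ι_map : ∀ {U V : S.Opens} (i : V ⟶ U) (m : Γ(M, U)),
    O.presheaf.map i.op (ι U m) = ι V (M.presheaf.map i.op m)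
  ι_inj : ∀ U, Function.Injective (ι U)
  exact : ∀ U (t : O.presheaf.obj (op U)), π.app (op U) t = 0 ↔ ∃ m, ι U m = t
  ι_smul : ∀ U (t : O.presheaf.obj (op U)) (m : Γ(M, U)),
    ι U ((show Γ(S, U) from π.app (op U) t) • m) = t * ι U m

open Scheme

section Ext
variable {R : Type u} [CommRing R] {S : Scheme.{u}} {ρ : R →+* Γ(S, ⊤)}
    {M M' : S.Modules}
namespace SqZeroExt

/-- A morphism of square-zero extensions of `S` by `M`: a homomorphism of sheaves of `R`-algebras
that induces the identity of `𝒪_S` and of `M`. It is automatically an isomorphism. -/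
@[ext] structure Hom (E E' : SqZeroExt ρ M) where
  hom : E.O.presheaf ⟶ E'.O.presheaf
  base : ∀ r, hom.app (op ⊤) (E.base r) = E'.base r
  π : hom ≫ E'.π = E.π
  ι : ∀ U (m : Γ(M, U)), hom.app (op U) (E.ι U m) = E'.ι U m

instance : Category (SqZeroExt ρ M) where
  Hom := Hom
  id E := ⟨𝟙 _, fun _ => rfl, by simp, fun _ _ => rfl⟩
  comp f g := ⟨f.hom ≫ g.hom, by simp [f.base, g.base], by simp [f.π, g.π], by simp [f.ι, g.ι]⟩

lemma π_ι (E : SqZeroExt ρ M) (U : S.Opens) (m : Γ(M, U)) : E.π.app (op U) (E.ι U m) = 0 :=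
  (E.exact U _).2 ⟨m, rfl⟩

/-- The ideal of a square-zero extension is killed by itself. -/
lemma ι_mul_ι (E : SqZeroExt ρ M) (U : S.Opens) (m n : Γ(M, U)) : E.ι U m * E.ι U n = 0 := by
  rw [← E.ι_smul, π_ι]
  exact (congrArg (E.ι U) (zero_smul Γ(S, U) n)).trans (map_zero _)

section Pushforward
variable (φ : M ⟶ M') (E : SqZeroExt ρ M)

/-- The trivial extension `O(U) ⊕ M'(U)`. -/
abbrev PreRing (E : SqZeroExt ρ M) (M' : S.Modules) (U : S.Opens) : Type u :=
  TrivExt (B := Γ(S, U)) (E.π.app (op U)).hom Γ(M', U)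

/-- The ideal `{(ι m, -φ m)}` of `O(U) ⊕ M'(U)`. -/
def preIdeal (U : S.Opens) : Ideal (E.PreRing M' U) where
  carrier := {x | ∃ m : Γ(M, U), x.fst = E.ι U m ∧ x.snd = -φ.app U m}
  zero_mem' := ⟨0, by simp⟩
  add_mem' := by
    rintro x y ⟨m, hm, hm'⟩ ⟨n, hn, hn'⟩
    exact ⟨m + n, by simp [hm, hn], by simp [hm', hn']; abel⟩
  smul_mem' := by
    rintro c x ⟨m, hm, hm'⟩
    refine ⟨(show Γ(S, U) from E.π.app (op U) c.fst) • m, ?_, ?_⟩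
    · rw [E.ι_smul, smul_eq_mul, TrivExt.fst_mul, hm]
    · rw [Modules.Hom.app_smul, smul_eq_mul, TrivExt.snd_mul, hm, hm', ← smul_neg]
      erw [π_ι, zero_smul]
      rw [add_zero]

/-- The restriction maps of `U ↦ O(U) ⊕ M'(U)`. -/
def preRes (M' : S.Modules) {U V : S.Opens} (i : V ⟶ U) : E.PreRing M' U →+* E.PreRing M' V :=
  TrivExt.map (E.O.presheaf.map i.op).hom (S.presheaf.map i.op).hom (M'.presheaf.map i.op).hom
    (fun x => NatTrans.naturality_apply E.π i.op x) (fun x y => Modules.map_smul M' i x y)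

lemma preRes_mem {U V : S.Opens} (i : V ⟶ U) :
    E.preIdeal φ U ≤ (E.preIdeal φ V).comap (E.preRes M' i) := by
  rintro x ⟨m, hm, hm'⟩
  refine ⟨M.presheaf.map i.op m, ?_, ?_⟩
  · rw [← E.ι_map, ← hm]; rfl
  · have : (E.preRes M' i x).snd = M'.presheaf.map i.op x.snd := rfl
    rw [this, hm', map_neg]
    exact congrArg _ (NatTrans.naturality_apply φ.mapPresheaf i.op m).symm

/-- The presheaf of rings `U ↦ (O(U) ⊕ M'(U)) / {(ι m, -φ m)}`. -/
def prePushforward : TopCat.Presheaf CommRingCat.{u} S.carrier where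
  obj U := .of (E.PreRing M' U.unop ⧸ E.preIdeal φ U.unop)
  map i := CommRingCat.ofHom (Ideal.quotientMap _ (E.preRes M' i.unop) (E.preRes_mem φ i.unop))
  map_id U := by
    ext x
    change Ideal.Quotient.mk _ _ = _
    congr 1
    ext
    · exact congrArg (fun g => g.hom x.fst) (E.O.presheaf.map_id U)
    · exact congrArg (fun g => g.hom x.snd) (M'.presheaf.map_id U)
  map_comp i j := by
    ext x
    change Ideal.Quotient.mk _ _ = Ideal.Quotient.mk _ _
    congr 1
    ext
    · exact congrArg (fun g => g.hom x.fst) (E.O.presheaf.map_comp i j)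
    · exact congrArg (fun g => g.hom x.snd) (M'.presheaf.map_comp i j)


variable {φ E} in
lemma pre_map_mk {U V : S.Opens} (i : V ⟶ U) (x : E.PreRing M' U) :
    (E.prePushforward φ).map i.op (Ideal.Quotient.mk _ x : E.PreRing M' U ⧸ E.preIdeal φ U) =
      (Ideal.Quotient.mk _ (E.preRes M' i x) : E.PreRing M' V ⧸ E.preIdeal φ V) := rfl

/-- The projection `(t, m') ↦ π t`. -/
def preπ : E.prePushforward φ ⟶ S.presheaf where
  app U := CommRingCat.ofHom (Ideal.Quotient.lift (E.preIdeal φ U.unop)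
    ((E.π.app U).hom.comp
      { toFun := fun x => x.fst
        map_one' := rfl
        map_mul' := fun _ _ => rfl
        map_zero' := rfl
        map_add' := fun _ _ => rfl }) (by
      rintro x ⟨m, hm, -⟩
      exact (congrArg (E.π.app U) hm).trans (E.π_ι _ _)))
  naturality U V i := by
    ext x
    obtain ⟨x, rfl⟩ := Ideal.Quotient.mk_surjective (I := E.preIdeal φ U.unop) x
    exact NatTrans.naturality_apply E.π i x.fst

/-- The map `t ↦ (t, 0)`. -/
def toPre : E.O.presheaf ⟶ E.prePushforward φ where
  app U := CommRingCat.ofHom ((Ideal.Quotient.mk (E.preIdeal φ U.unop)).comp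
      { toFun := fun t => ⟨t, 0⟩
        map_one' := rfl
        map_mul' := fun _ _ => by ext <;> simp
        map_zero' := rfl
        map_add' := fun _ _ => by ext <;> simp })
  naturality U V i := by
    ext x
    refine congrArg (Ideal.Quotient.mk (E.preIdeal φ V.unop)) ?_
    ext
    · rfl
    · exact (map_zero (M'.presheaf.map i).hom).symm

/-- The map `m' ↦ (0, m')`. -/
def preι (U : S.Opens) : Γ(M', U) →+ (E.prePushforward φ).obj (op U) :=
  (Ideal.Quotient.mk (E.preIdeal φ U)).toAddMonoidHom.comp
    { toFun := fun m => (⟨0, m⟩ : E.PreRing M' U)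
      map_zero' := rfl
      map_add' := fun _ _ => by ext <;> simp }

lemma preι_map {U V : S.Opens} (i : V ⟶ U) (m : Γ(M', U)) :
    (E.prePushforward φ).map i.op (E.preι φ U m) = E.preι φ V (M'.presheaf.map i.op m) := by
  refine congrArg (Ideal.Quotient.mk (E.preIdeal φ V)) ?_
  ext
  · exact map_zero (E.O.presheaf.map i.op).hom
  · rfl

lemma preι_inj (U : S.Opens) : Function.Injective (E.preι φ U) := by
  rw [injective_iff_map_eq_zero]
  intro m hm
  obtain ⟨n, hn, hn'⟩ := Ideal.Quotient.eq_zero_iff_mem.1 hm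
  have : n = 0 := E.ι_inj U (by rw [← hn, map_zero]; rfl)
  subst this
  rw [map_zero, neg_zero] at hn'
  exact hn'

lemma preι_smul (U : S.Opens) (t : (E.prePushforward φ).obj (op U)) (m : Γ(M', U)) :
    E.preι φ U ((show Γ(S, U) from (E.preπ φ).app (op U) t) • m) = t * E.preι φ U m := by
  obtain ⟨t, rfl⟩ := Ideal.Quotient.mk_surjective (I := E.preIdeal φ U) t
  refine congrArg (Ideal.Quotient.mk (E.preIdeal φ U)) (?_ : _ = t * _)
  ext
  · simp
  · simp; rfl

lemma preπ_preι (U : S.Opens) (m : Γ(M', U)) : (E.preπ φ).app (op U) (E.preι φ U m) = 0 :=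
  map_zero (E.π.app (op U)).hom

lemma pre_exact (U : S.Opens) (t : (E.prePushforward φ).obj (op U))
    (h : (E.preπ φ).app (op U) t = 0) : ∃ m, E.preι φ U m = t := by
  obtain ⟨t, rfl⟩ := Ideal.Quotient.mk_surjective (I := E.preIdeal φ U) t
  obtain ⟨m, hm⟩ := (E.exact U t.fst).1 h
  refine ⟨t.snd + φ.app U m, (Ideal.Quotient.eq (I := E.preIdeal φ U)).2 ⟨-m, ?_, ?_⟩⟩
  · rw [sub_eq_add_neg, map_neg, hm]; simp
  · rw [sub_eq_add_neg, map_neg]; simp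

/-- The sheaf associated with `U ↦ (O(U) ⊕ M'(U)) / {(ι m, -φ m)}`. -/
def pushO : TopCat.Sheaf CommRingCat.{u} S.carrier :=
  (presheafToSheaf (Opens.grothendieckTopology S.carrier) CommRingCat.{u}).obj (E.prePushforward φ)

/-- The canonical map from the presheaf quotient to its associated sheaf. -/
def unitPush : E.prePushforward φ ⟶ (E.pushO φ).presheaf :=
  toSheafify (Opens.grothendieckTopology S.carrier) (E.prePushforward φ)

/-- The projection of the pushed forward extension. -/
def pushπ : (E.pushO φ).presheaf ⟶ S.presheaf :=
  sheafifyLift _ (E.preπ φ) S.sheaf.property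

lemma unitPush_pushπ : E.unitPush φ ≫ E.pushπ φ = E.preπ φ :=
  toSheafify_sheafifyLift _ _ _

lemma unitPush_pushπ_apply (U : S.Opens) (t) :
    (E.pushπ φ).app (op U) ((E.unitPush φ).app (op U) t) = (E.preπ φ).app (op U) t := by
  rw [← unitPush_pushπ]; rfl

lemma unitPush_locally_inj {U : S.Opens} (t t' : (E.prePushforward φ).obj (op U))
    (h : (E.unitPush φ).app (op U) t = (E.unitPush φ).app (op U) t') (x : S) (hx : x ∈ U) :
    ∃ (V : S.Opens) (i : V ⟶ U), x ∈ V ∧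
      (E.prePushforward φ).map i.op t = (E.prePushforward φ).map i.op t' := by
  have : Presheaf.IsLocallyInjective (Opens.grothendieckTopology S.carrier) (E.unitPush φ) := by
    exact toSheafify_locInjective _
  obtain ⟨V, i, hi, hV⟩ := Presheaf.equalizerSieve_mem (Opens.grothendieckTopology S.carrier) (E.unitPush φ) t t' h x hx
  exact ⟨V, i, hV, hi⟩

lemma unitPush_locally_surj {U : S.Opens} (t : (E.pushO φ).presheaf.obj (op U)) (x : S)
    (hx : x ∈ U) : ∃ (V : S.Opens) (i : V ⟶ U), x ∈ V ∧
      ∃ q, (E.unitPush φ).app (op V) q = (E.pushO φ).presheaf.map i.op t := by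
  have : Presheaf.IsLocallySurjective (Opens.grothendieckTopology S.carrier) (E.unitPush φ) := by
    exact toSheafify_locSurjective _
  obtain ⟨V, i, hi, hV⟩ := Presheaf.imageSieve_mem (Opens.grothendieckTopology S.carrier) (E.unitPush φ) t x hx
  exact ⟨V, i, hV, hi⟩

/-- The inclusion of `M'` in the pushed forward extension. -/
def pushι (U : S.Opens) : Γ(M', U) →+ (E.pushO φ).presheaf.obj (op U) :=
  ((E.unitPush φ).app (op U)).hom.toAddMonoidHom.comp (E.preι φ U)

lemma pushι_map {U V : S.Opens} (i : V ⟶ U) (m : Γ(M', U)) :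
    (E.pushO φ).presheaf.map i.op (E.pushι φ U m) = E.pushι φ V (M'.presheaf.map i.op m) :=
  (NatTrans.naturality_apply (E.unitPush φ) i.op (E.preι φ U m)).symm.trans
    (congrArg _ (E.preι_map φ i m))

lemma pushι_inj (U : S.Opens) : Function.Injective (E.pushι φ U) := by
  intro m n h
  choose V i hV hi using fun x : U => E.unitPush_locally_inj φ _ _ h x.1 x.2
  refine TopCat.Sheaf.eq_of_locally_eq' ⟨M'.presheaf, M'.isSheaf⟩ V U i
    (fun x hx => Opens.mem_iSup.2 ⟨⟨x, hx⟩, hV _⟩) m n fun x => E.preι_inj φ (V x) ?_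
  have := hi x
  rw [preι_map, preι_map] at this
  exact this

/-- The pushforward of a square-zero extension by `φ : M → M'`, whose middle term is the sheaf
quotient `(O ⊕ M') / {(ι m, -φ m)}`. -/
def pushforwardObj : SqZeroExt ρ M' where
  O := E.pushO φ
  π := E.pushπ φ
  base := ((E.toPre φ ≫ E.unitPush φ).app (op ⊤)).hom.comp E.base
  π_base r := by
    refine (E.unitPush_pushπ_apply φ ⊤ _).trans (E.π_base r)
  π_surj := by
    rw [TopCat.Presheaf.isLocallySurjective_iff]
    intro U t x hx
    obtain ⟨V, hV, ⟨s, hs⟩, hxV⟩ := (TopCat.Presheaf.isLocallySurjective_iff _).1 E.π_surj U t x hx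
    exact ⟨V, hV, ⟨(E.toPre φ ≫ E.unitPush φ).app (op V) s,
      (E.unitPush_pushπ_apply φ V _).trans hs⟩, hxV⟩
  ι := E.pushι φ
  ι_map := E.pushι_map φ
  ι_inj := E.pushι_inj φ
  exact U t := by
    constructor
    · intro h
      have key : ∀ x : U, ∃ (V : S.Opens) (i : V ⟶ U) (m : Γ(M', V)), x.1 ∈ V ∧
          E.pushι φ V m = (E.pushO φ).presheaf.map i.op t := by
        rintro ⟨x, hx⟩
        obtain ⟨V, i, hV, q, hq⟩ := E.unitPush_locally_surj φ t x hx
        have hq0 : (E.preπ φ).app (op V) q = 0 := by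
          rw [← unitPush_pushπ_apply, hq, NatTrans.naturality_apply (E.pushπ φ) i.op t, h]
          exact map_zero (S.presheaf.map i.op).hom
        obtain ⟨m, hm⟩ := E.pre_exact φ V q hq0
        exact ⟨V, i, m, hV, by rw [← hq, ← hm]; rfl⟩
      choose V i m hV hm using key
      obtain ⟨s, hs, -⟩ := TopCat.Sheaf.existsUnique_gluing' ⟨M'.presheaf, M'.isSheaf⟩ V U i
        (fun x hx => Opens.mem_iSup.2 ⟨⟨x, hx⟩, hV _⟩) m (fun x y => E.pushι_inj φ _ (by
          dsimp only
          erw [← pushι_map, ← pushι_map]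
          rw [hm, hm, ← CommRingCat.comp_apply, ← CommRingCat.comp_apply, ← Functor.map_comp,
            ← Functor.map_comp]
          rfl))
      refine ⟨s, TopCat.Sheaf.eq_of_locally_eq' (E.pushO φ) V U i
        (fun x hx => Opens.mem_iSup.2 ⟨⟨x, hx⟩, hV _⟩) _ _ fun x => ?_⟩
      refine (E.pushι_map φ (i x) s).trans ?_
      erw [hs x]
      exact hm x
    · rintro ⟨m, rfl⟩
      exact (E.unitPush_pushπ_apply φ U _).trans (E.preπ_preι φ U m)
  ι_smul U t m := by
    choose V i hV q hq using fun x : U => E.unitPush_locally_surj φ t x.1 x.2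
    refine TopCat.Sheaf.eq_of_locally_eq' (E.pushO φ) V U i
        (fun x hx => Opens.mem_iSup.2 ⟨⟨x, hx⟩, hV _⟩) _ _ fun x => ?_
    refine (E.pushι_map φ (i x) _).trans (Eq.trans ?_ (map_mul _ _ _).symm)
    rw [Modules.map_smul]
    erw [E.pushι_map φ (i x) m, ← hq x]
    refine Eq.trans ?_ (map_mul ((E.unitPush φ).app (op (V x))).hom _ _)
    refine congrArg ((E.unitPush φ).app (op (V x))) ((Eq.trans ?_ (E.preι_smul φ (V x) (q x) _)))
    congr 2
    rw [← unitPush_pushπ_apply, hq]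
    exact (NatTrans.naturality_apply (E.pushπ φ) (i x).op t).symm

variable {E} {E' : SqZeroExt ρ M}

/-- Functoriality of `prePushforward`. -/
def preMap (h : E ⟶ E') : E.prePushforward φ ⟶ E'.prePushforward φ where
  app U := CommRingCat.ofHom (Ideal.quotientMap (E'.preIdeal φ U.unop)
    (TrivExt.map (h.hom.app U).hom (RingHom.id Γ(S, U.unop)) (AddMonoidHom.id Γ(M', U.unop))
      (fun x => congrArg (fun g => g.app U x) h.π) (fun _ _ => rfl)) (by
        rintro x ⟨m, hm, hm'⟩
        exact ⟨m, (congrArg (h.hom.app U) hm).trans (h.ι _ m), hm'⟩))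
  naturality U V i := by
    ext x
    obtain ⟨x, rfl⟩ := Ideal.Quotient.mk_surjective (I := E.preIdeal φ U.unop) x
    refine congrArg (Ideal.Quotient.mk (E'.preIdeal φ V.unop)) ?_
    ext
    · exact NatTrans.naturality_apply h.hom i x.fst
    · rfl

/-- Functoriality of `pushO`. -/
def pushMap (h : E ⟶ E') : (E.pushO φ).presheaf ⟶ (E'.pushO φ).presheaf :=
  sheafifyMap (Opens.grothendieckTopology S.carrier) (preMap φ h)

lemma unitPush_pushMap (h : E ⟶ E') :
    E.unitPush φ ≫ pushMap φ h = preMap φ h ≫ E'.unitPush φ :=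
  (toSheafify_naturality _ _).symm

lemma unitPush_hom_ext {P : TopCat.Sheaf CommRingCat.{u} S.carrier}
    (f g : (E.pushO φ).presheaf ⟶ P.presheaf)
    (h : E.unitPush φ ≫ f = E.unitPush φ ≫ g) : f = g :=
  sheafify_hom_ext _ f g P.property h

lemma toPre_preMap (h : E ⟶ E') : E.toPre φ ≫ preMap φ h = h.hom ≫ E'.toPre φ := rfl

lemma preι_preMap (h : E ⟶ E') (U : S.Opens) (m : Γ(M', U)) :
    (preMap φ h).app (op U) (E.preι φ U m) = E'.preι φ U m := by
  refine congrArg (Ideal.Quotient.mk (E'.preIdeal φ U)) ?_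
  ext
  · exact map_zero (h.hom.app (op U)).hom
  · rfl

lemma preMap_preπ (h : E ⟶ E') : preMap φ h ≫ E'.preπ φ = E.preπ φ := by
  ext U x
  obtain ⟨x, rfl⟩ := Ideal.Quotient.mk_surjective (I := E.preIdeal φ U) x
  exact congrArg (fun g => g.app (op U) x.fst) h.π

lemma preMap_id : preMap φ (𝟙 E) = 𝟙 _ := by
  ext U x
  obtain ⟨x, rfl⟩ := Ideal.Quotient.mk_surjective (I := E.preIdeal φ U) x
  rfl

lemma preMap_comp {E'' : SqZeroExt ρ M} (h : E ⟶ E') (h' : E' ⟶ E'') :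
    preMap φ (h ≫ h') = preMap φ h ≫ preMap φ h' := by
  ext U x
  obtain ⟨x, rfl⟩ := Ideal.Quotient.mk_surjective (I := E.preIdeal φ U) x
  rfl

/-- The pushforward functor `φ_*` from square-zero extensions by `M` to square-zero extensions by
`M'`, for `φ : M → M'`. -/
def pushforward : SqZeroExt ρ M ⥤ SqZeroExt ρ M' where
  obj E := E.pushforwardObj φ
  map {E E'} h :=
    { hom := pushMap φ h
      base := fun r => (congrArg (fun g => g.app (op ⊤) (E.base r))
        (show (E.toPre φ ≫ E.unitPush φ) ≫ pushMap φ h = h.hom ≫ E'.toPre φ ≫ E'.unitPush φ by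
          rw [Category.assoc, unitPush_pushMap, ← Category.assoc, toPre_preMap,
            Category.assoc])).trans (congrArg ((E'.toPre φ ≫ E'.unitPush φ).app (op ⊤)) (h.base r))
      π := unitPush_hom_ext (P := S.sheaf) φ _ _ (by
        change _ ≫ _ ≫ E'.pushπ φ = _ ≫ E.pushπ φ
        rw [← Category.assoc, unitPush_pushMap, Category.assoc, unitPush_pushπ, unitPush_pushπ,
          preMap_preπ])
      ι := fun U m => (congrArg (fun g => g.app (op U) (E.preι φ U m))
        (unitPush_pushMap φ h)).trans (congrArg ((E'.unitPush φ).app (op U))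
          (preι_preMap φ h U m)) }
  map_id E := Hom.ext ((congrArg _ (preMap_id φ)).trans (sheafifyMap_id _ _))
  map_comp h h' := Hom.ext ((congrArg _ (preMap_comp φ h h')).trans (sheafifyMap_comp _ _ _))

variable (E)
/-- The canonical homomorphism from the middle term of `E` to that of `φ_* E`. -/
def toPush : E.O.presheaf ⟶ ((pushforward φ).obj E).O.presheaf := E.toPre φ ≫ E.unitPush φ

lemma toPush_ι (U : S.Opens) (m : Γ(M, U)) :
    (E.toPush φ).app (op U) (E.ι U m) = ((pushforward φ).obj E).ι U (φ.app U m) := by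
  refine congrArg ((E.unitPush φ).app (op U)) ((Ideal.Quotient.eq (I := E.preIdeal φ U)).2 ?_)
  refine ⟨m, ?_, ?_⟩ <;> rw [sub_eq_add_neg] <;> simp

end Pushforward
end SqZeroExt
end Ext


lemma isIso_of_away {A L L' : CommRingCat.{u}} (f : A ⟶ L) (g : A ⟶ L') (h : L ⟶ L')
    (hc : f ≫ h = g) (r : A) (hf : @IsLocalization.Away A _ r L _ f.hom.toAlgebra)
    (hg : @IsLocalization.Away A _ r L' _ g.hom.toAlgebra) : IsIso h := by
  algebraize [f.hom, g.hom]
  let e : L ≃ₐ[A] L' := IsLocalization.algEquiv (Submonoid.powers r) L L'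
  have : h = (e.toRingEquiv.toCommRingCatIso).hom := by
    ext1
    refine IsLocalization.ringHom_ext (Submonoid.powers r) ?_
    ext a
    exact (congrArg (fun j => j.hom a) hc).trans (e.commutes a).symm
  rw [this]
  infer_instance

/-- A sheaf of rings `O` on the space of `S` with a locally surjective map to `𝒪_S` whose kernel has square zero. -/
structure Thickening (S : Scheme.{u}) where
  /-- the sheaf of rings -/
  O : TopCat.Sheaf CommRingCat.{u} S.carrier
  /-- the projection -/
  π : O.presheaf ⟶ S.presheaf
  surj : TopCat.Presheaf.IsLocallySurjective π
  sq : ∀ (U : S.Opens) (t t' : O.presheaf.obj (op U)),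
    π.app (op U) t = 0 → π.app (op U) t' = 0 → t * t' = 0

namespace Thickening
variable {S : Scheme.{u}} (E : Thickening S)

lemma isUnit_res {U : S.Opens} (t : E.O.presheaf.obj (op U)) (x : S) (hx : x ∈ U)
    (h : IsUnit (E.π.app (op U) t)) :
    ∃ (V : S.Opens) (i : V ⟶ U), x ∈ V ∧ IsUnit (E.O.presheaf.map i.op t) := by
  obtain ⟨b, hb⟩ := h.exists_right_inv
  obtain ⟨V, hV, ⟨s, hs⟩, hxV⟩ := (TopCat.Presheaf.isLocallySurjective_iff _).1 E.surj U b x hx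
  refine ⟨V, homOfLE hV, hxV, ?_⟩
  have h1 : E.π.app (op V) (E.O.presheaf.map (homOfLE hV).op t * s - 1) = 0 := by
    rw [map_sub, map_mul, map_one, hs, NatTrans.naturality_apply]
    rw [sub_eq_zero]
    refine (map_mul (S.presheaf.map (homOfLE hV).op).hom _ _).symm.trans ?_
    exact (congrArg _ hb).trans (map_one _)
  have h2 := E.sq V _ _ h1 h1
  refine IsUnit.of_mul_eq_one (s * (2 - E.O.presheaf.map (homOfLE hV).op t * s)) ?_
  linear_combination - h2

/-- The map induced by `π` on stalks. -/
def stalkπ (x : S) : E.O.presheaf.stalk x ⟶ S.presheaf.stalk x :=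
  (TopCat.Presheaf.stalkFunctor CommRingCat x).map E.π

lemma stalkπ_germ {U : S.Opens} (x : S) (hU : x ∈ U) (t : E.O.presheaf.obj (op U)) :
    E.stalkπ x (E.O.presheaf.germ U x hU t) = S.presheaf.germ U x hU (E.π.app (op U) t) :=
  TopCat.Presheaf.stalkFunctor_map_germ_apply U x hU E.π t

lemma isLocalHom_stalkπ (x : S) : IsLocalHom (CommRingCat.Hom.hom (E.stalkπ x)) := by
  constructor
  intro a ha
  obtain ⟨U, hU, t, rfl⟩ := E.O.presheaf.exists_germ_eq a
  erw [stalkπ_germ] at ha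
  obtain ⟨V, i, hV, hu⟩ := S.toRingedSpace.isUnit_res_of_isUnit_germ U _ x hU ha
  have h2 : IsUnit (E.π.app (op V) (E.O.presheaf.map i.op t)) := by
    rw [NatTrans.naturality_apply]; exact hu
  obtain ⟨W, j, hW, hu⟩ := E.isUnit_res _ x hV h2
  have := hu.map (E.O.presheaf.germ W x hW).hom
  erw [TopCat.Presheaf.germ_res_apply, TopCat.Presheaf.germ_res_apply] at this
  exact this

/-- The locally ringed space `(|S|, O)` -/
def toLRS : LocallyRingedSpace.{u} where
  carrier := S.carrier
  presheaf := E.O.presheaf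
  IsSheaf := E.O.property
  isLocalRing x :=
    have : IsLocalRing (S.presheaf.stalk x) := S.isLocalRing x
    have := E.isLocalHom_stalkπ x
    RingHom.domain_isLocalRing (E.stalkπ x).hom

/-- The closed immersion of `S` in `(|S|, O)`. -/
def incl : S.toLocallyRingedSpace ⟶ E.toLRS where
  base := 𝟙 _
  c := E.π
  prop x := by
    constructor
    intro a ha
    obtain ⟨U, hU, t, rfl⟩ := E.O.presheaf.exists_germ_eq a
    erw [PresheafedSpace.stalkMap_germ_apply] at ha
    have := E.isLocalHom_stalkπ x
    refine isUnit_of_map_unit (E.stalkπ x).hom _ ?_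
    erw [stalkπ_germ]
    exact ha

/-- The restriction of a thickening to an open subscheme. -/
def restrict (U : S.Opens) : Thickening U.toScheme where
  O := ⟨(E.toLRS.restrict U.isOpenEmbedding).presheaf, (E.toLRS.restrict U.isOpenEmbedding).IsSheaf⟩
  π := Functor.whiskerLeft U.isOpenEmbedding.isOpenMap.functor.op E.π
  surj := by
    refine (TopCat.Presheaf.isLocallySurjective_iff _).2 ?_
    intro V t x hx
    obtain ⟨W, hW, ⟨s, hs⟩, hxW⟩ := (TopCat.Presheaf.isLocallySurjective_iff _).1 E.surj
      (U.ι ''ᵁ V) t x.1 ⟨x, hx, rfl⟩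
    have hle : U.ι ''ᵁ (U.ι ⁻¹ᵁ W) ≤ W := U.ι.image_preimage_le W
    have hV : U.ι ⁻¹ᵁ W ≤ V := by
      intro y hy
      obtain ⟨z, hz, hzy⟩ := hW hy
      rwa [← Subtype.ext hzy]
    refine ⟨U.ι ⁻¹ᵁ W, hV, ⟨E.O.presheaf.map (homOfLE hle).op s, ?_⟩, hxW⟩
    refine (NatTrans.naturality_apply E.π (homOfLE hle).op s).trans ((congrArg _ hs).trans ?_)
    exact (congrArg (fun g => g.hom t) (S.presheaf.map_comp (homOfLE hW).op (homOfLE hle).op)).symm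
  sq V := E.sq (U.ι ''ᵁ V)

lemma restrict_toLRS (U : S.Opens) : (E.restrict U).toLRS = E.toLRS.restrict U.isOpenEmbedding :=
  rfl

lemma toΓSpecMapBasicOpen (b : E.O.presheaf.obj (op ⊤)) :
    E.toLRS.toΓSpecMapBasicOpen b = S.basicOpen (U := ⊤) (E.π.app (op ⊤) b) := by
  refine (E.toLRS.toΓSpecMapBasicOpen_eq b).trans (Opens.ext (Set.ext fun x => ?_))
  refine (E.toLRS.toRingedSpace.mem_top_basicOpen b x).trans (Iff.trans ?_
    (S.toRingedSpace.mem_top_basicOpen (E.π.app (op ⊤) b) x).symm)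
  have := E.stalkπ_germ x (U := ⊤) trivial b
  refine ⟨fun h => ?_, fun h => ?_⟩
  · exact this ▸ h.map (E.stalkπ x).hom
  · exact (E.isLocalHom_stalkπ x).map_nonunit (E.O.presheaf.germ ⊤ x trivial b)
      (show IsUnit ((E.stalkπ x) (E.O.presheaf.germ ⊤ x trivial b)) from this ▸ h)

lemma isIso_toΓSpec [IsAffine S] (h₁ : Function.Surjective (E.π.app (op ⊤)))
    (h₂ : ∀ (b : E.O.presheaf.obj (op ⊤)) (V : S.Opens) (_ : V = S.basicOpen (E.π.app (op ⊤) b)),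
      @IsLocalization.Away _ _ b (E.O.presheaf.obj (op V)) _
        (E.O.presheaf.map (homOfLE le_top : V ⟶ ⊤).op).hom.toAlgebra) :
    IsIso E.toLRS.toΓSpec := by
  have nat : E.incl ≫ E.toLRS.toΓSpec = S.toLocallyRingedSpace.toΓSpec ≫
      Spec.toLocallyRingedSpace.map (LocallyRingedSpace.Γ.map E.incl.op).op :=
    identityToΓSpec.naturality E.incl
  have iso1 : IsIso S.toLocallyRingedSpace.toΓSpec := by
    have : IsIso (Scheme.forgetToLocallyRingedSpace.map S.toSpecΓ) := inferInstance
    exact this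
  have homeo : IsHomeomorph E.toLRS.toΓSpec.base := by
    have e1 : E.toLRS.toΓSpec.base = S.toLocallyRingedSpace.toΓSpec.base ≫
        (Spec.toLocallyRingedSpace.map (LocallyRingedSpace.Γ.map E.incl.op).op).base :=
      (Category.id_comp _).symm.trans (congrArg (fun f => f.base) nat)
    rw [e1]
    have h3 : IsIso S.toLocallyRingedSpace.toΓSpec.base := by
      have : IsIso (LocallyRingedSpace.forgetToTop.map S.toLocallyRingedSpace.toΓSpec) :=
        inferInstance
      exact this
    refine IsHomeomorph.comp (g := (Spec.toLocallyRingedSpace.map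
      (LocallyRingedSpace.Γ.map E.incl.op).op).base) ?_
      (TopCat.homeoOfIso (asIso S.toLocallyRingedSpace.toΓSpec.base)).isHomeomorph
    refine PrimeSpectrum.isHomeomorph_comap (E.π.app (op ⊤)).hom
      (fun x => ⟨1, one_pos, ?_⟩) fun x hx => ⟨2, ?_⟩
    · rw [pow_one]
      exact h₁ x
    · rw [pow_two]
      exact E.sq ⊤ x x hx hx
  have hb : IsIso E.toLRS.toΓSpec.base := by
    exact (TopCat.isIso_iff_isHomeomorph _).2 homeo
  have hc : IsIso E.toLRS.toΓSpec.c := by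
    let φ : Spec.structureSheaf (LocallyRingedSpace.Γ.obj (op E.toLRS)) ⟶
      (TopCat.Sheaf.pushforward _ E.toLRS.toΓSpecBase).obj E.toLRS.𝒪 := ⟨E.toLRS.toΓSpec.c⟩
    have hφ : IsIso φ := by
      refine TopCat.Sheaf.isIso_iff_isIso_basis PrimeSpectrum.isBasis_basic_opens fun r => ?_
      exact isIso_of_away _ _ _ (E.toLRS.toΓSpecSheafedSpace_app_spec r) r
        (by
          have := StructureSheaf.IsLocalization.to_basicOpen
            (LocallyRingedSpace.Γ.obj (op E.toLRS)) r
          convert this using 1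
          exact Algebra.algebra_ext _ _ fun _ => rfl) (h₂ r _ (E.toΓSpecMapBasicOpen r))
    exact (ObjectProperty.isIso_hom_iff φ).2 hφ
  have hp : IsIso (SheafedSpace.forgetToPresheafedSpace.map
      (LocallyRingedSpace.forgetToSheafedSpace.map E.toLRS.toΓSpec)) :=
    PresheafedSpace.isIso_of_components E.toLRS.toΓSpec.toHom
  have := isIso_of_reflects_iso (LocallyRingedSpace.forgetToSheafedSpace.map E.toLRS.toΓSpec)
    SheafedSpace.forgetToPresheafedSpace
  exact isIso_of_reflects_iso E.toLRS.toΓSpec LocallyRingedSpace.forgetToSheafedSpace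

end Thickening

section Locality
variable {R : Type u} [CommRing R] {S : Scheme.{u}} {ρ : R →+* Γ(S, ⊤)} {M : S.Modules}

/-- Restriction of functions. -/
def rA {U V : S.Opens} (h : V ≤ U) : Γ(S, U) →+* Γ(S, V) := (S.presheaf.map (homOfLE h).op).hom

/-- Restriction of sections of a module. -/
def rM (M : S.Modules) {U V : S.Opens} (h : V ≤ U) : Γ(M, U) →+ Γ(M, V) :=
  (M.presheaf.map (homOfLE h).op).hom

lemma rA_rA {U V W : S.Opens} (h : V ≤ U) (h' : W ≤ V) (a : Γ(S, U)) :
    rA h' (rA h a) = rA (h'.trans h) a :=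
  (congrArg (fun g => g.hom a) (S.presheaf.map_comp (homOfLE h).op (homOfLE h').op)).symm

lemma rM_rM {U V W : S.Opens} (h : V ≤ U) (h' : W ≤ V) (a : Γ(M, U)) :
    rM M h' (rM M h a) = rM M (h'.trans h) a :=
  (congrArg (fun g => g.hom a) (M.presheaf.map_comp (homOfLE h).op (homOfLE h').op)).symm

lemma rM_smul {U V : S.Opens} (h : V ≤ U) (a : Γ(S, U)) (m : Γ(M, U)) :
    rM M h (a • m) = rA h a • rM M h m := Modules.map_smul M (homOfLE h) a m

/-- The sections of `M` over a basic open subset `D(f)` of an affine open `U` are the localization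
`Γ(M, U)_f`. -/
def IsLocalizing (M : S.Modules) : Prop :=
  ∀ (U V : S.Opens) (h : V ≤ U) (_ : IsAffineOpen U) (f : Γ(S, U)) (_ : V = S.basicOpen f),
    (∀ m : Γ(M, U), rM M h m = 0 → ∃ n : ℕ, f ^ n • m = 0) ∧
    (∀ m : Γ(M, V), ∃ (n : ℕ) (m' : Γ(M, U)), rM M h m' = rA h f ^ n • m)

namespace SqZeroExt
variable (E : SqZeroExt ρ M)

/-- Restriction of sections of the middle term. -/
def rO {U V : S.Opens} (h : V ≤ U) : E.O.presheaf.obj (op U) →+* E.O.presheaf.obj (op V) :=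
  (E.O.presheaf.map (homOfLE h).op).hom

/-- The projection on sections. -/
def πA (U : S.Opens) : E.O.presheaf.obj (op U) →+* Γ(S, U) := (E.π.app (op U)).hom

lemma rO_rO {U V W : S.Opens} (h : V ≤ U) (h' : W ≤ V) (a : E.O.presheaf.obj (op U)) :
    E.rO h' (E.rO h a) = E.rO (h'.trans h) a :=
  (congrArg (fun g => g.hom a) (E.O.presheaf.map_comp (homOfLE h).op (homOfLE h').op)).symm

lemma rO_ι {U V : S.Opens} (h : V ≤ U) (m : Γ(M, U)) :
    E.rO h (E.ι U m) = E.ι V (rM M h m) := E.ι_map (homOfLE h) m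

lemma πA_rO {U V : S.Opens} (h : V ≤ U) (t : E.O.presheaf.obj (op U)) :
    E.πA V (E.rO h t) = rA h (E.πA U t) := NatTrans.naturality_apply E.π (homOfLE h).op t

lemma ι_smul' (U : S.Opens) (t : E.O.presheaf.obj (op U)) (m : Γ(M, U)) :
    E.ι U (E.πA U t • m) = t * E.ι U m := E.ι_smul U t m

lemma exact' (U : S.Opens) (t : E.O.presheaf.obj (op U)) (h : E.πA U t = 0) :
    ∃ m, E.ι U m = t := (E.exact U t).1 h

lemma exists_lift (hM : IsLocalizing M) (U : S.Opens) (hU : IsAffineOpen U) (a : Γ(S, U)) :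
    ∃ t, E.πA U t = a := by
  -- local lifts on basic opens
  have loc : ∀ x : U, ∃ f : Γ(S, U), x.1 ∈ S.basicOpen f ∧
      ∃ t, E.πA (S.basicOpen f) t = rA (S.basicOpen_le f) a := by
    rintro ⟨x, hx⟩
    obtain ⟨V, hV, ⟨s, hs⟩, hxV⟩ := (TopCat.Presheaf.isLocallySurjective_iff _).1 E.π_surj U a x hx
    obtain ⟨f, hf, hxf⟩ := hU.exists_basicOpen_le ⟨x, hxV⟩ hx
    refine ⟨f, hxf, E.rO hf s, ?_⟩
    rw [πA_rO]
    exact (congrArg (rA hf) hs).trans (rA_rA hV hf a)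
  choose F hF hlift using loc
  have hspan : Ideal.span (Set.range F) = ⊤ := by
    rw [← hU.iSup_basicOpen_eq_self_iff]
    refine le_antisymm (iSup_le fun f => S.basicOpen_le _) fun x hx => ?_
    exact Opens.mem_iSup.2 ⟨⟨F ⟨x, hx⟩, ⟨_, rfl⟩⟩, hF ⟨x, hx⟩⟩
  obtain ⟨s, hs, hspan⟩ := (Ideal.span_eq_top_iff_finite _).1 hspan
  have hl : ∀ f : s, ∃ t, E.πA (S.basicOpen f.1) t = rA (S.basicOpen_le f.1) a := by
    rintro ⟨f, hf⟩
    obtain ⟨x, rfl⟩ := hs hf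
    exact hlift x
  choose t ht using hl
  let D (i : s) : S.Opens := S.basicOpen i.1
  have hD (i : s) : D i ≤ U := S.basicOpen_le _
  have hDa (i : s) : IsAffineOpen (D i) := hU.basicOpen _
  have hDD (i j : s) : D i ⊓ D j = S.basicOpen (rA (hD j) i.1) :=
    (inf_comm _ _).trans (S.basicOpen_res i.1 (homOfLE (hD j)).op).symm
  have hm : ∀ i j : s, ∃ m : Γ(M, D i ⊓ D j), E.ι _ m =
      E.rO inf_le_left (t i) - E.rO inf_le_right (t j) := by
    intro i j
    refine E.exact' _ _ ?_
    rw [map_sub, πA_rO, πA_rO, ht, ht, rA_rA, rA_rA, sub_self]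
  choose m hm using hm
  have h1 : ∀ i j : s, ∃ (n : ℕ) (m' : Γ(M, D j)),
      (rM M inf_le_right m' : Γ(M, D i ⊓ D j)) =
        (rA (inf_le_left.trans (hD i)) i.1 : Γ(S, D i ⊓ D j)) ^ n • m i j := by
    intro i j
    obtain ⟨n, m', h⟩ := (hM (D j) (D i ⊓ D j) inf_le_right (hDa j) (rA (hD j) i.1) (hDD i j)).2
      (m i j)
    exact ⟨n, m', by rw [h, rA_rA]⟩
  choose n n' hn using h1
  obtain ⟨N, hN⟩ : ∃ N, ∀ i j, n i j ≤ N :=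
    ⟨Finset.univ.sup fun i => Finset.univ.sup fun j => n i j, fun i j =>
      (Finset.le_sup (f := fun j => n i j) (Finset.mem_univ j)).trans
        (Finset.le_sup (f := fun i => Finset.univ.sup fun j => n i j) (Finset.mem_univ i))⟩
  let w (i j : s) : Γ(M, D j) := rA (hD j) i.1 ^ (N - n i j) • n' i j
  have hw (i j : s) : (rM M inf_le_right (w i j) : Γ(M, D i ⊓ D j)) =
      (rA (inf_le_left.trans (hD i)) i.1 : Γ(S, D i ⊓ D j)) ^ N • m i j := by
    simp only [w]
    rw [rM_smul, map_pow, rA_rA, hn, smul_smul, ← pow_add, Nat.sub_add_cancel (hN i j)]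
  clear_value w
  have h2 : ∀ i j l : s, ∃ K : ℕ, (rA (inf_le_left.trans (hD j)) i.1 : Γ(S, D j ⊓ D l)) ^ K •
      (rM M inf_le_left (w i j) - rM M inf_le_right (w i l) +
        (rA (inf_le_left.trans (hD j)) i.1 : Γ(S, D j ⊓ D l)) ^ N • m j l : Γ(M, D j ⊓ D l)) = 0 := by
    intro i j l
    have hV : (D i ⊓ D j) ⊓ (D i ⊓ D l) ≤ D j ⊓ D l := inf_le_inf inf_le_right inf_le_right
    have ha : IsAffineOpen (D j ⊓ D l) := by rw [hDD]; exact (hDa l).basicOpen _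
    refine (hM (D j ⊓ D l) ((D i ⊓ D j) ⊓ (D i ⊓ D l)) hV ha
      (rA (inf_le_left.trans (hD j)) i.1) ?_).1 _ ?_
    · refine Eq.trans ?_ (S.basicOpen_res i.1 (homOfLE (inf_le_left.trans (hD j))).op).symm
      change _ = (D j ⊓ D l) ⊓ D i
      rw [← inf_inf_distrib_left, inf_comm]
    · have e1 : rM M hV (rM M inf_le_left (w i j)) = rM M inf_le_left (rM M inf_le_right (w i j)) := by
        rw [rM_rM, rM_rM]
      have e2 : rM M hV (rM M inf_le_right (w i l)) =
          rM M inf_le_right (rM M inf_le_right (w i l)) := by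
        rw [rM_rM, rM_rM]
      rw [map_add, map_sub, e1, e2, hw, hw, rM_smul, rM_smul, rM_smul, map_pow, map_pow, map_pow,
        rA_rA, rA_rA, rA_rA, ← smul_sub, ← smul_add]
      convert smul_zero _
      refine E.ι_inj _ ?_
      rw [map_add, map_sub, map_zero, ← rO_ι, ← rO_ι, ← rO_ι, hm, hm, hm, map_sub, map_sub, map_sub]
      simp only [rO_rO]
      ring
  choose K hK using h2
  obtain ⟨L, hL⟩ : ∃ L, ∀ i j l, K i j l ≤ L :=
    ⟨Finset.univ.sup fun i => Finset.univ.sup fun j => Finset.univ.sup fun l => K i j l,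
      fun i j l => (Finset.le_sup (f := fun l => K i j l) (Finset.mem_univ l)).trans
        ((Finset.le_sup (f := fun j => Finset.univ.sup fun l => K i j l) (Finset.mem_univ j)).trans
        (Finset.le_sup (f := fun i => Finset.univ.sup fun j => Finset.univ.sup fun l => K i j l)
          (Finset.mem_univ i)))⟩
  have hKL (i j l : s) : (rA (inf_le_left.trans (hD j)) i.1 : Γ(S, D j ⊓ D l)) ^ L •
      (rM M inf_le_left (w i j) - rM M inf_le_right (w i l) : Γ(M, D j ⊓ D l)) =
        - ((rA (inf_le_left.trans (hD j)) i.1 : Γ(S, D j ⊓ D l)) ^ (L + N) • m j l) := by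
    have := congrArg (fun z => (rA (inf_le_left.trans (hD j)) i.1 : Γ(S, D j ⊓ D l)) ^ (L - K i j l) • z) (hK i j l)
    simp only [smul_zero] at this
    rw [smul_smul, ← pow_add, Nat.sub_add_cancel (hL i j l), smul_add, smul_smul, ← pow_add] at this
    exact eq_neg_of_add_eq_zero_left this
  obtain ⟨g, hg⟩ : ∃ g : s → Γ(S, U), ∑ i, g i * i.1 ^ (L + N) = 1 := by
    have := Ideal.span_pow_eq_top _ hspan (L + N)
    rw [Set.image_eq_range] at this
    exact Ideal.mem_span_range_iff_exists_fun.1 (this ▸ Submodule.mem_top)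
  let t' (j : s) : E.O.presheaf.obj (op (D j)) :=
    t j + E.ι _ (∑ i, rA (hD j) (g i * i.1 ^ L) • w i j)
  have ht' (j l : s) : E.rO inf_le_left (t' j) = (E.rO inf_le_right (t' l) :
      E.O.presheaf.obj (op (D j ⊓ D l))) := by
    rw [← sub_eq_zero]
    simp only [t']
    rw [map_add, map_add, rO_ι, rO_ι, add_sub_add_comm, ← hm, ← map_sub, ← map_add]
    refine (congrArg _ ?_).trans (map_zero (E.ι _))
    rw [map_sum, map_sum, ← Finset.sum_sub_distrib]
    have : ∀ i : s, (rM M inf_le_left (rA (hD j) (g i * i.1 ^ L) • w i j) -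
        rM M inf_le_right (rA (hD l) (g i * i.1 ^ L) • w i l) : Γ(M, D j ⊓ D l)) =
        -((rA (inf_le_left.trans (hD j)) (g i * i.1 ^ (L + N)) : Γ(S, D j ⊓ D l)) • m j l) := by
      intro i
      rw [rM_smul, rM_smul, rA_rA, rA_rA, ← smul_sub, map_mul, mul_smul, map_pow, hKL, smul_neg,
        smul_smul, map_mul, map_pow]
    rw [Finset.sum_congr rfl fun i _ => this i, Finset.sum_neg_distrib, ← Finset.sum_smul,
      ← map_sum, hg, map_one, one_smul, add_neg_cancel]
  have hcov : U ≤ iSup D := by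
    have := (hU.iSup_basicOpen_eq_self_iff (s := (s : Set Γ(S, U)))).2 hspan
    exact this.ge
  obtain ⟨r, hr, -⟩ := TopCat.Sheaf.existsUnique_gluing' E.O D U (fun i => homOfLE (hD i)) hcov t' ht'
  refine ⟨r, TopCat.Sheaf.eq_of_locally_eq' S.sheaf D U (fun i => homOfLE (hD i)) hcov _ _ fun i => ?_⟩
  refine (E.πA_rO (hD i) r).symm.trans ?_
  refine (congrArg (E.πA (D i)) (hr i)).trans ?_
  refine (map_add (E.πA (D i)) _ _).trans ?_
  rw [ht]
  refine (congrArg _ (E.π_ι (D i) _)).trans (add_zero _)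


lemma isUnit_of_πA (hM : IsLocalizing M) (U : S.Opens) (hU : IsAffineOpen U)
    (t : E.O.presheaf.obj (op U)) (h : IsUnit (E.πA U t)) : IsUnit t := by
  obtain ⟨b, hb⟩ := h.exists_right_inv
  obtain ⟨s, rfl⟩ := E.exists_lift hM U hU b
  have h1 : E.πA U (t * s - 1) = 0 := by rw [map_sub, map_mul, hb, map_one, sub_self]
  obtain ⟨m, hm⟩ := E.exact' U _ h1
  have h2 := E.ι_mul_ι U m m
  rw [hm] at h2
  refine IsUnit.of_mul_eq_one (s * (2 - t * s)) ?_
  linear_combination - h2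

lemma isLocalization_away (hM : IsLocalizing M) (U V : S.Opens) (hU : IsAffineOpen U) (h : V ≤ U)
    (b : E.O.presheaf.obj (op U)) (hV : V = S.basicOpen (E.πA U b)) :
    @IsLocalization.Away _ _ b (E.O.presheaf.obj (op V)) _ (E.rO h).toAlgebra := by
  have hVa : IsAffineOpen V := by rw [hV]; exact hU.basicOpen _
  have loc := hU.isLocalization_of_eq_basicOpen (E.πA U b) (homOfLE h) hV
  let _ := (E.rO h).toAlgebra
  let _ := (S.presheaf.map (homOfLE h).op).hom.toAlgebra
  have hunit : IsUnit (rA h (E.πA U b)) :=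
    IsLocalization.Away.algebraMap_isUnit (S := Γ(S, V)) (E.πA U b)
  refine IsLocalization.Away.mk _ ?_ ?_ ?_
  · refine E.isUnit_of_πA hM V hVa _ ?_
    change IsUnit (E.πA V (E.rO h b))
    rw [πA_rO]
    exact hunit
  · intro t
    obtain ⟨n, a, ha⟩ := IsLocalization.Away.surj (S := Γ(S, V)) (E.πA U b) (E.πA V t)
    obtain ⟨t₀, rfl⟩ := E.exists_lift hM U hU a
    have h1 : E.πA V (t * E.rO h b ^ n - E.rO h t₀) = 0 := by
      rw [map_sub, map_mul, map_pow, πA_rO, πA_rO, sub_eq_zero]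
      exact ha
    obtain ⟨m, hm⟩ := E.exact' V _ h1
    obtain ⟨l, m', hm'⟩ := (hM U V h hU (E.πA U b) hV).2 m
    refine ⟨n + l, t₀ * b ^ l + E.ι U m', ?_⟩
    change t * E.rO h b ^ (n + l) = E.rO h _
    rw [map_add, map_mul, map_pow, rO_ι, hm', ← πA_rO, ← map_pow (E.πA V), ι_smul', hm]
    ring
  · intro t t₁ ht
    change E.rO h t = E.rO h t₁ at ht
    obtain ⟨n, hn⟩ := IsLocalization.Away.exists_of_eq (S := Γ(S, V)) (E.πA U b)
      (a := E.πA U t) (b := E.πA U t₁)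
      (((E.πA_rO h t).symm.trans (congrArg (E.πA V) ht)).trans (E.πA_rO h t₁))
    obtain ⟨m, hm⟩ := E.exact' U (b ^ n * (t - t₁)) (by
      rw [map_mul, map_sub, map_pow, mul_sub, hn, sub_self])
    have hm0 : rM M h m = 0 := E.ι_inj V (by
      rw [← rO_ι, hm, map_mul, map_sub, ht, sub_self, mul_zero, map_zero])
    obtain ⟨l, hl⟩ := (hM U V h hU (E.πA U b) hV).1 m hm0
    rw [← map_pow] at hl
    have := E.ι_smul' U (b ^ l) m
    rw [hl, map_zero, hm] at this
    refine ⟨n + l, ?_⟩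
    linear_combination - this


/-- The thickening underlying a square-zero extension. -/
def thickening : Thickening S where
  O := E.O
  π := E.π
  surj := E.π_surj
  sq U t t' h h' := by
    obtain ⟨m, rfl⟩ := E.exact' U t h
    obtain ⟨n, rfl⟩ := E.exact' U t' h'
    exact E.ι_mul_ι U m n

/-- The scheme `(|S|, O)`, when `M` is quasi-coherent. -/
def toScheme (hM : IsLocalizing M) : Scheme.{u} where
  toLocallyRingedSpace := E.thickening.toLRS
  local_affine x := by
    obtain ⟨_, ⟨(U : S.Opens), hU, rfl⟩, hx, -⟩ :=
      S.isBasis_affineOpens.exists_subset_of_mem_open (a := x) (u := Set.univ) trivial isOpen_univ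
    have hU' : IsAffine U.toScheme := hU
    have hUa : IsAffineOpen (U.ι ''ᵁ ⊤) := by rw [U.ι_image_top]; exact hU
    have : IsIso (E.thickening.restrict U).toLRS.toΓSpec := by
      refine (E.thickening.restrict U).isIso_toΓSpec (fun a => E.exists_lift hM _ hUa a) ?_
      rintro b V rfl
      exact E.isLocalization_away hM _ _ hUa (U.ι.image_mono le_top) b
        (U.ι_image_basicOpen (E.πA (U.ι ''ᵁ ⊤) b))
    exact ⟨⟨U, hx⟩, _, ⟨@asIso _ _ _ _ (E.thickening.restrict U).toLRS.toΓSpec this⟩⟩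

/-- The ringed space `(|S|, O)` is a scheme. Then `π` defines a closed immersion of `S` in it. -/
def IsScheme : Prop :=
  ∃ T : Scheme.{u}, Nonempty (T.toPresheafedSpace ≅ E.thickening.toLRS.toPresheafedSpace)

lemma isScheme (hM : IsLocalizing M) : E.IsScheme := ⟨E.toScheme hM, ⟨Iso.refl _⟩⟩

end SqZeroExt

end Locality


section Witt
variable (p : ℕ) [hp : Fact p.Prime]

lemma charP_of_cast_eq_zero {A : Type u} [CommRing A] [Nontrivial A] (h : (p : A) = 0) :
    CharP A p := (CharP.charP_iff_prime_eq_zero hp.out).2 h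

/-- The Frobenius `x ↦ x ^ p` of a ring in which `p = 0`. -/
def frobHom {A : Type u} [CommRing A] (h : (p : A) = 0) : A →+* A where
  toFun x := x ^ p
  map_one' := one_pow p
  map_mul' x y := mul_pow x y p
  map_zero' := zero_pow hp.out.ne_zero
  map_add' x y := by
    obtain ⟨r, hr⟩ := exists_add_pow_prime_eq hp.out x y
    rw [hr, h]; ring

/-- The ring of Witt vectors of length two. -/
abbrev W₂ (A : Type u) [CommRing A] : Type u := TruncatedWittVector p 2 A

namespace W₂
variable {A B : Type u} [CommRing A] [CommRing B]

/-- Functoriality of Witt vectors: apply `f` to both coordinates. -/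
def map (f : A →+* B) : W₂ p A →+* W₂ p B :=
  have key : ∀ X : WittVector p A,
      TruncatedWittVector.mk p (fun i => f ((WittVector.truncate 2 X).coeff i)) =
        WittVector.truncate 2 (WittVector.map f X) := fun X => by
    ext i
    rw [TruncatedWittVector.coeff_mk, WittVector.coeff_truncate, WittVector.coeff_truncate,
      WittVector.map_coeff]
  { toFun := fun x => TruncatedWittVector.mk p (fun i => f (x.coeff i))
    map_one' := by rw [← map_one (WittVector.truncate 2), key, map_one, map_one]
    map_zero' := by rw [← map_zero (WittVector.truncate 2), key, map_zero, map_zero]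
    map_mul' := fun x y => by
      obtain ⟨x, rfl⟩ := WittVector.truncate_surjective p 2 A x
      obtain ⟨y, rfl⟩ := WittVector.truncate_surjective p 2 A y
      rw [← map_mul, key, key, key, map_mul, map_mul]
    map_add' := fun x y => by
      obtain ⟨x, rfl⟩ := WittVector.truncate_surjective p 2 A x
      obtain ⟨y, rfl⟩ := WittVector.truncate_surjective p 2 A y
      rw [← map_add, key, key, key, map_add, map_add] }

@[simp] lemma coeff_map (f : A →+* B) (x : W₂ p A) (i : Fin 2) :
    (map p f x).coeff i = f (x.coeff i) := rfl

/-- The reduction `W₂(A) → A`, `(x₀, x₁) ↦ x₀`. -/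
def res : W₂ p A →+* A where
  toFun x := x.coeff 0
  map_one' := WittVector.one_coeff_zero p A
  map_zero' := TruncatedWittVector.coeff_zero p 2 A 0
  map_mul' x y := by
    obtain ⟨x, rfl⟩ := WittVector.truncate_surjective p 2 A x
    obtain ⟨y, rfl⟩ := WittVector.truncate_surjective p 2 A y
    rw [← map_mul]
    exact WittVector.mul_coeff_zero x y
  map_add' x y := by
    obtain ⟨x, rfl⟩ := WittVector.truncate_surjective p 2 A x
    obtain ⟨y, rfl⟩ := WittVector.truncate_surjective p 2 A y
    rw [← map_add]
    exact WittVector.add_coeff_zero x y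

@[simp] lemma res_apply (x : W₂ p A) : res p x = x.coeff 0 := rfl

lemma res_surjective : Function.Surjective (res p : W₂ p A →+* A) :=
  fun a => ⟨TruncatedWittVector.mk p fun _ => a, rfl⟩

lemma truncate_verschiebung (X : WittVector p A) :
    WittVector.truncate 2 (WittVector.verschiebung X) =
      TruncatedWittVector.mk p ![0, X.coeff 0] := by
  ext i
  rw [WittVector.coeff_truncate, TruncatedWittVector.coeff_mk]
  fin_cases i
  · exact WittVector.verschiebung_coeff_zero X
  · exact WittVector.verschiebung_coeff_succ X 0

/-- The injection `A → W₂(A)`, `a ↦ (0, a)`. -/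
def ver : A →+ W₂ p A where
  toFun a := TruncatedWittVector.mk p ![0, a]
  map_zero' := by ext i; fin_cases i <;> simp
  map_add' a b := by
    have h := truncate_verschiebung p (WittVector.teichmuller p a + WittVector.teichmuller p b)
    rw [map_add, map_add, truncate_verschiebung, truncate_verschiebung,
      WittVector.add_coeff_zero] at h
    simpa using h.symm

lemma ver_apply (a : A) : ver p a = TruncatedWittVector.mk p ![0, a] := rfl

lemma ver_smul (h : (p : A) = 0) (x : W₂ p A) (a : A) :
    ver p (x.coeff 0 ^ p * a) = x * ver p a := by
  rcases subsingleton_or_nontrivial A with hA | hA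
  · ext i; exact Subsingleton.elim _ _
  · have := charP_of_cast_eq_zero p h
    obtain ⟨x, rfl⟩ := WittVector.truncate_surjective p 2 A x
    have ha : ver p a = WittVector.truncate 2
        (WittVector.verschiebung (WittVector.teichmuller p a)) := by
      rw [truncate_verschiebung, WittVector.teichmuller_coeff_zero, ver_apply]
    rw [ha, ← map_mul, mul_comm x, ← WittVector.verschiebung_mul_frobenius, truncate_verschiebung,
      ver_apply, WittVector.mul_coeff_zero, WittVector.coeff_frobenius_charP,
      WittVector.teichmuller_coeff_zero, WittVector.coeff_truncate, mul_comm a]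
    rfl

lemma natCast_mul (h : (p : A) = 0) (x : W₂ p A) : (p : W₂ p A) * x = ver p (x.coeff 0 ^ p) := by
  rcases subsingleton_or_nontrivial A with hA | hA
  · ext i; exact Subsingleton.elim _ _
  · have := charP_of_cast_eq_zero p h
    obtain ⟨x, rfl⟩ := WittVector.truncate_surjective p 2 A x
    rw [← map_natCast (WittVector.truncate 2 : WittVector p A →+* _), ← map_mul, mul_comm,
      ← WittVector.verschiebung_frobenius, truncate_verschiebung, WittVector.coeff_frobenius_charP]
    rfl

lemma ver_eq_iff {x : W₂ p A} : x.coeff 0 = 0 ↔ ∃ a, ver p a = x := by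
  constructor
  · intro h
    refine ⟨x.coeff 1, ?_⟩
    ext i; fin_cases i
    · exact h.symm
    · rfl
  · rintro ⟨a, rfl⟩; rfl

end W₂
end Witt

section Frobenius
lemma cast_eq_zero {p : ℕ} {S : Scheme.{u}} (hS : (p : Γ(S, ⊤)) = 0) (U : S.Opens) : (p : Γ(S, U)) = 0 := by
  have := map_natCast (S.presheaf.map (homOfLE (le_top : U ≤ ⊤)).op).hom p
  rw [← this]
  erw [hS]
  exact map_zero _

variable (p : ℕ) [hp : Fact p.Prime] (S : Scheme.{u}) (hS : (p : Γ(S, ⊤)) = 0)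

/-- The absolute Frobenius of a scheme on which `p = 0`: the identity on the space and `x ↦ x ^ p`
on sections. -/
def absFrob : S ⟶ S where
  base := 𝟙 _
  c :=
    { app := fun U => CommRingCat.ofHom (frobHom p (cast_eq_zero hS U.unop))
      naturality := fun U V i => by
        ext x
        exact (map_pow (S.presheaf.map i).hom x p).symm }
  prop x := by
    constructor
    intro a ha
    obtain ⟨U, hU, s, rfl⟩ := S.presheaf.exists_germ_eq a
    erw [PresheafedSpace.stalkMap_germ_apply] at ha
    exact (isUnit_pow_iff hp.out.ne_zero).1
      ((map_pow (S.presheaf.germ U x hU).hom s p).symm ▸ ha)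

/-- The structure sheaf `𝒪_S` as a module over itself. -/
abbrev 𝒪 : S.Modules := SheafOfModules.unit S.ringCatSheaf

/-- The module `Frob_* 𝒪_S`. -/
abbrev frobO : S.Modules := (Modules.pushforward (absFrob p S hS)).obj (𝒪 S)

/-- The linear map `Frob : 𝒪_S → Frob_* 𝒪_S`, `x ↦ x ^ p`. -/
def frobMap : 𝒪 S ⟶ frobO p S hS :=
  SheafOfModules.unitToPushforwardObjUnit (absFrob p S hS).toRingCatSheafHom


/-- The module `Frob_* B¹`, the cokernel of `Frob : 𝒪_S → Frob_* 𝒪_S`. -/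
def B₁ : S.Modules := Limits.cokernel (frobMap p S hS)
/-- The quotient map `d : Frob_* 𝒪_S → Frob_* B¹`. -/
def dMap : frobO p S hS ⟶ B₁ p S hS := Limits.cokernel.π (frobMap p S hS)

end Frobenius


/-- The structure sheaf and its pushforward by Frobenius are quasi-coherent, so the middle term of a
square-zero extension by one of them is always the structure sheaf of a scheme. -/
lemma isLocalizing_𝒪 (S : Scheme.{u}) : IsLocalizing (𝒪 S) := by
  intro U V h hU f hV
  have loc := hU.isLocalization_of_eq_basicOpen f (homOfLE h) hV
  let _ := (S.presheaf.map (homOfLE h).op).hom.toAlgebra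
  refine ⟨fun m hm => ?_, fun m => ?_⟩
  · obtain ⟨n, hn⟩ := IsLocalization.Away.exists_of_eq (S := Γ(S, V)) f
      (a := (show Γ(S, U) from m)) (b := 0) (Eq.trans hm (map_zero (rA h)).symm)
    exact ⟨n, hn.trans (mul_zero _)⟩
  · obtain ⟨n, a, ha⟩ := IsLocalization.Away.surj (S := Γ(S, V)) f (show Γ(S, V) from m)
    refine ⟨n, (show Γ(S, U) from a), ?_⟩
    exact ha.symm.trans (mul_comm _ _)
lemma isLocalizing_frobO (p : ℕ) [hp : Fact p.Prime] (S : Scheme.{u}) (hS : (p : Γ(S, ⊤)) = 0) :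
    IsLocalizing (frobO p S hS) := by
  intro U V h hU f hV
  have loc := isLocalizing_𝒪 S U V h hU (f ^ p) (hV.trans (S.basicOpen_pow _ hp.out.pos).symm)
  refine ⟨fun m hm => ?_, fun m => ?_⟩
  · obtain ⟨n, hn⟩ := loc.1 m hm
    refine ⟨n, Eq.trans ?_ hn⟩
    change (f ^ n) ^ p * _ = (f ^ p) ^ n * _
    rw [pow_right_comm]
  · obtain ⟨n, a, ha⟩ := loc.2 m
    refine ⟨n, a, ha.trans ?_⟩
    change rA h (f ^ p) ^ n * _ = (rA h f ^ n) ^ p * _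
    rw [map_pow, pow_right_comm]



section WittExt
variable (p : ℕ) [hp : Fact p.Prime] (S : Scheme.{u})

/-- The presheaf `U ↦ W₂(Γ(S, U))` of commutative rings on `S`. -/
def wittPresheaf : TopCat.Presheaf CommRingCat.{u} S.carrier where
  obj U := .of (W₂ p Γ(S, U.unop))
  map i := CommRingCat.ofHom (W₂.map p (S.presheaf.map i).hom)
  map_id U := by
    refine CommRingCat.hom_ext (RingHom.ext fun x => ?_)
    refine TruncatedWittVector.ext (p := p) fun i => ?_
    exact congrArg (fun g => g.hom (TruncatedWittVector.coeff i (show W₂ p Γ(S, U.unop) from x)))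
      (S.presheaf.map_id U)
  map_comp i j := by
    refine CommRingCat.hom_ext (RingHom.ext fun x => ?_)
    refine TruncatedWittVector.ext (p := p) fun l => ?_
    exact congrArg (fun g => g.hom (TruncatedWittVector.coeff l (show W₂ p Γ(S, _) from x)))
      (S.presheaf.map_comp i j)

lemma wittPresheaf_isSheaf : (wittPresheaf p S).IsSheaf := by
  rw [TopCat.Presheaf.isSheaf_iff_isSheafUniqueGluing]
  intro ι U sf hsf
  have key (l : Fin 2) := S.sheaf.existsUnique_gluing U
    (fun i => TruncatedWittVector.coeff (p := p) l (sf i))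
    (fun i j => congrArg (TruncatedWittVector.coeff (p := p) l) (hsf i j))
  choose g hg hg' using key
  refine ⟨TruncatedWittVector.mk p g, fun i => TruncatedWittVector.ext (p := p) fun l => hg l i,
    fun y hy => TruncatedWittVector.ext (p := p) fun l => ?_⟩
  exact hg' l _ fun i => congrArg (TruncatedWittVector.coeff (p := p) l) (hy i)

variable {R : Type u} [CommRing R] (ρ : R →+* Γ(S, ⊤)) (hS : (p : Γ(S, ⊤)) = 0)

/-- The square-zero extension `0 → Frob_* 𝒪_S → W₂(𝒪_S) → 𝒪_S → 0`, where the first map is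
`a ↦ (0, a)` and the second is `(x₀, x₁) ↦ x₀`, as an extension of algebras over `W₂(R)`. -/
def wittExt : SqZeroExt (ρ.comp (W₂.res p)) (frobO p S hS) where
  O := ⟨wittPresheaf p S, wittPresheaf_isSheaf p S⟩
  π := { app := fun U => CommRingCat.ofHom (W₂.res p) }
  base := W₂.map p ρ
  π_base _ := rfl
  π_surj := by
    rw [TopCat.Presheaf.isLocallySurjective_iff]
    intro U t x hx
    exact ⟨U, le_rfl, ⟨_, (W₂.res_surjective p _).choose_spec⟩, hx⟩
  ι U := W₂.ver p (A := Γ(S, U))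
  ι_map {U V} i m := TruncatedWittVector.ext (p := p) fun l => by
    fin_cases l
    · exact map_zero (S.presheaf.map i.op).hom
    · rfl
  ι_inj U a b h := congrArg (TruncatedWittVector.coeff (p := p) (R := Γ(S, U)) 1) h
  exact U t := W₂.ver_eq_iff (A := Γ(S, U)) p
  ι_smul U t m := W₂.ver_smul p (cast_eq_zero hS U) t m

end WittExt

namespace SqZeroExt
variable {R : Type u} [CommRing R] {S : Scheme.{u}} {ρ : R →+* Γ(S, ⊤)} {M M' : S.Modules}

/-- Square-zero extensions of `R`-algebras, seen as extensions of `R'`-algebras through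
`g : R' → R`. -/
def restrictScalars {R' : Type u} [CommRing R'] (g : R' →+* R) :
    SqZeroExt ρ M ⥤ SqZeroExt (ρ.comp g) M where
  obj E := { E with
    base := E.base.comp g
    π_base := fun r => E.π_base (g r) }
  map h := ⟨h.hom, fun r => h.base (g r), h.π, h.ι⟩

/-- A square-zero extension of `R'`-algebras in which the kernel of a surjection `g : R' → R` is
mapped to zero is an extension of `R`-algebras. -/
def descend {R' : Type u} [CommRing R'] (g : R' →+* R) (hg : Function.Surjective g)
    (E : SqZeroExt (ρ.comp g) M) (h : ∀ r, g r = 0 → E.base r = 0) : SqZeroExt ρ M :=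
  { E with
    base := RingHom.liftOfSurjective g hg ⟨E.base, h⟩
    π_base := fun r => by
      obtain ⟨r, rfl⟩ := hg r
      rw [RingHom.liftOfSurjective, RingHom.liftOfRightInverse_comp_apply]
      exact E.π_base r }

/-- The ring `O₁(U) ×_{𝒪_S(U)} O₂(U)`. -/
def fiberSubring (E₁ E₂ : SqZeroExt ρ M) (U : S.Opens) :
    Subring (E₁.O.presheaf.obj (op U) × E₂.O.presheaf.obj (op U)) :=
  RingHom.eqLocus ((E₁.π.app (op U)).hom.comp (RingHom.fst _ _))
    ((E₂.π.app (op U)).hom.comp (RingHom.snd _ _))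

/-- The presheaf of rings `O₁ ×_{𝒪_S} O₂`. -/
def fiberPresheaf (E₁ E₂ : SqZeroExt ρ M) : TopCat.Presheaf CommRingCat.{u} S.carrier where
  obj U := .of (fiberSubring E₁ E₂ U.unop)
  map {U V} i := CommRingCat.ofHom
    ((RingHom.prodMap (E₁.O.presheaf.map i).hom (E₂.O.presheaf.map i).hom).restrict
      (fiberSubring E₁ E₂ U.unop) (fiberSubring E₁ E₂ V.unop) (fun x hx => by
        refine (NatTrans.naturality_apply E₁.π i x.1).trans (Eq.trans ?_
          (NatTrans.naturality_apply E₂.π i x.2).symm)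
        exact congrArg (S.presheaf.map i) hx))
  map_id U := by
    refine CommRingCat.hom_ext (RingHom.ext fun x => Subtype.ext (Prod.ext ?_ ?_))
    · exact congrArg (fun g => g.hom x.1.1) (E₁.O.presheaf.map_id U)
    · exact congrArg (fun g => g.hom x.1.2) (E₂.O.presheaf.map_id U)
  map_comp i j := by
    refine CommRingCat.hom_ext (RingHom.ext fun x => Subtype.ext (Prod.ext ?_ ?_))
    · exact congrArg (fun g => g.hom x.1.1) (E₁.O.presheaf.map_comp i j)
    · exact congrArg (fun g => g.hom x.1.2) (E₂.O.presheaf.map_comp i j)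

lemma fiberPresheaf_isSheaf (E₁ E₂ : SqZeroExt ρ M) : (fiberPresheaf E₁ E₂).IsSheaf := by
  rw [TopCat.Presheaf.isSheaf_iff_isSheafUniqueGluing]
  intro I U sf hsf
  obtain ⟨g₁, h₁, h₁'⟩ := E₁.O.existsUnique_gluing U (fun i => (sf i).1.1)
    (fun i j => congrArg (fun z => z.1.1) (hsf i j))
  obtain ⟨g₂, h₂, h₂'⟩ := E₂.O.existsUnique_gluing U (fun i => (sf i).1.2)
    (fun i j => congrArg (fun z => z.1.2) (hsf i j))
  refine ⟨⟨(g₁, g₂), ?_⟩, fun i => Subtype.ext (Prod.ext (h₁ i) (h₂ i)), fun y hy => ?_⟩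
  · refine S.sheaf.eq_of_locally_eq U _ _ fun i => ?_
    refine (NatTrans.naturality_apply E₁.π _ g₁).symm.trans (Eq.trans ?_
      (NatTrans.naturality_apply E₂.π _ g₂))
    rw [h₁ i, h₂ i]
    exact (sf i).2
  · exact Subtype.ext (Prod.ext (h₁' _ fun i => congrArg (fun z => z.1.1) (hy i))
      (h₂' _ fun i => congrArg (fun z => z.1.2) (hy i)))

open Limits in
/-- The fibre product of two square-zero extensions of `S` by `M`, an extension of `S` by
`M ⊞ M`. -/
def fiberProd (E₁ E₂ : SqZeroExt ρ M) : SqZeroExt ρ (M ⊞ M) where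
  O := ⟨fiberPresheaf E₁ E₂, fiberPresheaf_isSheaf E₁ E₂⟩
  π :=
    { app := fun U => CommRingCat.ofHom ((E₁.π.app U).hom.comp
        ((RingHom.fst _ _).comp (fiberSubring E₁ E₂ U.unop).subtype))
      naturality := fun U V i => by
        ext x
        exact NatTrans.naturality_apply E₁.π i x.1.1 }
  base :=
    { toFun := fun r => ⟨(E₁.base r, E₂.base r), (E₁.π_base r).trans (E₂.π_base r).symm⟩
      map_one' := Subtype.ext (Prod.ext (map_one _) (map_one _))
      map_mul' := fun _ _ => Subtype.ext (Prod.ext (map_mul _ _ _) (map_mul _ _ _))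
      map_zero' := Subtype.ext (Prod.ext (map_zero _) (map_zero _))
      map_add' := fun _ _ => Subtype.ext (Prod.ext (map_add _ _ _) (map_add _ _ _)) }
  π_base r := E₁.π_base r
  π_surj := by
    rw [TopCat.Presheaf.isLocallySurjective_iff]
    intro U t x hx
    obtain ⟨V₁, hV₁, ⟨s₁, hs₁⟩, hx₁⟩ :=
      (TopCat.Presheaf.isLocallySurjective_iff _).1 E₁.π_surj U t x hx
    obtain ⟨V₂, hV₂, ⟨s₂, hs₂⟩, hx₂⟩ :=
      (TopCat.Presheaf.isLocallySurjective_iff _).1 E₂.π_surj U t x hx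
    have h₁ : E₁.π.app (op (V₁ ⊓ V₂)) (E₁.O.presheaf.map (homOfLE inf_le_left).op s₁) =
        S.presheaf.map (homOfLE (inf_le_left.trans hV₁)).op t := by
      rw [NatTrans.naturality_apply]
      exact (congrArg _ hs₁).trans (by
        simp only [TopCat.Presheaf.restrictOpen, TopCat.Presheaf.restrict]
        rw [← ConcreteCategory.comp_apply, ← Functor.map_comp]; rfl)
    have h₂ : E₂.π.app (op (V₁ ⊓ V₂)) (E₂.O.presheaf.map (homOfLE inf_le_right).op s₂) =
        S.presheaf.map (homOfLE (inf_le_left.trans hV₁)).op t := by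
      rw [NatTrans.naturality_apply]
      exact (congrArg _ hs₂).trans (by
        simp only [TopCat.Presheaf.restrictOpen, TopCat.Presheaf.restrict]
        rw [← ConcreteCategory.comp_apply, ← Functor.map_comp]; rfl)
    exact ⟨V₁ ⊓ V₂, inf_le_left.trans hV₁, ⟨⟨(_, _), h₁.trans h₂.symm⟩, h₁⟩, hx₁, hx₂⟩
  ι U :=
    { toFun := fun m => ⟨(E₁.ι U ((biprod.fst : M ⊞ M ⟶ M).app U m),
          E₂.ι U ((biprod.snd : M ⊞ M ⟶ M).app U m)), (E₁.π_ι U _).trans (E₂.π_ι U _).symm⟩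
      map_zero' := by simp; rfl
      map_add' := fun a b => Subtype.ext (Prod.ext (by simp; rfl) (by simp; rfl)) }
  ι_map {U V} i m := by
    refine Subtype.ext (Prod.ext ?_ ?_)
    · exact (E₁.ι_map i _).trans (congrArg (E₁.ι V)
        (NatTrans.naturality_apply (biprod.fst : M ⊞ M ⟶ M).mapPresheaf i.op m).symm)
    · exact (E₂.ι_map i _).trans (congrArg (E₂.ι V)
        (NatTrans.naturality_apply (biprod.snd : M ⊞ M ⟶ M).mapPresheaf i.op m).symm)
  ι_inj U m n h := by
    have h₁ := E₁.ι_inj U (congrArg (fun z => z.1.1) h)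
    have h₂ := E₂.ι_inj U (congrArg (fun z => z.1.2) h)
    have key (m : Γ(M ⊞ M, U)) : m = (biprod.inl : M ⟶ M ⊞ M).app U
        ((biprod.fst : M ⊞ M ⟶ M).app U m) + (biprod.inr : M ⟶ M ⊞ M).app U
        ((biprod.snd : M ⊞ M ⟶ M).app U m) :=
      congrArg (fun g => g.app U m) (biprod.total (X := M) (Y := M)).symm
    rw [key m, key n, h₁, h₂]
  exact U t := by
    constructor
    · intro h
      obtain ⟨m, hm⟩ := (E₁.exact U t.1.1).1 h
      obtain ⟨n, hn⟩ := (E₂.exact U t.1.2).1 (t.2.symm.trans h)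
      refine ⟨(biprod.inl : M ⟶ M ⊞ M).app U m + (biprod.inr : M ⟶ M ⊞ M).app U n,
        Subtype.ext (Prod.ext ?_ ?_)⟩
      · refine Eq.trans (congrArg (E₁.ι U) ?_) hm
        rw [map_add, ← ConcreteCategory.comp_apply, ← ConcreteCategory.comp_apply,
          ← Modules.Hom.comp_app, ← Modules.Hom.comp_app]
        simp
      · refine Eq.trans (congrArg (E₂.ι U) ?_) hn
        rw [map_add, ← ConcreteCategory.comp_apply, ← ConcreteCategory.comp_apply,
          ← Modules.Hom.comp_app, ← Modules.Hom.comp_app]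
        simp
    · rintro ⟨m, rfl⟩
      exact E₁.π_ι U _
  ι_smul U t m := by
    refine Subtype.ext (Prod.ext ?_ ?_)
    · refine Eq.trans (congrArg (E₁.ι U) (Modules.Hom.app_smul _ _ _)) (E₁.ι_smul U t.1.1 _)
    · refine Eq.trans (congrArg (E₂.ι U) (Modules.Hom.app_smul _ _ _)) (Eq.trans ?_
        (E₂.ι_smul U t.1.2 _))
      exact congrArg (fun a : Γ(S, U) => E₂.ι U (a • (biprod.snd : M ⊞ M ⟶ M).app U m)) t.2

/-- Functoriality of the fibre product. -/
def fiberProdMap {E₁ E₁' E₂ E₂' : SqZeroExt ρ M} (h₁ : E₁ ⟶ E₁') (h₂ : E₂ ⟶ E₂') :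
    fiberProd E₁ E₂ ⟶ fiberProd E₁' E₂' where
  hom :=
    { app := fun U => CommRingCat.ofHom
        ((RingHom.prodMap (h₁.hom.app U).hom (h₂.hom.app U).hom).restrict
          (fiberSubring E₁ E₂ U.unop) (fiberSubring E₁' E₂' U.unop) (fun x hx => by
            have e₁ := congrArg (fun g => g.app U x.1) h₁.π
            have e₂ := congrArg (fun g => g.app U x.2) h₂.π
            exact e₁.trans (Eq.trans hx e₂.symm)))
      naturality := fun U V i => by
        ext x
        refine Subtype.ext (Prod.ext ?_ ?_)
        · exact NatTrans.naturality_apply h₁.hom i x.1.1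
        · exact NatTrans.naturality_apply h₂.hom i x.1.2 }
  base r := Subtype.ext (Prod.ext (h₁.base r) (h₂.base r))
  π := by
    ext U x
    exact congrArg (fun g => g.app (op U) x.1.1) h₁.π
  ι U m := Subtype.ext (Prod.ext (h₁.ι U _) (h₂.ι U _))

open Limits in
/-- The Baer difference `E₂ ↦ E₁ - E₂` of square-zero extensions of `S` by `M`: the pushforward of
`E₁ ×_{𝒪_S} E₂` by `M ⊞ M → M`, `(m₁, m₂) ↦ m₁ - m₂`. -/
def baerSub (E₁ : SqZeroExt ρ M) : SqZeroExt ρ M ⥤ SqZeroExt ρ M where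
  obj E₂ := (pushforward (biprod.fst - biprod.snd : M ⊞ M ⟶ M)).obj (fiberProd E₁ E₂)
  map h := (pushforward _).map (fiberProdMap (𝟙 E₁) h)
  map_id E := (pushforward _).map_id (fiberProd E₁ E)
  map_comp f g := (pushforward (biprod.fst - biprod.snd : M ⊞ M ⟶ M)).map_comp
    (fiberProdMap (𝟙 E₁) f) (fiberProdMap (𝟙 E₁) g)

/-- The section `t₁ - t₂` of the Baer difference `E₁ - E₂` that two sections `t₁`, `t₂` of `E₁`,
`E₂` with the same image in `𝒪_S` define. -/
def sub (E₁ E₂ : SqZeroExt ρ M) {U : S.Opens} (t₁ : E₁.O.presheaf.obj (op U))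
    (t₂ : E₂.O.presheaf.obj (op U)) (h : E₁.π.app (op U) t₁ = E₂.π.app (op U) t₂) :
    ((baerSub E₁).obj E₂).O.presheaf.obj (op U) :=
  ((fiberProd E₁ E₂).toPush (Limits.biprod.fst - Limits.biprod.snd : M ⊞ M ⟶ M)).app (op U)
    (show fiberSubring E₁ E₂ U from ⟨(t₁, t₂), h⟩)

end SqZeroExt

section Main

/-- The ring homomorphism `k → Γ(S, 𝒪_S)` that makes `S` a `k`-scheme. -/
def structHom {k : Type u} [Field k] {S : Scheme.{u}} (s : S ⟶ Spec (.of k)) : k →+* Γ(S, ⊤) :=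
  s.appTop.hom.comp (Scheme.ΓSpecIso (.of k)).inv.hom

lemma cast_eq_zero_of_over (p : ℕ) {k : Type u} [Field k] [CharP k p] {S : Scheme.{u}}
    (s : S ⟶ Spec (.of k)) : (p : Γ(S, ⊤)) = 0 := by
  rw [← map_natCast (structHom s), CharP.cast_eq_zero, map_zero]

variable (p : ℕ) [hp : Fact p.Prime] {k : Type u} [Field k] [CharP k p] {S : Scheme.{u}}
  (s : S ⟶ Spec (.of k))

/-- The square-zero extension `EW₂(S) : 0 → Frob_* 𝒪_S → W₂(𝒪_S) → 𝒪_S → 0` over `W₂(k)`. -/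
abbrev EW₂ : SqZeroExt ((structHom s).comp (W₂.res p)) (frobO p S (cast_eq_zero_of_over p s)) :=
  wittExt p S (structHom s) (cast_eq_zero_of_over p s)

lemma pushforward_witt_base [PerfectField k] (r : W₂ p k) (hr : W₂.res p r = 0) :
    ((SqZeroExt.pushforward (dMap p S (cast_eq_zero_of_over p s))).obj (EW₂ p s)).base r = 0 := by
  obtain ⟨a, rfl⟩ := (W₂.ver_eq_iff p).1 hr
  obtain ⟨b, rfl⟩ := surjective_frobenius k p a
  have hw : (EW₂ p s).base (W₂.ver p (frobenius k p b)) =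
      (EW₂ p s).ι ⊤ ((frobMap p S (cast_eq_zero_of_over p s)).app ⊤
        (show Γ(𝒪 S, ⊤) from structHom s b)) := by
    refine TruncatedWittVector.ext (p := p) fun l => ?_
    fin_cases l
    · exact map_zero (structHom s)
    · exact map_pow (structHom s) b p
  have := SqZeroExt.toPush_ι (dMap p S (cast_eq_zero_of_over p s)) (EW₂ p s) ⊤
    ((frobMap p S (cast_eq_zero_of_over p s)).app ⊤ (show Γ(𝒪 S, ⊤) from structHom s b))
  rw [← hw] at this
  refine this.trans ?_
  rw [← ConcreteCategory.comp_apply, ← Modules.Hom.comp_app]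
  have h0 : frobMap p S (cast_eq_zero_of_over p s) ≫ dMap p S (cast_eq_zero_of_over p s) = 0 :=
    Limits.cokernel.condition _
  rw [h0]
  exact map_zero _

variable [PerfectField k]

/-- The square-zero extension `CW₂(S)` of `S` by `Frob_* B¹` over `k`, the pushforward of `EW₂(S)`
by `d : Frob_* 𝒪_S → Frob_* B¹`. -/
def CW₂ : SqZeroExt (structHom s) (B₁ p S (cast_eq_zero_of_over p s)) :=
  SqZeroExt.descend (W₂.res p) (W₂.res_surjective p)
    ((SqZeroExt.pushforward (dMap p S (cast_eq_zero_of_over p s))).obj (EW₂ p s))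
    (pushforward_witt_base p s)

/-- The canonical homomorphism from `W₂(𝒪_S)` to the middle term of `CW₂(S)`. -/
def toCW₂ : (EW₂ p s).O.presheaf ⟶ (CW₂ p s).O.presheaf :=
  (EW₂ p s).toPush (dMap p S (cast_eq_zero_of_over p s))

/-- A square-zero extension `0 → 𝒪_S → O → 𝒪_S → 0` of schemes over `W₂(k)` is a flat lift of `S`
to `W₂(k)` if the homomorphism `κ : 𝒪_S → 𝒪_S` induced by multiplication by `p` on `O`, which is
given by `ι (κ (π t)) = p t`, is the identity. -/
def isFlatLift : ObjectProperty (SqZeroExt ((structHom s).comp (W₂.res p)) (𝒪 S)) :=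
  fun E => E.IsScheme ∧ ∀ (U : S.Opens) (t : E.O.presheaf.obj (op U)),
    (p : E.O.presheaf.obj (op U)) * t = E.ι U (show Γ(S, U) from E.π.app (op U) t)

/-- The category of lifts of `S` to a scheme that is flat over `W₂(k)`. -/
abbrev FlatLift := (isFlatLift p s).FullSubcategory

/-- The pairs `(F, f)` of a square-zero extension `F` of `S` by `Frob_* 𝒪_S` in schemes over `k` and
an isomorphism `f : d_* F ≅ CW₂(S)` of square-zero extensions over `k`. -/
structure FrobExt where
  /-- the extension `0 → Frob_* 𝒪_S → O → 𝒪_S → 0` -/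
  F : SqZeroExt (structHom s) (frobO p S (cast_eq_zero_of_over p s))
  isScheme : F.IsScheme
  /-- the identification of its pushforward by `d` -/
  f : (SqZeroExt.pushforward (dMap p S (cast_eq_zero_of_over p s))).obj F ≅ CW₂ p s

/-- The functor `E ↦ Frob_* E` (pushforward by `Frob : 𝒪_S → Frob_* 𝒪_S`) on flat lifts. -/
def FlatLift.frobPush : FlatLift p s ⥤
    SqZeroExt ((structHom s).comp (W₂.res p)) (frobO p S (cast_eq_zero_of_over p s)) :=
  (isFlatLift p s).ι ⋙ SqZeroExt.pushforward (frobMap p S (cast_eq_zero_of_over p s))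

/-- The canonical homomorphism from the middle term of `E` to that of `Frob_* E`. -/
def FlatLift.toFrobPush (E : FlatLift p s) :
    E.obj.O.presheaf ⟶ ((FlatLift.frobPush p s).obj E).O.presheaf :=
  E.obj.toPush (frobMap p S (cast_eq_zero_of_over p s))

namespace FrobExt
variable {p s}

/-- A morphism `(F, f) → (F', f')` is a morphism `F → F'` that is compatible with `f` and `f'`. -/
@[ext] structure Hom (X Y : FrobExt p s) where
  /-- the morphism of extensions -/
  hom : X.F ⟶ Y.F
  comm : (SqZeroExt.pushforward (dMap p S (cast_eq_zero_of_over p s))).map hom ≫ Y.f.hom = X.f.hom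

instance : Category (FrobExt p s) where
  Hom := Hom
  id X := ⟨𝟙 X.F, by rw [CategoryTheory.Functor.map_id, Category.id_comp]⟩
  comp f g := ⟨f.hom ≫ g.hom, by rw [Functor.map_comp, Category.assoc, g.comm, f.comm]⟩

variable (p s) in
/-- The functor `(F, f) ↦ F`, where `F` is seen as an extension over `W₂(k)`. -/
def toExt : FrobExt p s ⥤
    SqZeroExt ((structHom s).comp (W₂.res p)) (frobO p S (cast_eq_zero_of_over p s)) where
  obj X := (SqZeroExt.restrictScalars (W₂.res p)).obj X.F
  map h := (SqZeroExt.restrictScalars (W₂.res p)).map h.hom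

/-- The composite `F → d_* F → CW₂(S)` of the canonical homomorphism and `f`, on middle terms. -/
def toCW₂ (X : FrobExt p s) : X.F.O.presheaf ⟶ (CW₂ p s).O.presheaf :=
  X.F.toPush (dMap p S (cast_eq_zero_of_over p s)) ≫ X.f.hom.hom

end FrobExt
end Main

end WittLift
end

/-!
Write `EW` for `EW₂(S)`, `CW` for `CW₂(S)`, and consider the sequence
`0 → 𝒪_S → Frob_* 𝒪_S → Frob_* B¹ → 0` given by `Frob` and `d`. It is exact because `S` is reduced
(`isShortExact_frobMap_dMap`).

*From lifts to extensions over `k`.* In `W₂(𝒪_S)` multiplication by `p` is `w ↦ (0, w₀ ^ p)`. In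
`Frob_* E`, for a flat lift `E`, it is given on the image of `E` by the same formula. So the kernel of
`W₂(k) → k` acts by zero on `EW - Frob_* E`, which is therefore an extension over `k`
(`FlatLift.diff_base`). As `d ∘ Frob = 0`, the extension `d_* Frob_* E` is split, and `w - ȳ ↦ w` is a
well-defined homomorphism from `EW - Frob_* E` to `CW` over `d` (`baerSubPush`). It is the required
identification `f`, since every morphism of square-zero extensions is an isomorphism.

*From extensions over `k` to lifts.* The projection `W₂(𝒪_S) → 𝒪_S` is surjective on sections over
every open set, and not only locally. Hence each section of `EW - F` is globally of the form `w - x`,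
and the pair `(w, x)` is unique up to the diagonal action of `Frob_* 𝒪_S` (`exists_sub_eq`,
`exists_of_sub_eq`). For a pair `(F, f)` the condition `w = f x` in `CW` thus depends only on `w - x`,
and it cuts out a subsheaf of rings of `EW - F`. By the exact sequence above this subsheaf is an
extension of `𝒪_S` by `𝒪_S` (`eqExt`). Since `p` kills `F`, multiplication by `p` maps `w - x` to
`p w - 0`, so that the extension is a flat lift (`natCast_mul_eqExt`). The inclusion in `EW - F` is
a homomorphism over `Frob`, and it identifies `EW - F` with the pushforward by `Frob`.

*The two constructions are inverse to each other.* By the surjectivity on sections,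
`g ↦ w - (w - g)` is a natural isomorphism `G ≅ EW - (EW - G)` (`doubleIso`). Composed with the
isomorphisms `EW - Frob_* E ≅ F` and `Frob_* E ≅ EW - F`, it gives the unit and the counit.

That the ringed spaces are schemes is automatic: `SqZeroExt.isScheme` applies to every square-zero
extension by `𝒪_S` or `Frob_* 𝒪_S`.
-/

noncomputable section
namespace WittLift
open Scheme

/-! ### Local sections of cokernels -/

section Modules

open Limits in
/-- In a reflective subcategory, a cokernel projection `d` is, up to a split epimorphism, the
reflection of an epimorphism `q` of the ambient category. -/
lemma exists_epi_fac_of_reflective {C D : Type*} [Category* C] [Category* D] [Abelian C] [Abelian D]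
    {L : C ⥤ D} {G : D ⥤ C} (adj : L ⊣ G) [G.Full] [G.Faithful] {A M N : D} (f : A ⟶ M)
    (d : M ⟶ N) (w : f ≫ d = 0) (hc : IsColimit (CokernelCofork.ofπ d w)) :
    ∃ (Q : C) (q : G.obj M ⟶ Q) (l : L.obj Q ⟶ N), Epi q ∧ IsSplitEpi l ∧
      q ≫ adj.unit.app Q ≫ G.map l = G.map d := by
  have : G.IsRightAdjoint := adj.isRightAdjoint
  have hG : G.PreservesZeroMorphisms := Functor.preservesZeroMorphisms_of_isRightAdjoint G
  obtain ⟨Q, q, hq, hfq, hQ⟩ : ∃ (Q : C) (q : G.obj M ⟶ Q), Epi q ∧ G.map f ≫ q = 0 ∧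
      ∃ l : Q ⟶ G.obj N, q ≫ l = G.map d :=
    ⟨_, cokernel.π (G.map f), inferInstance, cokernel.condition _,
      cokernel.desc (G.map f) (G.map d) (by rw [← G.map_comp, w, G.map_zero]),
      cokernel.π_desc _ _ _⟩
  obtain ⟨l₀, hl₀⟩ := hQ
  let l := (adj.homEquiv _ _).symm l₀
  have hl : adj.unit.app Q ≫ G.map l = l₀ :=
    (adj.homEquiv_unit Q N l).symm.trans (Equiv.apply_symm_apply _ _)
  let g := G.preimage (q ≫ adj.unit.app Q)
  have hg : f ≫ g = 0 := G.map_injective (by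
    rw [G.map_comp, G.map_preimage, G.map_zero, ← Category.assoc, hfq, zero_comp])
  have hgl : g ≫ l = d := G.map_injective (by
    rw [G.map_comp, G.map_preimage, Category.assoc, hl, hl₀])
  -- `l` is split by the map that `q` induces on the cokernel.
  refine ⟨Q, q, l, hq, ⟨⟨hc.desc (CokernelCofork.ofπ g hg), ?_⟩⟩, by rw [hl, hl₀]⟩
  have hd : Epi d := Cofork.IsColimit.epi hc
  rw [← cancel_epi d, Category.comp_id, ← Category.assoc]
  exact (congrArg (· ≫ l) (hc.fac (CokernelCofork.ofπ g hg) WalkingParallelPair.one)).trans hgl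

lemma isLocallySurjective_comp₃ {C : Type u} [SmallCategory C] {J : GrothendieckTopology C}
    {P₁ P₂ P₃ P₄ : Cᵒᵖ ⥤ AddCommGrpCat.{u}} (f : P₁ ⟶ P₂) (g : P₂ ⟶ P₃) (h : P₃ ⟶ P₄)
    (hf : Presheaf.IsLocallySurjective J f) (hg : Presheaf.IsLocallySurjective J g)
    (hh : Presheaf.IsLocallySurjective J h) : Presheaf.IsLocallySurjective J (f ≫ g ≫ h) :=
  inferInstance

open Limits in
/-- The projection to the cokernel of a morphism of sheaves of modules is locally surjective. -/
lemma isLocallySurjective_cokernelπ {C : Type u} [SmallCategory C] {J : GrothendieckTopology C}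
    (R : Sheaf J RingCat.{u}) [HasSheafify J AddCommGrpCat.{u}]
    [J.WEqualsLocallyBijective AddCommGrpCat.{u}] {A M N : SheafOfModules.{u} R} (f : A ⟶ M)
    (d : M ⟶ N) (w : f ≫ d = 0) (hc : IsColimit (CokernelCofork.ofπ d w)) :
    Presheaf.IsLocallySurjective J ((PresheafOfModules.toPresheaf R.obj).map d.val) := by
  obtain ⟨Q, q, l, hq, hl, h⟩ := exists_epi_fac_of_reflective
    (PresheafOfModules.sheafificationAdjunction (𝟙 R.obj)) f d w hc
  have h' := congrArg (PresheafOfModules.toPresheaf R.obj).map h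
  rw [Functor.map_comp, Functor.map_comp,
    PresheafOfModules.toPresheaf_map_sheafificationAdjunction_unit_app] at h'
  have h1 : Presheaf.IsLocallySurjective J ((PresheafOfModules.toPresheaf R.obj).map q) :=
    Presheaf.isLocallySurjective_of_surjective _ _ fun U => PresheafOfModules.surjective_of_epi q U
  have h2 : Presheaf.IsLocallySurjective J ((PresheafOfModules.toPresheaf R.obj).map l.val) := by
    have e : IsSplitEpi ((PresheafOfModules.toPresheaf R.obj).map l.val) :=
      inferInstanceAs (IsSplitEpi ((SheafOfModules.forget R ⋙
        PresheafOfModules.toPresheaf R.obj).map l))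
    refine Presheaf.isLocallySurjective_of_surjective _ _ fun U b => ?_
    exact ⟨(section_ ((PresheafOfModules.toPresheaf R.obj).map l.val)).app U b,
      congrArg (fun g => g.app U b) (IsSplitEpi.id ((PresheafOfModules.toPresheaf R.obj).map l.val))⟩
  have h3 : Presheaf.IsLocallySurjective J ((PresheafOfModules.toPresheaf R.obj).map q ≫
      toSheafify J Q.presheaf ≫ (PresheafOfModules.toPresheaf R.obj).map l.val) := by
    have h4 : Presheaf.IsLocallySurjective J (toSheafify J Q.presheaf) := inferInstance
    exact isLocallySurjective_comp₃ _ _ _ h1 h4 h2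
  exact Eq.mp (congrArg (Presheaf.IsLocallySurjective J) h') h3

variable {S : Scheme.{u}} {M N : S.Modules}

open Limits in
/-- Every section of the cokernel of a morphism of `𝒪_S`-modules lifts locally. -/
lemma exists_local_cokernel_lift (f : M ⟶ N) {U : S.Opens} (b : Γ(cokernel f, U)) (x : S)
    (hx : x ∈ U) : ∃ (V : S.Opens) (i : V ⟶ U) (n : Γ(N, V)), x ∈ V ∧
      (cokernel.π f).app V n = (cokernel f).presheaf.map i.op b := by
  have : Presheaf.IsLocallySurjective (Opens.grothendieckTopology S.carrier)
    (cokernel.π f).mapPresheaf := isLocallySurjective_cokernelπ S.ringCatSheaf f (cokernel.π f)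
      (cokernel.condition f) (cokernelIsCokernel f)
  obtain ⟨V, i, ⟨n, hn⟩, hV⟩ := Presheaf.imageSieve_mem (Opens.grothendieckTopology S.carrier)
    (cokernel.π f).mapPresheaf b x hx
  exact ⟨V, i, n, hV, hn⟩

open Limits in
/-- For an injective `f : M → N`, the sections of `N` over an open set `U` that vanish in the
cokernel come from sections of `M` over the same `U`: a monomorphism is the kernel of its cokernel,
and taking sections preserves kernels. -/
lemma exists_eq_of_cokernelπ_eq_zero (f : M ⟶ N) (hf : ∀ U, Function.Injective (f.app U))
    {U : S.Opens} (n : Γ(N, U)) (hn : (cokernel.π f).app U n = 0) : ∃ m, f.app U m = n := by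
  have hm : Mono f := ⟨fun g h e => Modules.hom_ext _ _ fun U => by
    ext x
    exact hf U (congrArg (fun k => k.app U x) e)⟩
  have hk := Abelian.monoIsKernelOfCokernel (CokernelCofork.ofπ _ (cokernel.condition f))
    (cokernelIsCokernel f)
  let ev : S.Modules ⥤ Ab := Modules.toPresheaf S ⋙ (CategoryTheory.evaluation _ _).obj (op U)
  have hz : ev.PreservesZeroMorphisms := ⟨fun _ _ => rfl⟩
  have : PreservesLimitsOfShape WalkingParallelPair
    ((CategoryTheory.evaluation (Opens S.carrier)ᵒᵖ Ab.{u}).obj (op U)) :=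
      evaluation_preservesLimitsOfShape _
  have : PreservesLimitsOfShape WalkingParallelPair (Modules.toPresheaf S) := inferInstance
  have : PreservesLimitsOfShape WalkingParallelPair ev := comp_preservesLimitsOfShape _ _
  have := isLimitForkMapOfIsLimit' ev _ hk
  let S' := ShortComplex.mk (f.app U) ((cokernel.π f).app U)
    (by rw [← Modules.Hom.comp_app, cokernel.condition]; rfl)
  have hS : S'.Exact := S'.exact_of_f_is_kernel this
  exact (ShortComplex.ab_exact_iff S').1 hS n hn
end Modules

/-! ### Square-zero extensions and pushforwards -/

namespace SqZeroExt
variable {R : Type u} [CommRing R] {S : Scheme.{u}} {ρ : R →+* Γ(S, ⊤)} {M M' : S.Modules}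

lemma Hom.π_apply {E E' : SqZeroExt ρ M} (h : E ⟶ E') {U : S.Opens}
    (t : E.O.presheaf.obj (op U)) : E'.π.app (op U) (h.hom.app (op U) t) = E.π.app (op U) t :=
  congrArg (fun g => g.app (op U) t) h.π

lemma exists_local_lift (E : SqZeroExt ρ M) {U : S.Opens} (a : Γ(S, U)) (x : S) (hx : x ∈ U) :
    ∃ (V : S.Opens) (i : V ⟶ U) (t : E.O.presheaf.obj (op V)), x ∈ V ∧
      E.π.app (op V) t = S.presheaf.map i.op a := by
  obtain ⟨V, hV, ⟨s, hs⟩, hxV⟩ := (TopCat.Presheaf.isLocallySurjective_iff _).1 E.π_surj U a x hx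
  exact ⟨V, homOfLE hV, s, hxV, hs⟩

lemma exists_add_ι {E : SqZeroExt ρ M} {U : S.Opens} {t t' : E.O.presheaf.obj (op U)}
    (h : E.π.app (op U) t = E.π.app (op U) t') : ∃ m, t = t' + E.ι U m := by
  obtain ⟨m, hm⟩ := (E.exact U (t - t')).1 (by
    refine (map_sub (E.π.app (op U)).hom t t').trans ?_
    exact sub_eq_zero.2 h)
  exact ⟨m, by rw [hm]; ring⟩

/-- A morphism of square-zero extensions is bijective on sections, by the five lemma: local preimages
are unique, hence glue. -/
lemma Hom.bijective {E E' : SqZeroExt ρ M} (h : E ⟶ E') (U : S.Opens) :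
    Function.Bijective (h.hom.app (op U)) := by
  have inj (V : S.Opens) : Function.Injective (h.hom.app (op V)) := by
    intro t t' ht
    obtain ⟨m, rfl⟩ := exists_add_ι (E := E) (t := t) (t' := t') (by
      rw [← Hom.π_apply h, ht, Hom.π_apply])
    have h1 : E'.ι V m = E'.ι V 0 := by
      rw [← h.ι, map_zero]
      simpa using ht
    rw [E'.ι_inj V h1, map_zero, add_zero]
  refine ⟨inj U, fun t' => ?_⟩
  have key : ∀ x : U, ∃ (V : S.Opens) (i : V ⟶ U) (t : E.O.presheaf.obj (op V)), x.1 ∈ V ∧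
      h.hom.app (op V) t = E'.O.presheaf.map i.op t' := by
    rintro ⟨x, hx⟩
    obtain ⟨V, i, t, hV, ht⟩ := E.exists_local_lift (E'.π.app (op U) t') x hx
    obtain ⟨m, hm⟩ := exists_add_ι (E := E') (t := E'.O.presheaf.map i.op t')
      (t' := h.hom.app (op V) t) (by
        rw [Hom.π_apply, ht]; exact NatTrans.naturality_apply E'.π i.op t')
    exact ⟨V, i, t + E.ι V m, hV, by rw [hm, ← h.ι, map_add]⟩
  choose V i t hV ht using key
  obtain ⟨s, hs, -⟩ := TopCat.Sheaf.existsUnique_gluing' E.O V U i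
    (fun x hx => Opens.mem_iSup.2 ⟨⟨x, hx⟩, hV _⟩) t (fun x y => inj _ (by
      dsimp only
      rw [NatTrans.naturality_apply, NatTrans.naturality_apply, ht, ht, ← CommRingCat.comp_apply,
        ← CommRingCat.comp_apply, ← Functor.map_comp, ← Functor.map_comp]
      rfl))
  refine ⟨s, TopCat.Sheaf.eq_of_locally_eq' E'.O V U i
    (fun x hx => Opens.mem_iSup.2 ⟨⟨x, hx⟩, hV _⟩) _ _ fun x => ?_⟩
  rw [← ht, ← hs x]
  exact (NatTrans.naturality_apply h.hom (i x).op s).symm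

/-- Every morphism of square-zero extensions is an isomorphism. -/
instance {E E' : SqZeroExt ρ M} (h : E ⟶ E') : IsIso h := by
  have h1 : ∀ U, IsIso (h.hom.app U) := fun U =>
    (ConcreteCategory.isIso_iff_bijective _).2 (Hom.bijective h U.unop)
  have h2 : IsIso h.hom := NatIso.isIso_of_isIso_app h.hom
  have e (U : S.Opens) (t) : (inv h.hom).app (op U) (h.hom.app (op U) t) = t :=
    congrArg (fun g => g.app (op U) t) (IsIso.hom_inv_id h.hom)
  let g : E' ⟶ E :=
    { hom := inv h.hom
      base := fun r => by rw [← h.base, e]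
      π := by rw [IsIso.inv_comp_eq, h.π]
      ι := fun U m => by rw [← h.ι, e] }
  exact ⟨g, Hom.ext (IsIso.hom_inv_id h.hom), Hom.ext (IsIso.inv_hom_id h.hom)⟩

/-- A homomorphism, over `φ : M → M'`, of a square-zero extension by `M` to one by `M'`. -/
structure HomOver (φ : M ⟶ M') (E : SqZeroExt ρ M) (E' : SqZeroExt ρ M') where
  /-- the homomorphism of middle terms -/
  hom : E.O.presheaf ⟶ E'.O.presheaf
  base : ∀ r, hom.app (op ⊤) (E.base r) = E'.base r
  π : hom ≫ E'.π = E.π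
  ι : ∀ U (m : Γ(M, U)), hom.app (op U) (E.ι U m) = E'.ι U (φ.app U m)

section Desc
variable {φ : M ⟶ M'} {E : SqZeroExt ρ M} {E' : SqZeroExt ρ M'}

lemma HomOver.π_apply (h : HomOver φ E E') {U : S.Opens}
    (t : E.O.presheaf.obj (op U)) : E'.π.app (op U) (h.hom.app (op U) t) = E.π.app (op U) t :=
  congrArg (fun g => g.app (op U) t) h.π

variable (φ) in
lemma toPush_π : E.toPush φ ≫ ((pushforward φ).obj E).π = E.π := by
  refine (Category.assoc _ _ _).trans ((congrArg (E.toPre φ ≫ ·) (E.unitPush_pushπ φ)).trans ?_)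
  rfl

variable (φ) in
lemma toPush_π_apply {U : S.Opens} (t : E.O.presheaf.obj (op U)) :
    ((pushforward φ).obj E).π.app (op U) ((E.toPush φ).app (op U) t) = E.π.app (op U) t :=
  congrArg (fun g => g.app (op U) t) (toPush_π φ)

variable (φ) in
lemma toPush_map {E E' : SqZeroExt ρ M} (h : E ⟶ E') {U : S.Opens} (t : E.O.presheaf.obj (op U)) :
    ((pushforward φ).map h).hom.app (op U) ((E.toPush φ).app (op U) t) =
      (E'.toPush φ).app (op U) (h.hom.app (op U) t) := by
  have : (E.toPre φ ≫ E.unitPush φ) ≫ pushMap φ h = h.hom ≫ E'.toPre φ ≫ E'.unitPush φ := by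
    rw [Category.assoc, unitPush_pushMap, ← Category.assoc, toPre_preMap, Category.assoc]
  exact congrArg (fun g => g.app (op U) t) this

lemma mk_eq_toPre_add_preι {U : S.Opens} (q : (E.prePushforward φ).obj (op U)) :
    ∃ t m, q = (E.toPre φ).app (op U) t + E.preι φ U m := by
  obtain ⟨q, rfl⟩ := Ideal.Quotient.mk_surjective (I := E.preIdeal φ U) q
  refine ⟨q.fst, q.snd, ?_⟩
  refine (congrArg (Ideal.Quotient.mk (E.preIdeal φ U)) ?_).trans
    (map_add (Ideal.Quotient.mk (E.preIdeal φ U)) ⟨q.fst, 0⟩ ⟨0, q.snd⟩)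
  ext <;> simp

/-- Locally, a section of `φ_* E` is the sum of a section of `E` and a section of `M'`. -/
lemma exists_local_toPush_add_ι {U : S.Opens} (z : ((pushforward φ).obj E).O.presheaf.obj (op U))
    (x : S) (hx : x ∈ U) : ∃ (V : S.Opens) (i : V ⟶ U) (t : E.O.presheaf.obj (op V)) (m : Γ(M', V)),
      x ∈ V ∧ ((pushforward φ).obj E).O.presheaf.map i.op z =
        (E.toPush φ).app (op V) t + ((pushforward φ).obj E).ι V m := by
  obtain ⟨V, i, hV, q, hq⟩ := E.unitPush_locally_surj φ z x hx
  obtain ⟨t, m, rfl⟩ := mk_eq_toPre_add_preι q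
  exact ⟨V, i, t, m, hV, hq.symm.trans (map_add ((E.unitPush φ).app (op V)).hom _ _)⟩

/-- Homomorphisms from `φ_* E` to a sheaf that agree on `E` and on `M'` are equal. -/
lemma push_hom_ext {P : TopCat.Sheaf CommRingCat.{u} S.carrier}
    {f g : ((pushforward φ).obj E).O.presheaf ⟶ P.presheaf}
    (h : ∀ (U : S.Opens) t, f.app (op U) ((E.toPush φ).app (op U) t) =
      g.app (op U) ((E.toPush φ).app (op U) t))
    (h' : ∀ (U : S.Opens) (m : Γ(M', U)), f.app (op U) (((pushforward φ).obj E).ι U m) =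
      g.app (op U) (((pushforward φ).obj E).ι U m)) : f = g := by
  refine unitPush_hom_ext (E := E) φ f g ?_
  ext U q
  obtain ⟨t, m, rfl⟩ := mk_eq_toPre_add_preι (U := U) q
  have e₁ := h U t
  have e₂ := h' U m
  rw [map_add, map_add]
  exact congrArg₂ (· + ·) e₁ e₂

lemma pushforward_hom_ext {f g : (pushforward φ).obj E ⟶ E'}
    (h : ∀ (U : S.Opens) t, f.hom.app (op U) ((E.toPush φ).app (op U) t) =
      g.hom.app (op U) ((E.toPush φ).app (op U) t)) : f = g :=
  Hom.ext (push_hom_ext h fun U m => by rw [f.ι, g.ι])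

section Factor
variable {M'' : S.Modules} {ψ : M' ⟶ M''} {χ : M ⟶ M''} {E'' : SqZeroExt ρ M''}

/-- The homomorphism `(t, m') ↦ h t + ψ m'` on `O(U) ⊕ M'(U)`, for `h` over `χ = ψ ∘ φ`. -/
def HomOver.trivExtHom (ψ : M' ⟶ M'') (h : HomOver χ E E'') (U : S.Opens) :
    E.PreRing M' U →+* E''.O.presheaf.obj (op U) where
  toFun x := h.hom.app (op U) x.fst + E''.ι U (ψ.app U x.snd)
  map_one' := by simp
  map_zero' := by simp
  map_add' x y := by
    rw [TrivExt.fst_add, TrivExt.snd_add, map_add, map_add, map_add]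
    abel
  map_mul' x y := by
    have e (t : E.O.presheaf.obj (op U)) (m : Γ(M', U)) :
        E''.ι U (ψ.app U ((show Γ(S, U) from E.π.app (op U) t) • m)) =
          h.hom.app (op U) t * E''.ι U (ψ.app U m) := by
      rw [← E''.ι_smul, Modules.Hom.app_smul]
      exact congrArg (fun a : Γ(S, U) => E''.ι U (a • ψ.app U m)) (HomOver.π_apply h t).symm
    have e0 := E''.ι_mul_ι U (ψ.app U x.snd) (ψ.app U y.snd)
    have e1 := (congrArg (E''.ι U) (map_add (ψ.app U).hom _ _)).trans ((map_add (E''.ι U) _ _).trans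
      (congrArg₂ (· + ·) (e x.fst y.snd) (e y.fst x.snd)))
    have e2 := map_mul (h.hom.app (op U)).hom x.fst y.fst
    refine (congrArg₂ (· + ·) e2 e1).trans ?_
    linear_combination - e0

lemma HomOver.trivExtHom_eq_zero (hχ : φ ≫ ψ = χ) (h : HomOver χ E E'') (U : S.Opens)
    (x : E.PreRing M' U) (hx : x ∈ E.preIdeal φ U) : h.trivExtHom ψ U x = 0 := by
  obtain ⟨m, hm, hm'⟩ := hx
  subst hχ
  change h.hom.app (op U) x.fst + E''.ι U (ψ.app U x.snd) = 0
  rw [hm, hm', map_neg, map_neg, h.ι]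
  exact add_neg_cancel _

/-- The homomorphism `(t, m') ↦ h t + ψ m'` on the presheaf quotient. -/
def HomOver.preDesc (hχ : φ ≫ ψ = χ) (h : HomOver χ E E'') :
    E.prePushforward φ ⟶ E''.O.presheaf where
  app U := CommRingCat.ofHom (Ideal.Quotient.lift (E.preIdeal φ U.unop)
    (h.trivExtHom ψ U.unop) (h.trivExtHom_eq_zero hχ U.unop))
  naturality U V i := by
    ext x
    obtain ⟨x, rfl⟩ := Ideal.Quotient.mk_surjective (I := E.preIdeal φ U.unop) x
    refine Eq.trans ?_ (map_add (E''.O.presheaf.map i).hom _ _).symm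
    refine congrArg₂ (· + ·) (NatTrans.naturality_apply h.hom i x.fst)
      (Eq.trans ?_ (E''.ι_map i.unop _).symm)
    exact congrArg (E''.ι V.unop) (NatTrans.naturality_apply ψ.mapPresheaf i x.snd)

/-- A homomorphism `E → E''` over `ψ ∘ φ` factors through a homomorphism `φ_* E → E''` over `ψ`. -/
def HomOver.factor (hχ : φ ≫ ψ = χ) (h : HomOver χ E E'') :
    HomOver ψ ((pushforward φ).obj E) E'' :=
  have fac : E.unitPush φ ≫ sheafifyLift _ (h.preDesc hχ) E''.O.property = h.preDesc hχ :=
    toSheafify_sheafifyLift _ _ _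
  { hom := sheafifyLift _ (h.preDesc hχ) E''.O.property
    base := fun r => by
      refine (congrArg (fun g => g.app (op ⊤) ((E.toPre φ).app (op ⊤) (E.base r))) fac).trans ?_
      refine Eq.trans ?_ (h.base r)
      refine (congrArg (h.hom.app (op ⊤) (E.base r) + E''.ι ⊤ ·) (map_zero (ψ.app ⊤).hom)).trans ?_
      rw [map_zero, add_zero]
    π := unitPush_hom_ext (P := S.sheaf) φ _ _ (by
      refine (Category.assoc _ _ _).symm.trans ((congrArg (· ≫ E''.π) fac).trans ?_)
      refine Eq.trans ?_ (E.unitPush_pushπ φ).symm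
      ext U q
      obtain ⟨x, rfl⟩ := Ideal.Quotient.mk_surjective (I := E.preIdeal φ U) q
      refine (map_add (E''.π.app (op U)).hom (h.hom.app (op U) x.fst)
        (E''.ι U (ψ.app U x.snd))).trans ?_
      refine (congrArg₂ (· + ·) (HomOver.π_apply h x.fst) (E''.π_ι U _)).trans ?_
      exact add_zero _)
    ι := fun U m => by
      refine (congrArg (fun g => g.app (op U) (E.preι φ U m)) fac).trans ?_
      exact (congrArg (· + E''.ι U (ψ.app U m)) (map_zero (h.hom.app (op U)).hom)).trans
        (zero_add _) }

lemma HomOver.factor_toPush (hχ : φ ≫ ψ = χ) (h : HomOver χ E E'') {U : S.Opens}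
    (t : E.O.presheaf.obj (op U)) :
    (h.factor hχ).hom.app (op U) ((E.toPush φ).app (op U) t) = h.hom.app (op U) t := by
  have fac : E.unitPush φ ≫ sheafifyLift _ (h.preDesc hχ) E''.O.property = h.preDesc hχ :=
    toSheafify_sheafifyLift _ _ _
  refine (congrArg (fun g => g.app (op U) ((E.toPre φ).app (op U) t)) fac).trans ?_
  refine (congrArg (h.hom.app (op U) t + E''.ι U ·) (map_zero (ψ.app U).hom)).trans ?_
  rw [map_zero, add_zero]

end Factor

/-- The universal property of the pushforward: a homomorphism `E → E'` over `φ` factors through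
`φ_* E`. -/
def HomOver.desc (h : HomOver φ E E') : (pushforward φ).obj E ⟶ E' where
  hom := (h.factor (Category.comp_id φ)).hom
  base := (h.factor (Category.comp_id φ)).base
  π := (h.factor (Category.comp_id φ)).π
  ι := (h.factor (Category.comp_id φ)).ι

lemma HomOver.desc_toPush (h : HomOver φ E E') {U : S.Opens} (t : E.O.presheaf.obj (op U)) :
    h.desc.hom.app (op U) ((E.toPush φ).app (op U) t) = h.hom.app (op U) t :=
  h.factor_toPush _ t

/-- The composite of a morphism of extensions and a homomorphism over `φ`. -/
def HomOver.precomp {C : SqZeroExt ρ M'} {E₁ : SqZeroExt ρ M} (h : E₁ ⟶ E) (a : HomOver φ E C) :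
    HomOver φ E₁ C where
  hom := h.hom ≫ a.hom
  base r := (congrArg (a.hom.app (op ⊤)) (h.base r)).trans (a.base r)
  π := by rw [Category.assoc, a.π, h.π]
  ι U m := (congrArg (a.hom.app (op U)) (h.ι U m)).trans (a.ι U m)

lemma HomOver.map_desc {C : SqZeroExt ρ M'} {E₁ : SqZeroExt ρ M} (a : HomOver φ E₁ C) (h : E₁ ⟶ E)
    (a' : HomOver φ E C) (e : h.hom ≫ a'.hom = a.hom) :
    (pushforward φ).map h ≫ a'.desc = a.desc := pushforward_hom_ext fun U t => by
  have e₁ : ((pushforward φ).map h ≫ a'.desc).hom.app (op U) ((E₁.toPush φ).app (op U) t) =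
      a'.desc.hom.app (op U) (((pushforward φ).map h).hom.app (op U) ((E₁.toPush φ).app (op U) t)) :=
    rfl
  rw [e₁, toPush_map, desc_toPush, desc_toPush, ← e]
  rfl

end Desc
end SqZeroExt

/-! ### Baer differences -/

namespace SqZeroExt
variable {R : Type u} [CommRing R] {S : Scheme.{u}} {ρ : R →+* Γ(S, ⊤)} {M : S.Modules}

section Baer
variable {E₁ E₂ E₂' : SqZeroExt ρ M} {U V : S.Opens}

lemma π_map_eq (t₁ : E₁.O.presheaf.obj (op U)) (t₂ : E₂.O.presheaf.obj (op U))
    (h : E₁.π.app (op U) t₁ = E₂.π.app (op U) t₂) (i : V ⟶ U) :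
    E₁.π.app (op V) (E₁.O.presheaf.map i.op t₁) = E₂.π.app (op V) (E₂.O.presheaf.map i.op t₂) := by
  rw [NatTrans.naturality_apply, NatTrans.naturality_apply, h]

lemma sub_map (t₁ : E₁.O.presheaf.obj (op U)) (t₂ : E₂.O.presheaf.obj (op U))
    (h : E₁.π.app (op U) t₁ = E₂.π.app (op U) t₂) (i : V ⟶ U) :
    ((baerSub E₁).obj E₂).O.presheaf.map i.op (sub E₁ E₂ t₁ t₂ h) =
      sub E₁ E₂ (E₁.O.presheaf.map i.op t₁) (E₂.O.presheaf.map i.op t₂) (π_map_eq t₁ t₂ h i) :=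
  (NatTrans.naturality_apply ((fiberProd E₁ E₂).toPush _) i.op _).symm

lemma sub_π (t₁ : E₁.O.presheaf.obj (op U)) (t₂ : E₂.O.presheaf.obj (op U))
    (h : E₁.π.app (op U) t₁ = E₂.π.app (op U) t₂) :
    ((baerSub E₁).obj E₂).π.app (op U) (sub E₁ E₂ t₁ t₂ h) = E₁.π.app (op U) t₁ :=
  toPush_π_apply _ _

lemma sub_base (r : R) : ((baerSub E₁).obj E₂).base r =
    sub E₁ E₂ (E₁.base r) (E₂.base r) ((E₁.π_base r).trans (E₂.π_base r).symm) := rfl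

open Limits in
lemma sub_ι (m n : Γ(M, U)) : sub E₁ E₂ (E₁.ι U m) (E₂.ι U n)
    ((E₁.π_ι U m).trans (E₂.π_ι U n).symm) = ((baerSub E₁).obj E₂).ι U (m - n) := by
  let b : Γ(M ⊞ M, U) := (biprod.inl : M ⟶ M ⊞ M).app U m + (biprod.inr : M ⟶ M ⊞ M).app U n
  have h₁ : (biprod.fst : M ⊞ M ⟶ M).app U b = m := by
    simp only [b]
    rw [map_add, ← ConcreteCategory.comp_apply, ← ConcreteCategory.comp_apply,
      ← Modules.Hom.comp_app, ← Modules.Hom.comp_app]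
    simp
  have h₂ : (biprod.snd : M ⊞ M ⟶ M).app U b = n := by
    simp only [b]
    rw [map_add, ← ConcreteCategory.comp_apply, ← ConcreteCategory.comp_apply,
      ← Modules.Hom.comp_app, ← Modules.Hom.comp_app]
    simp
  have h₃ : (biprod.fst - biprod.snd : M ⊞ M ⟶ M).app U b = m - n := by
    rw [Modules.Hom.sub_app]
    exact congrArg₂ (· - ·) h₁ h₂
  have := toPush_ι (biprod.fst - biprod.snd : M ⊞ M ⟶ M) (fiberProd E₁ E₂) U b
  rw [h₃] at this
  refine Eq.trans ?_ this
  refine congrArg (((fiberProd E₁ E₂).toPush _).app (op U)) (Subtype.ext (Prod.ext ?_ ?_))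
  · exact congrArg (E₁.ι U) h₁.symm
  · exact congrArg (E₂.ι U) h₂.symm

open Limits in
variable (E₁ E₂ U) in
/-- The homomorphism `(t₁, t₂) ↦ t₁ - t₂` on sections. -/
def subHom : fiberSubring E₁ E₂ U →+* ((baerSub E₁).obj E₂).O.presheaf.obj (op U) :=
  (((fiberProd E₁ E₂).toPush (biprod.fst - biprod.snd : M ⊞ M ⟶ M)).app (op U)).hom

lemma sub_congr {t₁ t₁' : E₁.O.presheaf.obj (op U)} {t₂ t₂' : E₂.O.presheaf.obj (op U)}
    (h : E₁.π.app (op U) t₁ = E₂.π.app (op U) t₂) (e₁ : t₁ = t₁') (e₂ : t₂ = t₂') :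
    sub E₁ E₂ t₁ t₂ h = sub E₁ E₂ t₁' t₂' (e₁ ▸ e₂ ▸ h) := by
  subst e₁ e₂; rfl

lemma sub_add {t₁ t₁' : E₁.O.presheaf.obj (op U)} {t₂ t₂' : E₂.O.presheaf.obj (op U)}
    (h : E₁.π.app (op U) t₁ = E₂.π.app (op U) t₂)
    (h' : E₁.π.app (op U) t₁' = E₂.π.app (op U) t₂') :
    sub E₁ E₂ (t₁ + t₁') (t₂ + t₂') (by rw [map_add, map_add, h, h']) =
      sub E₁ E₂ t₁ t₂ h + sub E₁ E₂ t₁' t₂' h' :=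
  map_add (subHom E₁ E₂ U) ⟨(t₁, t₂), h⟩ ⟨(t₁', t₂'), h'⟩

lemma sub_mul {t₁ t₁' : E₁.O.presheaf.obj (op U)} {t₂ t₂' : E₂.O.presheaf.obj (op U)}
    (h : E₁.π.app (op U) t₁ = E₂.π.app (op U) t₂)
    (h' : E₁.π.app (op U) t₁' = E₂.π.app (op U) t₂') :
    sub E₁ E₂ (t₁ * t₁') (t₂ * t₂') (by rw [map_mul, map_mul, h, h']) =
      sub E₁ E₂ t₁ t₂ h * sub E₁ E₂ t₁' t₂' h' :=
  map_mul (subHom E₁ E₂ U) ⟨(t₁, t₂), h⟩ ⟨(t₁', t₂'), h'⟩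

lemma sub_one : sub E₁ E₂ (1 : E₁.O.presheaf.obj (op U)) 1 (by simp) = 1 :=
  map_one (subHom E₁ E₂ U)

lemma sub_zero' : sub E₁ E₂ (0 : E₁.O.presheaf.obj (op U)) 0 (by simp) = 0 :=
  map_zero (subHom E₁ E₂ U)

lemma baerSub_map_sub (f : E₂ ⟶ E₂') (t₁ : E₁.O.presheaf.obj (op U))
    (t₂ : E₂.O.presheaf.obj (op U)) (h : E₁.π.app (op U) t₁ = E₂.π.app (op U) t₂) :
    ((baerSub E₁).map f).hom.app (op U) (sub E₁ E₂ t₁ t₂ h) =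
      sub E₁ E₂' t₁ (f.hom.app (op U) t₂) (h.trans (f.π_apply t₂).symm) :=
  toPush_map _ (fiberProdMap (𝟙 E₁) f) _

lemma sub_add_ι {t₁ : E₁.O.presheaf.obj (op U)} {t₂ : E₂.O.presheaf.obj (op U)}
    (h : E₁.π.app (op U) t₁ = E₂.π.app (op U) t₂) (m n : Γ(M, U)) :
    sub E₁ E₂ (t₁ + E₁.ι U m) (t₂ + E₂.ι U n) (by rw [map_add, map_add, h, π_ι, π_ι]) =
      sub E₁ E₂ t₁ t₂ h + ((baerSub E₁).obj E₂).ι U (m - n) := by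
  rw [← sub_ι, ← sub_add]

/-- The sections of `E₁ ×_{𝒪_S} E₂` are determined by their image in `E₁ - E₂` up to the diagonal
of `M`. -/
lemma exists_of_sub_eq {t₁ t₁' : E₁.O.presheaf.obj (op U)} {t₂ t₂' : E₂.O.presheaf.obj (op U)}
    {h : E₁.π.app (op U) t₁ = E₂.π.app (op U) t₂}
    {h' : E₁.π.app (op U) t₁' = E₂.π.app (op U) t₂'}
    (e : sub E₁ E₂ t₁ t₂ h = sub E₁ E₂ t₁' t₂' h') :
    ∃ m, t₁ = t₁' + E₁.ι U m ∧ t₂ = t₂' + E₂.ι U m := by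
  have hπ : E₁.π.app (op U) t₁ = E₁.π.app (op U) t₁' := by rw [← sub_π t₁ t₂ h, e, sub_π]
  obtain ⟨m, rfl⟩ := exists_add_ι hπ
  obtain ⟨n, rfl⟩ := exists_add_ι (E := E₂) (t := t₂) (t' := t₂') (by rw [← h, ← h', hπ])
  rw [sub_add_ι h', add_eq_left] at e
  have : m = n := sub_eq_zero.1 (((baerSub E₁).obj E₂).ι_inj U (e.trans (map_zero _).symm))
  subst this
  exact ⟨m, rfl, rfl⟩

lemma sub_right_injective {t₁ : E₁.O.presheaf.obj (op U)} {t₂ t₂' : E₂.O.presheaf.obj (op U)}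
    {h : E₁.π.app (op U) t₁ = E₂.π.app (op U) t₂} {h' : E₁.π.app (op U) t₁ = E₂.π.app (op U) t₂'}
    (e : sub E₁ E₂ t₁ t₂ h = sub E₁ E₂ t₁ t₂' h') : t₂ = t₂' := by
  obtain ⟨m, hm, rfl⟩ := exists_of_sub_eq e
  rw [left_eq_add] at hm
  rw [E₁.ι_inj U (hm.trans (map_zero _).symm), map_zero, add_zero]

lemma exists_local_sub (z : ((baerSub E₁).obj E₂).O.presheaf.obj (op U)) (x : S) (hx : x ∈ U) :
    ∃ (V : S.Opens) (i : V ⟶ U) (t₁ : E₁.O.presheaf.obj (op V)) (t₂ : E₂.O.presheaf.obj (op V))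
      (h : E₁.π.app (op V) t₁ = E₂.π.app (op V) t₂), x ∈ V ∧
      ((baerSub E₁).obj E₂).O.presheaf.map i.op z = sub E₁ E₂ t₁ t₂ h := by
  obtain ⟨V, i, ⟨⟨s₁, s₂⟩, hs⟩, m, hV, hz⟩ := exists_local_toPush_add_ι z x hx
  have h := sub_add_ι (E₁ := E₁) (E₂ := E₂) (U := V) (t₁ := s₁) (t₂ := s₂) hs m 0
  rw [sub_zero] at h
  exact ⟨V, i, _, _, _, hV, hz.trans h.symm⟩

lemma sub_map_comp {W : S.Opens} {i : V ⟶ U} {t₁ : E₁.O.presheaf.obj (op U)}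
    {t₂ : E₂.O.presheaf.obj (op V)} {z : ((baerSub E₁).obj E₂).O.presheaf.obj (op U)}
    (h : E₁.π.app (op V) (E₁.O.presheaf.map i.op t₁) = E₂.π.app (op V) t₂)
    (e : sub E₁ E₂ _ _ h = ((baerSub E₁).obj E₂).O.presheaf.map i.op z) (j : W ⟶ V) (k : W ⟶ U) :
    ∃ h', sub E₁ E₂ (E₁.O.presheaf.map k.op t₁) (E₂.O.presheaf.map j.op t₂) h' =
      ((baerSub E₁).obj E₂).O.presheaf.map k.op z := by
  obtain rfl : k = j ≫ i := Subsingleton.elim _ _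
  have e₁ : E₁.O.presheaf.map j.op (E₁.O.presheaf.map i.op t₁) =
      E₁.O.presheaf.map (j ≫ i).op t₁ := by
    rw [← CommRingCat.comp_apply, ← Functor.map_comp]; rfl
  have e₂ : ((baerSub E₁).obj E₂).O.presheaf.map j.op
      (((baerSub E₁).obj E₂).O.presheaf.map i.op z) =
      ((baerSub E₁).obj E₂).O.presheaf.map (j ≫ i).op z := by
    rw [← CommRingCat.comp_apply, ← Functor.map_comp]; rfl
  rw [← e₂, ← e, sub_map]
  exact ⟨_, (sub_congr _ e₁ rfl).symm⟩

/-- A section `z` of `E₁ - E₂` and a section `t₁` of `E₁` with the same image in `𝒪_S` determine a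
section `t₂` of `E₂` with `z = t₁ - t₂`: such a `t₂` exists locally and is unique. -/
lemma exists_sub_eq (t₁ : E₁.O.presheaf.obj (op U))
    (z : ((baerSub E₁).obj E₂).O.presheaf.obj (op U))
    (h : E₁.π.app (op U) t₁ = ((baerSub E₁).obj E₂).π.app (op U) z) :
    ∃ t₂ h', sub E₁ E₂ t₁ t₂ h' = z := by
  have key : ∀ x : U, ∃ (V : S.Opens) (i : V ⟶ U) (t₂ : E₂.O.presheaf.obj (op V)), x.1 ∈ V ∧
      ∃ h', sub E₁ E₂ (E₁.O.presheaf.map i.op t₁) t₂ h' =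
        ((baerSub E₁).obj E₂).O.presheaf.map i.op z := by
    rintro ⟨x, hx⟩
    obtain ⟨V, i, s₁, s₂, hs, hV, hz⟩ := exists_local_sub z x hx
    have hπ : E₁.π.app (op V) (E₁.O.presheaf.map i.op t₁) = E₁.π.app (op V) s₁ := by
      rw [← sub_π s₁ s₂ hs, ← hz, NatTrans.naturality_apply, NatTrans.naturality_apply, h]
    -- Shifting both `s₁` and `s₂` by `n` does not change `s₁ - s₂`.
    obtain ⟨n, hn⟩ := exists_add_ι hπ
    have h1 := (sub_add_ι (E₁ := E₁) (E₂ := E₂) hs n n).trans (by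
      rw [sub_self, map_zero, add_zero])
    refine ⟨V, i, s₂ + E₂.ι V n, hV, ?_, ?_⟩
    · rw [hπ, map_add, π_ι, add_zero]; exact hs
    · rw [hz]
      exact (sub_congr _ hn rfl).trans h1
  choose V i t₂ hV h' ht using key
  obtain ⟨s, hs, -⟩ := TopCat.Sheaf.existsUnique_gluing' E₂.O V U i
    (fun x hx => Opens.mem_iSup.2 ⟨⟨x, hx⟩, hV _⟩) t₂ (fun x y => by
      obtain ⟨_, e₁⟩ := sub_map_comp (h' x) (ht x) (homOfLE inf_le_left)
        (homOfLE inf_le_left ≫ i x : V x ⊓ V y ⟶ U)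
      obtain ⟨_, e₂⟩ := sub_map_comp (h' y) (ht y) (homOfLE inf_le_right)
        (homOfLE inf_le_left ≫ i x : V x ⊓ V y ⟶ U)
      exact sub_right_injective (e₁.trans e₂.symm))
  have hπ : E₁.π.app (op U) t₁ = E₂.π.app (op U) s := by
    refine TopCat.Sheaf.eq_of_locally_eq' S.sheaf V U i
      (fun x hx => Opens.mem_iSup.2 ⟨⟨x, hx⟩, hV _⟩) _ _ fun x => ?_
    refine (NatTrans.naturality_apply E₁.π (i x).op t₁).symm.trans ((h' x).trans ?_)
    rw [← hs x]
    exact NatTrans.naturality_apply E₂.π (i x).op s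
  refine ⟨s, hπ, TopCat.Sheaf.eq_of_locally_eq' ((baerSub E₁).obj E₂).O V U i
    (fun x hx => Opens.mem_iSup.2 ⟨⟨x, hx⟩, hV _⟩) _ _ fun x => ?_⟩
  refine Eq.trans ?_ (ht x)
  exact (sub_map t₁ s hπ (i x)).trans (sub_congr _ rfl (hs x))

end Baer
end SqZeroExt

/-! ### The double Baer difference and restriction of scalars -/

namespace SqZeroExt
variable {R : Type u} [CommRing R] {S : Scheme.{u}} {ρ : R →+* Γ(S, ⊤)} {M : S.Modules}

section Double
variable {W G G' : SqZeroExt ρ M} {U V : S.Opens}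

variable (W G) in
/-- The section `w - (w - g)` of `W - (W - G)`. It does not depend on `w`. -/
def dsub (w : W.O.presheaf.obj (op U)) (g : G.O.presheaf.obj (op U))
    (h : W.π.app (op U) w = G.π.app (op U) g) :
    ((baerSub W).obj ((baerSub W).obj G)).O.presheaf.obj (op U) :=
  sub W ((baerSub W).obj G) w (sub W G w g h) (sub_π w g h).symm

lemma dsub_eq_dsub {w w' : W.O.presheaf.obj (op U)} {g : G.O.presheaf.obj (op U)}
    (h : W.π.app (op U) w = G.π.app (op U) g) (h' : W.π.app (op U) w' = G.π.app (op U) g) :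
    dsub W G w g h = dsub W G w' g h' := by
  obtain ⟨m, rfl⟩ := exists_add_ι (h.trans h'.symm)
  have e₁ : sub W G (w' + W.ι U m) g h = sub W G w' g h' + ((baerSub W).obj G).ι U m := by
    refine (sub_congr h rfl (show g = g + G.ι U 0 by rw [map_zero, add_zero])).trans ?_
    refine (sub_add_ι h' m 0).trans ?_
    rw [sub_zero]
  refine (sub_congr _ rfl e₁).trans ((sub_add_ι (sub_π w' g h').symm m m).trans ?_)
  rw [sub_self, map_zero, add_zero]
  rfl

lemma dsub_add {w w' : W.O.presheaf.obj (op U)} {g g' : G.O.presheaf.obj (op U)}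
    (h : W.π.app (op U) w = G.π.app (op U) g) (h' : W.π.app (op U) w' = G.π.app (op U) g') :
    dsub W G (w + w') (g + g') (by rw [map_add, map_add, h, h']) =
      dsub W G w g h + dsub W G w' g' h' :=
  (sub_congr _ rfl (sub_add h h')).trans (sub_add _ _)

lemma dsub_mul {w w' : W.O.presheaf.obj (op U)} {g g' : G.O.presheaf.obj (op U)}
    (h : W.π.app (op U) w = G.π.app (op U) g) (h' : W.π.app (op U) w' = G.π.app (op U) g') :
    dsub W G (w * w') (g * g') (by rw [map_mul, map_mul, h, h']) =
      dsub W G w g h * dsub W G w' g' h' :=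
  (sub_congr _ rfl (sub_mul h h')).trans (sub_mul _ _)

lemma dsub_ι (m : Γ(M, U)) : dsub W G (W.ι U 0) (G.ι U m) ((W.π_ι U 0).trans (G.π_ι U m).symm) =
    ((baerSub W).obj ((baerSub W).obj G)).ι U m :=
  (sub_congr _ rfl (sub_ι 0 m)).trans ((sub_ι 0 (0 - m)).trans (by simp))

lemma dsub_map (w : W.O.presheaf.obj (op U)) (g : G.O.presheaf.obj (op U))
    (h : W.π.app (op U) w = G.π.app (op U) g) (i : V ⟶ U) :
    ((baerSub W).obj ((baerSub W).obj G)).O.presheaf.map i.op (dsub W G w g h) =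
      dsub W G (W.O.presheaf.map i.op w) (G.O.presheaf.map i.op g) (π_map_eq w g h i) :=
  (sub_map _ _ _ i).trans (sub_congr _ rfl (sub_map w g h i))

variable (W) in
/-- The isomorphism `G → W - (W - G)`, `g ↦ w - (w - g)`, for an extension `W` whose projection to
`𝒪_S` is surjective on sections. -/
def toDouble (hW : ∀ U : S.Opens, Function.Surjective (W.π.app (op U))) (G : SqZeroExt ρ M) :
    G ⟶ (baerSub W).obj ((baerSub W).obj G) where
  hom :=
    { app := fun U => CommRingCat.ofHom
        { toFun := fun g => dsub W G (U := U.unop) _ g (hW U.unop (G.π.app U g)).choose_spec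
          map_one' := by
            refine (dsub_eq_dsub (w' := 1) _ (by simp)).trans ?_
            exact (sub_congr _ rfl sub_one).trans sub_one
          map_mul' := fun g g' => by
            refine Eq.trans ?_ (dsub_mul _ _)
            exact dsub_eq_dsub _ _
          map_zero' := by
            refine (dsub_eq_dsub (w' := 0) _ (by simp)).trans ?_
            exact (sub_congr _ rfl sub_zero').trans sub_zero'
          map_add' := fun g g' => by
            refine Eq.trans ?_ (dsub_add _ _)
            exact dsub_eq_dsub _ _ }
      naturality := fun U V i => by
        ext g
        refine Eq.trans ?_ (dsub_map (U := U.unop) (V := V.unop) _ g _ i.unop).symm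
        exact dsub_eq_dsub (U := V.unop) _ _ }
  base r := dsub_eq_dsub (w' := W.base r) _ ((W.π_base r).trans (G.π_base r).symm)
  π := by
    ext U g
    exact (sub_π _ _ _).trans (hW U (G.π.app (op U) g)).choose_spec
  ι U m := (dsub_eq_dsub _ _).trans (dsub_ι m)

lemma toDouble_apply (hW : ∀ U : S.Opens, Function.Surjective (W.π.app (op U)))
    (w : W.O.presheaf.obj (op U)) (g : G.O.presheaf.obj (op U))
    (h : W.π.app (op U) w = G.π.app (op U) g) :
    (toDouble W hW G).hom.app (op U) g = dsub W G w g h := dsub_eq_dsub _ _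

variable (W) in
/-- Taking the Baer difference with `W` is an involution up to isomorphism. -/
def doubleIso (hW : ∀ U : S.Opens, Function.Surjective (W.π.app (op U))) :
    𝟭 (SqZeroExt ρ M) ≅ baerSub W ⋙ baerSub W :=
  NatIso.ofComponents (fun G => asIso (toDouble W hW G)) (fun {G G'} f => by
    refine Hom.ext ?_
    ext U g
    obtain ⟨w, hw⟩ := hW U (G.π.app (op U) g)
    have hw' : W.π.app (op U) w = G'.π.app (op U) (f.hom.app (op U) g) := by rw [f.π_apply, hw]
    refine (toDouble_apply hW w (f.hom.app (op U) g) hw').trans ?_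
    refine Eq.trans ?_ (congrArg (((baerSub W).map ((baerSub W).map f)).hom.app (op U))
      (toDouble_apply hW w g hw)).symm
    refine Eq.trans ?_ (baerSub_map_sub _ _ _ _).symm
    exact sub_congr _ rfl (baerSub_map_sub f w g hw).symm)

lemma doubleIso_hom_apply (hW : ∀ U : S.Opens, Function.Surjective (W.π.app (op U)))
    (w : W.O.presheaf.obj (op U)) (g : G.O.presheaf.obj (op U))
    (h : W.π.app (op U) w = G.π.app (op U) g) :
    ((doubleIso W hW).hom.app G).hom.app (op U) g = dsub W G w g h := dsub_eq_dsub _ _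

lemma doubleIso_inv_apply (hW : ∀ U : S.Opens, Function.Surjective (W.π.app (op U)))
    (w : W.O.presheaf.obj (op U)) (g : G.O.presheaf.obj (op U))
    (h : W.π.app (op U) w = G.π.app (op U) g) :
    ((doubleIso W hW).inv.app G).hom.app (op U) (dsub W G w g h) = g := by
  rw [← doubleIso_hom_apply hW w g h]
  exact congrArg (fun f => Hom.hom f |>.app (op U) g) ((doubleIso W hW).hom_inv_id_app G)

end Double

section RestrictScalars
variable {R' : Type u} [CommRing R'] {g : R' →+* R} {E E' : SqZeroExt ρ M}

/-- Restriction of scalars along a surjection is full: its morphisms are automatically linear. -/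
def homOfRestrictScalars (hg : Function.Surjective g)
    (f : (restrictScalars g).obj E ⟶ (restrictScalars g).obj E') : E ⟶ E' where
  hom := f.hom
  base r := by
    obtain ⟨r, rfl⟩ := hg r
    exact f.base r
  π := f.π
  ι := f.ι

/-- An extension of `R'`-algebras that descends to `R` is the restriction of scalars of its
descent. -/
def descendIso {E : SqZeroExt (ρ.comp g) M} (hg : Function.Surjective g)
    (h : ∀ r, g r = 0 → E.base r = 0) : E ≅ (restrictScalars g).obj (descend g hg E h) :=
  have key (r : R') : E.base r = (descend g hg E h).base (g r) :=
    (RingHom.liftOfRightInverse_comp_apply g _ (Function.rightInverse_surjInv hg) ⟨E.base, h⟩ r).symm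
  { hom := ⟨𝟙 _, key, Category.id_comp _, fun _ _ => rfl⟩
    inv := ⟨𝟙 _, fun r => (key r).symm, Category.id_comp _, fun _ _ => rfl⟩
    hom_inv_id := Hom.ext (Category.id_comp _)
    inv_hom_id := Hom.ext (Category.id_comp _) }

/-- Functoriality of the descent to `R`. -/
def descendMap {E E' : SqZeroExt (ρ.comp g) M} (hg : Function.Surjective g)
    (h : ∀ r, g r = 0 → E.base r = 0) (h' : ∀ r, g r = 0 → E'.base r = 0) (f : E ⟶ E') :
    descend g hg E h ⟶ descend g hg E' h' where
  hom := f.hom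
  base r := by
    obtain ⟨r, rfl⟩ := hg r
    exact (congrArg (f.hom.app (op ⊤)) ((descendIso hg h).hom.base r).symm).trans
      ((f.base r).trans ((descendIso hg h').hom.base r))
  π := f.π
  ι := f.ι

lemma descendIso_naturality {E E' : SqZeroExt (ρ.comp g) M} (hg : Function.Surjective g)
    (h : ∀ r, g r = 0 → E.base r = 0) (h' : ∀ r, g r = 0 → E'.base r = 0) (f : E ⟶ E') :
    f ≫ (descendIso hg h').hom =
      (descendIso hg h).hom ≫ (restrictScalars g).map (descendMap hg h h' f) :=
  Hom.ext ((Category.comp_id f.hom).trans (Category.id_comp f.hom).symm)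

lemma descendMap_id {E : SqZeroExt (ρ.comp g) M} (hg : Function.Surjective g)
    (h : ∀ r, g r = 0 → E.base r = 0) : descendMap hg h h (𝟙 E) = 𝟙 _ := rfl

lemma descendMap_comp {E E' E'' : SqZeroExt (ρ.comp g) M} (hg : Function.Surjective g)
    (h : ∀ r, g r = 0 → E.base r = 0) (h' : ∀ r, g r = 0 → E'.base r = 0)
    (h'' : ∀ r, g r = 0 → E''.base r = 0) (f : E ⟶ E') (f' : E' ⟶ E'') :
    descendMap hg h h'' (f ≫ f') = descendMap hg h h' f ≫ descendMap hg h' h'' f' := rfl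

/-- A homomorphism over `φ` from an extension that descends to `R` is linear over `R`. -/
def HomOver.descend {M' : S.Modules} {φ : M ⟶ M'} {E : SqZeroExt (ρ.comp g) M}
    {C : SqZeroExt ρ M'} (hg : Function.Surjective g) (h : ∀ r, g r = 0 → E.base r = 0)
    (a : HomOver φ E ((restrictScalars g).obj C)) : HomOver φ (descend g hg E h) C where
  hom := a.hom
  base r := by
    obtain ⟨r, rfl⟩ := hg r
    exact (congrArg (a.hom.app (op ⊤)) ((descendIso hg h).hom.base r).symm).trans (a.base r)
  π := a.π
  ι := a.ι

lemma HomOver.descend_map_desc {M' : S.Modules} {φ : M ⟶ M'} {E E' : SqZeroExt (ρ.comp g) M}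
    {C : SqZeroExt ρ M'} (hg : Function.Surjective g) (h : ∀ r, g r = 0 → E.base r = 0)
    (h' : ∀ r, g r = 0 → E'.base r = 0) (f : E ⟶ E')
    (a : HomOver φ E ((restrictScalars g).obj C)) (a' : HomOver φ E' ((restrictScalars g).obj C))
    (e : f.hom ≫ a'.hom = a.hom) :
    (pushforward φ).map (descendMap hg h h' f) ≫ (a'.descend hg h').desc =
      (a.descend hg h).desc :=
  (a.descend hg h).map_desc _ (a'.descend hg h') e

end RestrictScalars

end SqZeroExt

/-! ### Baer differences with a pushforward along a map that a second map kills -/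

namespace SqZeroExt
variable {R : Type u} [CommRing R] {S : Scheme.{u}} {ρ : R →+* Γ(S, ⊤)} {M M' M'' : S.Modules}

section Trivial

variable (M) in
/-- The presheaf of rings `U ↦ 𝒪_S(U) ⊕ M(U)`. -/
def trivPresheaf : TopCat.Presheaf CommRingCat.{u} S.carrier where
  obj U := .of (TrivExt (RingHom.id Γ(S, U.unop)) Γ(M, U.unop))
  map {U V} i := CommRingCat.ofHom (TrivExt.map (S.presheaf.map i).hom (S.presheaf.map i).hom
    (M.presheaf.map i).hom (fun _ => rfl) (fun x y => Modules.map_smul M i.unop x y))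
  map_id U := by
    refine CommRingCat.hom_ext (RingHom.ext fun x => TrivExt.ext ?_ ?_)
    · exact congrArg (fun g => g.hom x.fst) (S.presheaf.map_id U)
    · exact congrArg (fun g => g.hom x.snd) (M.presheaf.map_id U)
  map_comp i j := by
    refine CommRingCat.hom_ext (RingHom.ext fun x => TrivExt.ext ?_ ?_)
    · exact congrArg (fun g => g.hom x.fst) (S.presheaf.map_comp i j)
    · exact congrArg (fun g => g.hom x.snd) (M.presheaf.map_comp i j)

variable (M) in
lemma trivPresheaf_isSheaf : (trivPresheaf M).IsSheaf := by
  rw [TopCat.Presheaf.isSheaf_iff_isSheafUniqueGluing]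
  intro I U sf hsf
  obtain ⟨g₁, h₁, h₁'⟩ := S.sheaf.existsUnique_gluing U (fun i => (sf i).fst)
    (fun i j => congrArg (fun z => z.fst) (hsf i j))
  obtain ⟨g₂, h₂, h₂'⟩ := TopCat.Sheaf.existsUnique_gluing ⟨M.presheaf, M.isSheaf⟩ U
    (fun i => (sf i).snd) (fun i j => congrArg (fun z => z.snd) (hsf i j))
  exact ⟨⟨g₁, g₂⟩, fun i => TrivExt.ext (h₁ i) (h₂ i), fun y hy => TrivExt.ext
    (h₁' _ fun i => congrArg (fun z => z.fst) (hy i))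
    (h₂' _ fun i => congrArg (fun z => z.snd) (hy i))⟩

variable (M) in
/-- The homomorphism `a ↦ (a, 0)`. -/
def trivInl (U : S.Opens) : Γ(S, U) →+* TrivExt (RingHom.id Γ(S, U)) Γ(M, U) where
  toFun a := ⟨a, 0⟩
  map_one' := rfl
  map_mul' _ _ := TrivExt.ext rfl (by simp)
  map_zero' := rfl
  map_add' _ _ := TrivExt.ext rfl (by simp)

variable (ρ M) in
/-- The trivial square-zero extension `𝒪_S ⊕ M`. -/
def triv : SqZeroExt ρ M where
  O := ⟨trivPresheaf M, trivPresheaf_isSheaf M⟩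
  π :=
    { app := fun U => CommRingCat.ofHom
        { toFun := fun x => x.fst
          map_one' := rfl
          map_mul' := fun _ _ => rfl
          map_zero' := rfl
          map_add' := fun _ _ => rfl } }
  base := (trivInl M ⊤).comp ρ
  π_base _ := rfl
  π_surj := by
    rw [TopCat.Presheaf.isLocallySurjective_iff]
    intro U t x hx
    exact ⟨U, le_rfl, ⟨⟨_, 0⟩, rfl⟩, hx⟩
  ι U :=
    { toFun := fun m => ⟨0, m⟩
      map_zero' := rfl
      map_add' := fun _ _ => TrivExt.ext (add_zero _).symm rfl }
  ι_map i m := TrivExt.ext (map_zero (S.presheaf.map i.op).hom) rfl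
  ι_inj U a b h := congrArg TrivExt.snd h
  exact U t := ⟨fun h => ⟨t.snd, TrivExt.ext h.symm rfl⟩, by rintro ⟨m, rfl⟩; rfl⟩
  ι_smul U t m := TrivExt.ext (mul_zero _).symm (by
    refine Eq.trans ?_ (congrArg (_ + ·) (zero_smul Γ(S, U) t.snd).symm)
    exact (add_zero _).symm)

/-- The homomorphism `t ↦ (π t, 0)` over the zero map. -/
def toTriv (E : SqZeroExt ρ M) {χ : M ⟶ M'} (hχ : χ = 0) : HomOver χ E (triv ρ M') where
  hom :=
    { app := fun U => CommRingCat.ofHom ((trivInl M' U.unop).comp (E.π.app U).hom)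
      naturality := fun U V i => by
        ext t
        exact TrivExt.ext (NatTrans.naturality_apply E.π i t) (map_zero (M'.presheaf.map i).hom).symm }
  base r := TrivExt.ext (E.π_base r) rfl
  π := rfl
  ι U m := by
    subst hχ
    exact TrivExt.ext (E.π_ι U m) rfl

/-- The second coordinate of a section of `𝒪_S ⊕ M`. -/
def trivSnd {U : S.Opens} (t : (triv ρ M).O.presheaf.obj (op U)) : Γ(M, U) :=
  (show TrivExt (RingHom.id Γ(S, U)) Γ(M, U) from t).snd

section
variable {U V : S.Opens}

lemma trivSnd_mul (s t : (triv ρ M).O.presheaf.obj (op U)) : trivSnd (s * t) =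
    (show Γ(S, U) from (triv ρ M).π.app (op U) s) • trivSnd t +
      (show Γ(S, U) from (triv ρ M).π.app (op U) t) • trivSnd s := rfl

lemma trivSnd_add (s t : (triv ρ M).O.presheaf.obj (op U)) :
    trivSnd (s + t) = trivSnd s + trivSnd t := rfl

lemma trivSnd_one : trivSnd (1 : (triv ρ M).O.presheaf.obj (op U)) = 0 := rfl

lemma trivSnd_zero : trivSnd (0 : (triv ρ M).O.presheaf.obj (op U)) = 0 := rfl

lemma trivSnd_ι (m : Γ(M, U)) : trivSnd ((triv ρ M).ι U m) = m := rfl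

end

section
variable {ψ : M ⟶ M'} {W G : SqZeroExt ρ M} {C : SqZeroExt ρ M'}

/-- The homomorphism `(w, g) ↦ a w - q g` on sections of `W ×_{𝒪_S} G`, for homomorphisms
`a : W → C` and `q : G → 𝒪_S ⊕ M'` over `ψ : M → M'`. -/
def subTrivHom (a : HomOver ψ W C) (q : HomOver ψ G (triv ρ M')) (U : S.Opens) :
    fiberSubring W G U →+* C.O.presheaf.obj (op U) where
  toFun x := a.hom.app (op U) x.1.1 - C.ι U (trivSnd (q.hom.app (op U) x.1.2))
  map_one' := by
    refine (congrArg₂ (fun s t => s - C.ι U (trivSnd t)) (map_one (a.hom.app (op U)).hom)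
      (map_one (q.hom.app (op U)).hom)).trans ?_
    rw [trivSnd_one, map_zero, sub_zero]
  map_zero' := by
    refine (congrArg₂ (fun s t => s - C.ι U (trivSnd t)) (map_zero (a.hom.app (op U)).hom)
      (map_zero (q.hom.app (op U)).hom)).trans ?_
    rw [trivSnd_zero, map_zero, sub_zero]
  map_add' x y := by
    refine (congrArg₂ (fun s t => s - C.ι U (trivSnd t)) (map_add (a.hom.app (op U)).hom _ _)
      (map_add (q.hom.app (op U)).hom _ _)).trans ?_
    rw [trivSnd_add, map_add]
    exact add_sub_add_comm _ _ _ _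
  map_mul' x y := by
    refine (congrArg₂ (fun s t => s - C.ι U (trivSnd t)) (map_mul (a.hom.app (op U)).hom _ _)
      (map_mul (q.hom.app (op U)).hom _ _)).trans ?_
    have e (z : fiberSubring W G U) : (triv ρ M').π.app (op U) (q.hom.app (op U) z.1.2) =
        C.π.app (op U) (a.hom.app (op U) z.1.1) :=
      (q.π_apply z.1.2).trans (z.2.symm.trans (a.π_apply z.1.1).symm)
    rw [trivSnd_mul, e, e, map_add, C.ι_smul, C.ι_smul]
    have key (A B I J : C.O.presheaf.obj (op U)) (h : I * J = 0) :
        A * B - (A * J + B * I) = (A - I) * (B - J) := by linear_combination - h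
    exact key _ _ _ _ (C.ι_mul_ι U _ _)

open Limits in
/-- The homomorphism `(w, g) ↦ a w - q g` on `W ×_{𝒪_S} G`, for homomorphisms `a : W → C` and
`q : G → 𝒪_S ⊕ M'` over `ψ : M → M'`. -/
def subTriv (a : HomOver ψ W C) (q : HomOver ψ G (triv ρ M')) :
    HomOver ((biprod.fst - biprod.snd : M ⊞ M ⟶ M) ≫ ψ) (fiberProd W G) C where
  hom :=
    { app := fun U => CommRingCat.ofHom (subTrivHom a q U.unop)
      naturality := fun U V i => by
        ext x
        refine Eq.trans ?_ (map_sub (C.O.presheaf.map i).hom _ _).symm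
        refine congrArg₂ (· - ·) (NatTrans.naturality_apply a.hom i x.1.1) ?_
        refine Eq.trans ?_ (C.ι_map i.unop _).symm
        exact congrArg (fun t => C.ι V.unop (trivSnd t)) (NatTrans.naturality_apply q.hom i x.1.2) }
  base r := by
    refine (congrArg₂ (fun s t => s - C.ι ⊤ (trivSnd t)) (a.base r) (q.base r)).trans ?_
    exact (congrArg (C.base r - ·) (map_zero (C.ι ⊤))).trans (sub_zero _)
  π := by
    ext U x
    refine (map_sub (C.π.app (op U)).hom _ _).trans ?_
    refine (congrArg₂ (· - ·) (a.π_apply x.1.1) (C.π_ι U _)).trans (sub_zero _)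
  ι U m := by
    refine (congrArg₂ (fun s t => s - C.ι U (trivSnd t)) (a.ι U _) (q.ι U _)).trans ?_
    rw [trivSnd_ι, ← map_sub, ← map_sub, Modules.Hom.comp_app, Modules.Hom.sub_app]
    rfl

/-- The homomorphism `w - g ↦ a w - q g` on `W - G`, for homomorphisms `a : W → C` and
`q : G → 𝒪_S ⊕ M'` over `ψ : M → M'`. -/
def baerSubTriv (a : HomOver ψ W C) (q : HomOver ψ G (triv ρ M')) :
    HomOver ψ ((baerSub W).obj G) C := (subTriv a q).factor rfl

lemma baerSubTriv_sub (a : HomOver ψ W C) (q : HomOver ψ G (triv ρ M')) {U : S.Opens}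
    (w : W.O.presheaf.obj (op U)) (g : G.O.presheaf.obj (op U))
    (h : W.π.app (op U) w = G.π.app (op U) g) :
    (baerSubTriv a q).hom.app (op U) (sub W G w g h) =
      a.hom.app (op U) w - C.ι U (trivSnd (q.hom.app (op U) g)) :=
  HomOver.factor_toPush rfl (subTriv a q) _

/-- For `φ : M → M'` and `ψ : M' → M''` with `ψ ∘ φ = 0`, the homomorphism `w - ȳ ↦ a w` on
`W - φ_* E`. -/
def baerSubPush {φ : M'' ⟶ M} (hφ : φ ≫ ψ = 0) (a : HomOver ψ W C) (E : SqZeroExt ρ M'') :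
    HomOver ψ ((baerSub W).obj ((pushforward φ).obj E)) C :=
  baerSubTriv a ((toTriv E (M' := M') (χ := φ ≫ ψ) hφ).factor rfl)

lemma baerSubPush_sub {φ : M'' ⟶ M} (hφ : φ ≫ ψ = 0) (a : HomOver ψ W C) {E : SqZeroExt ρ M''}
    {U : S.Opens} (w : W.O.presheaf.obj (op U)) (y : E.O.presheaf.obj (op U))
    (h : W.π.app (op U) w = ((pushforward φ).obj E).π.app (op U) ((E.toPush φ).app (op U) y)) :
    (baerSubPush hφ a E).hom.app (op U) (sub W _ w ((E.toPush φ).app (op U) y) h) =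
      a.hom.app (op U) w := by
  refine (baerSubTriv_sub _ _ _ _ _).trans ?_
  rw [HomOver.factor_toPush]
  exact (congrArg (_ - ·) (map_zero (C.ι U))).trans (sub_zero _)

/-- Homomorphisms over `ψ` from `W - φ_* E` that agree on the sections `w - ȳ` are equal. -/
lemma baerSubPush_hom_ext {φ : M'' ⟶ M} {E : SqZeroExt ρ M''}
    (hW : ∀ U : S.Opens, Function.Surjective (W.π.app (op U)))
    {f g : HomOver ψ ((baerSub W).obj ((pushforward φ).obj E)) C}
    (h : ∀ (U : S.Opens) (w : W.O.presheaf.obj (op U)) (y : E.O.presheaf.obj (op U)) (h),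
      f.hom.app (op U) (sub W _ w ((E.toPush φ).app (op U) y) h) =
        g.hom.app (op U) (sub W _ w ((E.toPush φ).app (op U) y) h)) : f.hom = g.hom := by
  -- A section of `W - φ_* E` is `w - x`, and locally `x = ȳ + ι m`.
  ext U z
  change f.hom.app (op U) z = g.hom.app (op U) z
  obtain ⟨w, hw⟩ := hW U (((baerSub W).obj _).π.app (op U) z)
  obtain ⟨x, hx, rfl⟩ := exists_sub_eq w z hw
  choose V i t m hV e using fun y : U => exists_local_toPush_add_ι x y.1 y.2
  refine TopCat.Sheaf.eq_of_locally_eq' C.O V U i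
    (fun x hx => Opens.mem_iSup.2 ⟨⟨x, hx⟩, hV _⟩) _ _ fun y => ?_
  have he : W.π.app (op (V y)) (W.O.presheaf.map (i y).op w) =
      ((pushforward φ).obj E).π.app (op (V y)) ((E.toPush φ).app (op (V y)) (t y)) := by
    rw [π_map_eq w x hx (i y), e y, map_add, π_ι, add_zero]
  have hy : sub W ((pushforward φ).obj E) (W.O.presheaf.map (i y).op w)
      (((pushforward φ).obj E).O.presheaf.map (i y).op x) (π_map_eq w x hx (i y)) =
      sub W _ (W.O.presheaf.map (i y).op w) ((E.toPush φ).app (op (V y)) (t y)) he +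
        ((baerSub W).obj ((pushforward φ).obj E)).ι (V y) (0 - m y) := by
    rw [← sub_add_ι]
    exact sub_congr _ (by rw [map_zero, add_zero]) (e y)
  refine (NatTrans.naturality_apply f.hom (i y).op _).symm.trans (Eq.trans ?_
    (NatTrans.naturality_apply g.hom (i y).op _))
  rw [sub_map, hy, map_add, map_add, h _ _ _ he, f.ι, g.ι]
end

end Trivial
end SqZeroExt

/-! ### From lifts to extensions of `S` by `Frob_* 𝒪_S` -/

section Phi
variable (p : ℕ) [hp : Fact p.Prime] {k : Type u} [Field k] [CharP k p] {S : Scheme.{u}}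
  (s : S ⟶ Spec (.of k))

lemma EW₂_π_surjective (U : S.Opens) : Function.Surjective ((EW₂ p s).π.app (op U)) :=
  W₂.res_surjective p

lemma frobMap_dMap : frobMap p S (cast_eq_zero_of_over p s) ≫
    dMap p S (cast_eq_zero_of_over p s) = 0 := Limits.cokernel.condition _

variable {p s}

/-- The element `(0, b ^ p)` of `W₂(k)` is `p x` for every `x` over `b`, so that its image in a flat
lift is that of `b` under the inclusion of the ideal. -/
lemma FlatLift.base_eq_ι (E : FlatLift p s) (b : k) :
    E.obj.base (W₂.ver p (frobenius k p b)) = E.obj.ι ⊤ (show Γ(𝒪 S, ⊤) from structHom s b) := by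
  obtain ⟨x, rfl⟩ := W₂.res_surjective p b
  have h : W₂.ver p (frobenius k p (W₂.res p x)) = (p : W₂ p k) * x :=
    (W₂.natCast_mul p (CharP.cast_eq_zero k p) x).symm
  rw [h, map_mul, map_natCast, E.property.2 ⊤]
  exact congrArg (E.obj.ι ⊤) (E.obj.π_base x)

variable (p s) in
/-- The functor `E ↦ EW₂(S) - Frob_* E`, with values in extensions over `W₂(k)`. -/
abbrev FlatLift.diff : FlatLift p s ⥤
    SqZeroExt ((structHom s).comp (W₂.res p)) (frobO p S (cast_eq_zero_of_over p s)) :=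
  FlatLift.frobPush p s ⋙ SqZeroExt.baerSub (EW₂ p s)

/-- Two homomorphisms over `d` from `EW₂(S) - Frob_* E` that agree on the sections `w - ȳ` are
equal. -/
lemma FlatLift.diff_hom_ext {E : FlatLift p s}
    {C : SqZeroExt ((structHom s).comp (W₂.res p)) (B₁ p S (cast_eq_zero_of_over p s))}
    {f g : SqZeroExt.HomOver (dMap p S (cast_eq_zero_of_over p s)) ((FlatLift.diff p s).obj E) C}
    (h : ∀ (U : S.Opens) (w : (EW₂ p s).O.presheaf.obj (op U))
      (y : E.obj.O.presheaf.obj (op U)) (h),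
      f.hom.app (op U) (SqZeroExt.sub (EW₂ p s) ((FlatLift.frobPush p s).obj E) w
        ((FlatLift.toFrobPush p s E).app (op U) y) h) =
      g.hom.app (op U) (SqZeroExt.sub (EW₂ p s) ((FlatLift.frobPush p s).obj E) w
        ((FlatLift.toFrobPush p s E).app (op U) y) h)) : f.hom = g.hom :=
  SqZeroExt.baerSubPush_hom_ext (EW₂_π_surjective p s) h

lemma FlatLift.frobPush_map_apply {E E' : FlatLift p s} (h : E ⟶ E') {U : S.Opens}
    (y : E.obj.O.presheaf.obj (op U)) : ((FlatLift.frobPush p s).map h).hom.app (op U)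
      ((FlatLift.toFrobPush p s E).app (op U) y) =
      (FlatLift.toFrobPush p s E').app (op U) (h.hom.hom.app (op U) y) :=
  SqZeroExt.toPush_map _ _ _

variable [PerfectField k]

variable (p s) in
/-- The canonical homomorphism `W₂(𝒪_S) → CW₂(S)` over `d`. -/
def wittToCW₂ : SqZeroExt.HomOver (dMap p S (cast_eq_zero_of_over p s)) (EW₂ p s)
    ((SqZeroExt.restrictScalars (W₂.res p)).obj (CW₂ p s)) where
  hom := toCW₂ p s
  base r := (SqZeroExt.descendIso (W₂.res_surjective p) (pushforward_witt_base p s)).hom.base r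
  π := SqZeroExt.toPush_π _
  ι := SqZeroExt.toPush_ι _ _

/-- Since multiplication by `p` on `W₂(𝒪_S)` and on a flat lift is given by `x ↦ (0, x ^ p)` and by
the inclusion of `𝒪_S`, the difference `EW₂(S) - Frob_* E` is an extension over `k`. -/
lemma FlatLift.diff_base (E : FlatLift p s) (r : W₂ p k) (hr : W₂.res p r = 0) :
    ((SqZeroExt.baerSub (EW₂ p s)).obj ((FlatLift.frobPush p s).obj E)).base r = 0 := by
  obtain ⟨a, rfl⟩ := (W₂.ver_eq_iff p).1 hr
  -- As `k` is perfect, the second component of `r` is a `p`-th power.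
  obtain ⟨b, rfl⟩ := surjective_frobenius k p a
  let c := (frobMap p S (cast_eq_zero_of_over p s)).app ⊤ (show Γ(𝒪 S, ⊤) from structHom s b)
  have hw : (EW₂ p s).base (W₂.ver p (frobenius k p b)) = (EW₂ p s).ι ⊤ c := by
    refine TruncatedWittVector.ext (p := p) fun l => ?_
    fin_cases l
    · exact map_zero (structHom s)
    · exact map_pow (structHom s) b p
  have hE : ((FlatLift.frobPush p s).obj E).base (W₂.ver p (frobenius k p b)) =
      ((FlatLift.frobPush p s).obj E).ι ⊤ c :=
    (congrArg ((FlatLift.toFrobPush p s E).app (op ⊤)) (E.base_eq_ι b)).trans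
      (SqZeroExt.toPush_ι _ _ _ _)
  refine (SqZeroExt.sub_base _).trans ((SqZeroExt.sub_congr _ hw hE).trans ?_)
  rw [SqZeroExt.sub_ι, sub_self, map_zero]

/-- The extension `EW₂(S) - Frob_* E` over `k`. -/
abbrev FlatLift.diffObj (E : FlatLift p s) :
    SqZeroExt (structHom s) (frobO p S (cast_eq_zero_of_over p s)) :=
  SqZeroExt.descend (W₂.res p) (W₂.res_surjective p) ((FlatLift.diff p s).obj E) E.diff_base

/-- The extensions `EW₂(S) - Frob_* E` over `W₂(k)` and over `k` have the same middle term. -/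
def FlatLift.diffIso (E : FlatLift p s) :
    (FlatLift.diff p s).obj E ≅ (SqZeroExt.restrictScalars (W₂.res p)).obj E.diffObj :=
  SqZeroExt.descendIso (W₂.res_surjective p) E.diff_base

/-- The homomorphism `w - ȳ ↦ w` from `EW₂(S) - Frob_* E` to `CW₂(S)`. -/
def FlatLift.diffToCW₂ (E : FlatLift p s) :
    SqZeroExt.HomOver (dMap p S (cast_eq_zero_of_over p s)) ((FlatLift.diff p s).obj E)
      ((SqZeroExt.restrictScalars (W₂.res p)).obj (CW₂ p s)) :=
  SqZeroExt.baerSubPush (frobMap_dMap p s) (wittToCW₂ p s) E.obj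

lemma FlatLift.diffToCW₂_sub (E : FlatLift p s) {U : S.Opens}
    (w : (EW₂ p s).O.presheaf.obj (op U)) (y : E.obj.O.presheaf.obj (op U))
    (h : (EW₂ p s).π.app (op U) w = ((FlatLift.frobPush p s).obj E).π.app (op U)
      ((FlatLift.toFrobPush p s E).app (op U) y)) :
    E.diffToCW₂.hom.app (op U) (SqZeroExt.sub (EW₂ p s) ((FlatLift.frobPush p s).obj E) w
      ((FlatLift.toFrobPush p s E).app (op U) y) h) = (toCW₂ p s).app (op U) w :=
  SqZeroExt.baerSubPush_sub (frobMap_dMap p s) (wittToCW₂ p s) w y h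

lemma FlatLift.diff_map_diffToCW₂ {E E' : FlatLift p s} (h : E ⟶ E') :
    ((FlatLift.diff p s).map h).hom ≫ E'.diffToCW₂.hom = E.diffToCW₂.hom :=
  FlatLift.diff_hom_ext (f := E'.diffToCW₂.precomp ((FlatLift.diff p s).map h))
    (g := E.diffToCW₂) fun U w y hwy => by
      rw [E.diffToCW₂_sub]
      refine (congrArg (E'.diffToCW₂.hom.app (op U))
        (SqZeroExt.baerSub_map_sub _ _ _ _)).trans ?_
      refine (congrArg (E'.diffToCW₂.hom.app (op U)) (SqZeroExt.sub_congr _ rfl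
        (FlatLift.frobPush_map_apply h y))).trans ?_
      exact E'.diffToCW₂_sub w _ _

variable (p s) in
/-- The functor `E ↦ (EW₂(S) - Frob_* E, f)`, where `f` maps `w - ȳ` to the image of `w`. -/
def toFrobExt : FlatLift p s ⥤ FrobExt p s where
  obj E :=
    { F := E.diffObj
      isScheme := E.diffObj.isScheme (isLocalizing_frobO p S (cast_eq_zero_of_over p s))
      f := asIso (E.diffToCW₂.descend (W₂.res_surjective p) E.diff_base).desc }
  map {E E'} h :=
    { hom := SqZeroExt.descendMap (W₂.res_surjective p) E.diff_base E'.diff_base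
        ((FlatLift.diff p s).map h)
      comm := SqZeroExt.HomOver.descend_map_desc _ E.diff_base E'.diff_base _ E.diffToCW₂
        E'.diffToCW₂ (FlatLift.diff_map_diffToCW₂ h) }
  map_id E := FrobExt.Hom.ext
    ((congrArg (SqZeroExt.descendMap _ _ _) ((FlatLift.diff p s).map_id E)).trans
      (SqZeroExt.descendMap_id _ _))
  map_comp f g := FrobExt.Hom.ext
    ((congrArg (SqZeroExt.descendMap _ _ _) ((FlatLift.diff p s).map_comp f g)).trans
      (SqZeroExt.descendMap_comp _ _ _ _ _ _))

variable (p s) in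
/-- The isomorphism `EW₂(S) - Frob_* E ≅ F`, where `F` is the extension attached to `E`. -/
def diffIsoToExt : FlatLift.frobPush p s ⋙ SqZeroExt.baerSub (EW₂ p s) ≅
    toFrobExt p s ⋙ FrobExt.toExt p s :=
  NatIso.ofComponents (fun E => E.diffIso) (fun {E E'} h =>
    SqZeroExt.descendIso_naturality (W₂.res_surjective p) E.diff_base E'.diff_base
      ((FlatLift.diff p s).map h))

lemma toFrobExt_obj_toCW₂ (E : FlatLift p s) {U : S.Opens}
    (t : ((FlatLift.diff p s).obj E).O.presheaf.obj (op U)) :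
    ((toFrobExt p s).obj E).toCW₂.app (op U) (((diffIsoToExt p s).hom.app E).hom.app (op U) t) =
      E.diffToCW₂.hom.app (op U) t :=
  SqZeroExt.HomOver.desc_toPush (E.diffToCW₂.descend (W₂.res_surjective p) E.diff_base) t

end Phi

/-! ### The extension `{w - x | a w = b x}` -/

namespace SqZeroExt
variable {R : Type u} [CommRing R] {S : Scheme.{u}} {ρ : R →+* Γ(S, ⊤)} {M N B : S.Modules}

/-- Exactness of `0 → M → N → B → 0` as a sequence of sheaves, in terms of sections. -/
structure IsShortExact (φ : M ⟶ N) (ψ : N ⟶ B) : Prop where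
  inj : ∀ U, Function.Injective (φ.app U)
  exact : ∀ {U : S.Opens} (n : Γ(N, U)), ψ.app U n = 0 ↔ ∃ m, φ.app U m = n
  surj : ∀ {U : S.Opens} (b : Γ(B, U)) (x : S), x ∈ U →
    ∃ (V : S.Opens) (i : V ⟶ U) (n : Γ(N, V)), x ∈ V ∧ ψ.app V n = B.presheaf.map i.op b

section Equalizer
variable {φ : M ⟶ N} {ψ : N ⟶ B} {W F F' : SqZeroExt ρ N} {C : SqZeroExt ρ B}
  (a : HomOver ψ W C) (b : HomOver ψ F C) (b' : HomOver ψ F' C)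

/-- The ring of the sections `w - x` of `W - F` with `a w = b x`. -/
def eqSubring (U : S.Opens) : Subring (((baerSub W).obj F).O.presheaf.obj (op U)) :=
  (RingHom.eqLocus
    ((a.hom.app (op U)).hom.comp ((RingHom.fst _ _).comp (fiberSubring W F U).subtype))
    ((b.hom.app (op U)).hom.comp ((RingHom.snd _ _).comp (fiberSubring W F U).subtype))).map
    (subHom W F U)

variable {a b b'}

lemma mem_eqSubring {U : S.Opens} {z : ((baerSub W).obj F).O.presheaf.obj (op U)} :
    z ∈ eqSubring a b U ↔ ∃ w x h, sub W F w x h = z ∧ a.hom.app (op U) w = b.hom.app (op U) x := by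
  constructor
  · rintro ⟨⟨⟨w, x⟩, h⟩, e, rfl⟩
    exact ⟨w, x, h, rfl, e⟩
  · rintro ⟨w, x, h, rfl, e⟩
    exact ⟨⟨(w, x), h⟩, e, rfl⟩

/-- Membership does not depend on the choice of `w` and `x`, since `a` and `b` agree on `N`. -/
lemma sub_mem_eqSubring {U : S.Opens} {w : W.O.presheaf.obj (op U)} {x : F.O.presheaf.obj (op U)}
    {h : W.π.app (op U) w = F.π.app (op U) x} :
    sub W F w x h ∈ eqSubring a b U ↔ a.hom.app (op U) w = b.hom.app (op U) x := by
  refine ⟨fun hz => ?_, fun e => mem_eqSubring.2 ⟨w, x, h, rfl, e⟩⟩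
  obtain ⟨w', x', h', e, hwx⟩ := mem_eqSubring.1 hz
  obtain ⟨m, rfl, rfl⟩ := exists_of_sub_eq e.symm
  rw [map_add, map_add, hwx, a.ι, b.ι]

lemma map_mem_eqSubring {U V : S.Opens} (i : V ⟶ U)
    {z : ((baerSub W).obj F).O.presheaf.obj (op U)} (hz : z ∈ eqSubring a b U) :
    ((baerSub W).obj F).O.presheaf.map i.op z ∈ eqSubring a b V := by
  obtain ⟨w, x, h, rfl, e⟩ := mem_eqSubring.1 hz
  rw [sub_map, sub_mem_eqSubring, NatTrans.naturality_apply, NatTrans.naturality_apply, e]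

variable (a b) in
/-- The presheaf of the sections `w - x` of `W - F` with `a w = b x`. -/
def eqPresheaf : TopCat.Presheaf CommRingCat.{u} S.carrier where
  obj U := .of (eqSubring a b U.unop)
  map {U V} i := CommRingCat.ofHom ((((baerSub W).obj F).O.presheaf.map i).hom.restrict
    (eqSubring a b U.unop) (eqSubring a b V.unop) fun _ hz => map_mem_eqSubring i.unop hz)
  map_id U := CommRingCat.hom_ext (RingHom.ext fun x => Subtype.ext
    (congrArg (fun g => g.hom x.1) (((baerSub W).obj F).O.presheaf.map_id U)))
  map_comp i j := CommRingCat.hom_ext (RingHom.ext fun x => Subtype.ext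
    (congrArg (fun g => g.hom x.1) (((baerSub W).obj F).O.presheaf.map_comp i j)))

/-- As `W → 𝒪_S` is surjective on sections, a section of `W - F` is globally of the form `w - x`, and
`a w = b x` may be checked locally. -/
lemma eqPresheaf_isSheaf (hW : ∀ U : S.Opens, Function.Surjective (W.π.app (op U))) :
    (eqPresheaf a b).IsSheaf := by
  rw [TopCat.Presheaf.isSheaf_iff_isSheafUniqueGluing]
  intro I U sf hsf
  obtain ⟨z, hz, hz'⟩ := ((baerSub W).obj F).O.existsUnique_gluing U (fun i => (sf i).1)
    (fun i j => congrArg Subtype.val (hsf i j))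
  refine ⟨⟨z, ?_⟩, fun i => Subtype.ext (hz i), fun y hy => Subtype.ext
    (hz' _ fun i => congrArg Subtype.val (hy i))⟩
  obtain ⟨w, hw⟩ := hW _ (((baerSub W).obj F).π.app _ z)
  obtain ⟨x, hx, rfl⟩ := exists_sub_eq w z hw
  refine sub_mem_eqSubring.2 (TopCat.Sheaf.eq_of_locally_eq C.O U _ _ fun i => ?_)
  have h1 : ((baerSub W).obj F).O.presheaf.map (Opens.leSupr U i).op (sub W F w x hx) ∈
      eqSubring a b (U i) :=
    Eq.mpr (congrArg (· ∈ eqSubring a b (U i)) (hz i)) (sf i).2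
  rw [sub_map, sub_mem_eqSubring] at h1
  refine (NatTrans.naturality_apply a.hom _ w).symm.trans (h1.trans ?_)
  exact NatTrans.naturality_apply b.hom _ x

lemma base_mem_eqSubring (r : R) : ((baerSub W).obj F).base r ∈ eqSubring a b ⊤ :=
  sub_mem_eqSubring.2 ((a.base r).trans (b.base r).symm)

/-- The ideal of `{w - x | a w = b x}` is the kernel of `ψ`, that is, the image of
`φ`. -/
lemma ι_mem_eqSubring (H : IsShortExact φ ψ) {U : S.Opens} {n : Γ(N, U)} :
    ((baerSub W).obj F).ι U n ∈ eqSubring a b U ↔ ∃ m, φ.app U m = n := by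
  have e : sub W F (W.ι U n) (F.ι U 0) ((W.π_ι U n).trans (F.π_ι U 0).symm) =
      ((baerSub W).obj F).ι U n := by rw [sub_ι, sub_zero]
  rw [← e, sub_mem_eqSubring, a.ι, b.ι, ← H.exact, map_zero]
  exact ⟨fun h => C.ι_inj U h, fun h => congrArg (C.ι U) h⟩

variable (a b) in
/-- The subsheaf `{w - x | a w = b x}` of `W - F`, for homomorphisms `a : W → C` and `b : F → C`
over `ψ : N → B`, as an extension by the kernel `φ : M → N` of `ψ`. -/
def eqExt (hW : ∀ U : S.Opens, Function.Surjective (W.π.app (op U))) (H : IsShortExact φ ψ) :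
    SqZeroExt ρ M where
  O := ⟨eqPresheaf a b, eqPresheaf_isSheaf hW⟩
  π :=
    { app := fun U => CommRingCat.ofHom
        ((((baerSub W).obj F).π.app U).hom.comp (eqSubring a b U.unop).subtype)
      naturality := fun U V i => by
        ext z
        exact NatTrans.naturality_apply ((baerSub W).obj F).π i z.1 }
  base := ((baerSub W).obj F).base.codRestrict (eqSubring a b ⊤) base_mem_eqSubring
  π_base := ((baerSub W).obj F).π_base
  π_surj := by
    rw [TopCat.Presheaf.isLocallySurjective_iff]
    intro U t x hx
    obtain ⟨V, i, f, hV, hf⟩ := F.exists_local_lift t x hx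
    obtain ⟨w, hw⟩ := hW V (F.π.app (op V) f)
    obtain ⟨c, hc⟩ := exists_add_ι (E := C) (t := a.hom.app (op V) w) (t' := b.hom.app (op V) f)
      (by rw [a.π_apply, b.π_apply, hw])
    -- Correcting the lift `f` by a local preimage `n` of `c = a w - b f` achieves `a w = b x`.
    obtain ⟨V', j, n, hV', hn⟩ := H.surj c x hV
    have hπ : W.π.app (op V') (W.O.presheaf.map j.op w) =
        F.π.app (op V') (F.O.presheaf.map j.op f + F.ι V' n) := by
      rw [map_add, π_ι, add_zero, π_map_eq w f hw j]
    refine ⟨V', leOfHom (j ≫ i), ⟨⟨sub W F _ _ hπ, ?_⟩, ?_⟩, hV'⟩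
    · rw [sub_mem_eqSubring, map_add, b.ι, hn, ← C.ι_map, NatTrans.naturality_apply,
        NatTrans.naturality_apply, hc, map_add]
    · refine (sub_π _ _ hπ).trans ?_
      rw [NatTrans.naturality_apply, hw, hf, ← CommRingCat.comp_apply, ← Functor.map_comp]
      rfl
  ι U := (((baerSub W).obj F).ι U |>.comp (φ.app U).hom).codRestrict
    (eqSubring a b U).toAddSubgroup fun m => (ι_mem_eqSubring H).2 ⟨m, rfl⟩
  ι_map {U V} i m := Subtype.ext ((((baerSub W).obj F).ι_map i _).trans
    (congrArg (((baerSub W).obj F).ι V) (NatTrans.naturality_apply φ.mapPresheaf i.op m).symm))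
  ι_inj U m n h := H.inj U (((baerSub W).obj F).ι_inj U (congrArg Subtype.val h))
  exact U t := by
    constructor
    · intro h
      obtain ⟨n, hn⟩ := (((baerSub W).obj F).exact U t.1).1 h
      obtain ⟨m, rfl⟩ := (ι_mem_eqSubring H).1 (show _ ∈ eqSubring a b U from hn ▸ t.2)
      exact ⟨m, Subtype.ext hn⟩
    · rintro ⟨m, rfl⟩
      exact ((baerSub W).obj F).π_ι U _
  ι_smul U t m := Subtype.ext ((congrArg (((baerSub W).obj F).ι U)
    (Modules.Hom.app_smul φ _ m)).trans (((baerSub W).obj F).ι_smul U t.1 _))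

variable (hW : ∀ U : S.Opens, Function.Surjective (W.π.app (op U))) (H : IsShortExact φ ψ)

variable (a b) in
/-- The inclusion of `{w - x | a w = b x}` in `W - F`. -/
def eqIncl : HomOver φ (eqExt a b hW H) ((baerSub W).obj F) where
  hom := { app := fun U => CommRingCat.ofHom (eqSubring a b U.unop).subtype }
  base _ := rfl
  π := rfl
  ι _ _ := rfl

lemma eqIncl_injective {U : S.Opens} :
    Function.Injective ((eqIncl a b hW H).hom.app (op U)) := Subtype.val_injective

lemma eqIncl_mem {U : S.Opens} (z : (eqExt a b hW H).O.presheaf.obj (op U)) :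
    (eqIncl a b hW H).hom.app (op U) z ∈ eqSubring a b U := z.2

/-- A homomorphism over `φ` to `W - F` with values in the sections `w - x` with `a w = b x`. -/
def eqLift {E : SqZeroExt ρ M} (f : HomOver φ E ((baerSub W).obj F))
    (hf : ∀ (U : S.Opens) t, f.hom.app (op U) t ∈ eqSubring a b U) : E ⟶ eqExt a b hW H where
  hom :=
    { app := fun U => CommRingCat.ofHom
        ((f.hom.app U).hom.codRestrict (eqSubring a b U.unop) (hf U.unop))
      naturality := fun U V i => by
        ext t
        exact Subtype.ext (NatTrans.naturality_apply f.hom i t) }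
  base r := Subtype.ext (f.base r)
  π := f.π
  ι U m := Subtype.ext (f.ι U m)

lemma eqExt_hom_ext {E : SqZeroExt ρ M} {f g : E ⟶ eqExt a b hW H}
    (h : ∀ (U : S.Opens) t, (eqIncl a b hW H).hom.app (op U) (f.hom.app (op U) t) =
      (eqIncl a b hW H).hom.app (op U) (g.hom.app (op U) t)) : f = g := by
  refine Hom.ext ?_
  ext U t
  exact eqIncl_injective hW H (h U t)

lemma map_mem_eqSubring_of_comp (f : F ⟶ F') (hf : f.hom ≫ b'.hom = b.hom) {U : S.Opens}
    {z : ((baerSub W).obj F).O.presheaf.obj (op U)} (hz : z ∈ eqSubring a b U) :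
    ((baerSub W).map f).hom.app (op U) z ∈ eqSubring a b' U := by
  obtain ⟨w, x, h, rfl, e⟩ := mem_eqSubring.1 hz
  rw [baerSub_map_sub, sub_mem_eqSubring, e, ← hf]
  rfl

/-- Functoriality of `{w - x | a w = b x}` in `F`. -/
def eqExtMap (f : F ⟶ F') (hf : f.hom ≫ b'.hom = b.hom) : eqExt a b hW H ⟶ eqExt a b' hW H where
  hom :=
    { app := fun U => CommRingCat.ofHom ((((baerSub W).map f).hom.app U).hom.restrict
        (eqSubring a b U.unop) (eqSubring a b' U.unop)
        fun _ hz => map_mem_eqSubring_of_comp f hf hz)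
      naturality := fun U V i => by
        ext t
        exact Subtype.ext (NatTrans.naturality_apply ((baerSub W).map f).hom i t.1) }
  base r := Subtype.ext (((baerSub W).map f).base r)
  π := by
    ext U t
    exact Hom.π_apply ((baerSub W).map f) t.1
  ι U m := Subtype.ext (((baerSub W).map f).ι U (φ.app U m))

lemma eqExtMap_incl (f : F ⟶ F') (hf : f.hom ≫ b'.hom = b.hom) {U : S.Opens}
    (t : (eqExt a b hW H).O.presheaf.obj (op U)) :
    (eqIncl a b' hW H).hom.app (op U) ((eqExtMap hW H f hf).hom.app (op U) t) =
      ((baerSub W).map f).hom.app (op U) ((eqIncl a b hW H).hom.app (op U) t) := rfl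

lemma eqExtMap_id (hf : (𝟙 F : F ⟶ F).hom ≫ b.hom = b.hom) :
    eqExtMap hW H (𝟙 F) hf = 𝟙 (eqExt a b hW H) := eqExt_hom_ext hW H fun U t =>
  (eqExtMap_incl hW H _ hf t).trans (congrArg (fun g => (Hom.hom g).app (op U) t.1)
    ((baerSub W).map_id F))

lemma eqExtMap_comp {F'' : SqZeroExt ρ N} {b'' : HomOver ψ F'' C} (f : F ⟶ F') (g : F' ⟶ F'')
    (hf : f.hom ≫ b'.hom = b.hom) (hg : g.hom ≫ b''.hom = b'.hom)
    (hfg : (f ≫ g).hom ≫ b''.hom = b.hom) :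
    eqExtMap (a := a) hW H (f ≫ g) hfg = eqExtMap hW H f hf ≫ eqExtMap hW H g hg :=
  eqExt_hom_ext hW H fun U t =>
    (eqExtMap_incl hW H _ hfg t).trans (congrArg (fun g => (Hom.hom g).app (op U) t.1)
      ((baerSub W).map_comp f g))

/-- Naturality in `F` of the morphism `φ_* {w - x | a w = b x} → W - F`. -/
lemma map_eqIncl_desc (f : F ⟶ F') (hf : f.hom ≫ b'.hom = b.hom) :
    (pushforward φ).map (eqExtMap (a := a) hW H f hf) ≫ (eqIncl a b' hW H).desc =
      (eqIncl a b hW H).desc ≫ (baerSub W).map f := pushforward_hom_ext fun U t => by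
  refine (congrArg ((eqIncl a b' hW H).desc.hom.app (op U)) (toPush_map φ _ t)).trans ?_
  refine ((eqIncl a b' hW H).desc_toPush _).trans ?_
  exact (congrArg (((baerSub W).map f).hom.app (op U)) ((eqIncl a b hW H).desc_toPush t)).symm

/-- If `n` kills `F` and acts on `W` as `w ↦ φ (θ w)`, then it acts on `{w - x | a w = b x}` as
`w - x ↦ θ w`. -/
lemma natCast_mul_eqExt {n : ℕ} {U : S.Opens} (θ : Γ(S, U) → Γ(M, U))
    (hn : ∀ w : W.O.presheaf.obj (op U), (n : W.O.presheaf.obj (op U)) * w =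
      W.ι U (φ.app U (θ (W.π.app (op U) w))))
    (hF : (n : F.O.presheaf.obj (op U)) = 0) (t : (eqExt a b hW H).O.presheaf.obj (op U)) :
    (n : (eqExt a b hW H).O.presheaf.obj (op U)) * t =
      (eqExt a b hW H).ι U (θ ((eqExt a b hW H).π.app (op U) t)) := by
  refine eqIncl_injective hW H ?_
  rw [map_mul, map_natCast, (eqIncl a b hW H).ι, ← (eqIncl a b hW H).π_apply]
  obtain ⟨w, x, h, e, -⟩ := mem_eqSubring.1 (eqIncl_mem hW H t)
  rw [← e, sub_π]
  have h1 := map_mul (subHom W F U) (n : fiberSubring W F U) ⟨(w, x), h⟩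
  rw [map_natCast] at h1
  refine h1.symm.trans ((sub_congr _ (hn w) ?_).trans (sub_ι _ 0 |>.trans (by rw [sub_zero])))
  rw [map_zero]
  exact (congrArg (· * x) hF).trans (zero_mul x)

end Equalizer
end SqZeroExt

/-! ### From extensions by `Frob_* 𝒪_S` to lifts -/

section Psi
variable (p : ℕ) [hp : Fact p.Prime] {k : Type u} [Field k] [CharP k p] {S : Scheme.{u}}
  (s : S ⟶ Spec (.of k))

/-- The Frobenius of a reduced scheme is injective on sections. -/
lemma frobMap_injective [IsReduced S] (hS : (p : Γ(S, ⊤)) = 0) (U : S.Opens) :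
    Function.Injective ((frobMap p S hS).app U) := by
  intro a b hab
  have h0 : (frobHom p (cast_eq_zero hS U)) ((show Γ(S, U) from a) - (show Γ(S, U) from b)) = 0 := by
    rw [map_sub]
    exact sub_eq_zero.2 hab
  exact sub_eq_zero.1 (pow_eq_zero_iff hp.out.ne_zero |>.1 h0)

/-- The sequence `0 → 𝒪_S → Frob_* 𝒪_S → Frob_* B¹ → 0` is exact, as `S` is reduced. -/
lemma isShortExact_frobMap_dMap [IsReduced S] (hS : (p : Γ(S, ⊤)) = 0) :
    SqZeroExt.IsShortExact (frobMap p S hS) (dMap p S hS) where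
  inj := frobMap_injective p hS
  exact {U} n := by
    refine ⟨fun h => exists_eq_of_cokernelπ_eq_zero _ (frobMap_injective p hS) n h, ?_⟩
    rintro ⟨m, rfl⟩
    exact congrArg (fun g => Modules.Hom.app g U m) (Limits.cokernel.condition (frobMap p S hS))
  surj b x hx := exists_local_cokernel_lift (frobMap p S hS) b x hx

variable [PerfectField k]

variable {p s}

/-- The homomorphism `F → CW₂(S)` over `d` that belongs to a pair `(F, f)`. -/
def FrobExt.homOver (X : FrobExt p s) :
    SqZeroExt.HomOver (dMap p S (cast_eq_zero_of_over p s)) ((FrobExt.toExt p s).obj X)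
      ((SqZeroExt.restrictScalars (W₂.res p)).obj (CW₂ p s)) where
  hom := X.toCW₂
  base r := X.f.hom.base (W₂.res p r)
  π := by
    refine (Category.assoc _ _ _).trans ((congrArg (_ ≫ ·) X.f.hom.π).trans ?_)
    exact SqZeroExt.toPush_π _
  ι U m := (congrArg (X.f.hom.hom.app (op U)) (SqZeroExt.toPush_ι _ _ _ _)).trans (X.f.hom.ι U _)

lemma FrobExt.Hom.comp_toCW₂ {X Y : FrobExt p s} (h : X ⟶ Y) :
    ((FrobExt.toExt p s).map h).hom ≫ Y.toCW₂ = X.toCW₂ := by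
  ext U t
  refine (congrArg (Y.f.hom.hom.app (op U)) (SqZeroExt.toPush_map _ h.hom t).symm).trans ?_
  exact congrArg (fun g => (SqZeroExt.Hom.hom g).app (op U) ((X.F.toPush _).app (op U) t)) h.comm

/-- A morphism of extensions over `W₂(k)` that commutes with the homomorphisms to `CW₂(S)` is a
morphism of pairs. -/
def FrobExt.homMk {X Y : FrobExt p s} (h : (FrobExt.toExt p s).obj X ⟶ (FrobExt.toExt p s).obj Y)
    (e : h.hom ≫ Y.toCW₂ = X.toCW₂) : X ⟶ Y where
  hom := SqZeroExt.homOfRestrictScalars (W₂.res_surjective p) h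
  comm := SqZeroExt.pushforward_hom_ext fun U t => by
    refine (congrArg (Y.f.hom.hom.app (op U)) (SqZeroExt.toPush_map _ _ t)).trans ?_
    exact congrArg (fun g => g.app (op U) t) e

lemma FrobExt.toExt_map_injective {X Y : FrobExt p s} {f g : X ⟶ Y}
    (h : (FrobExt.toExt p s).map f = (FrobExt.toExt p s).map g) : f = g :=
  FrobExt.Hom.ext (SqZeroExt.Hom.ext (congrArg (fun u => SqZeroExt.Hom.hom u) h :))

instance {X Y : FrobExt p s} (h : X ⟶ Y) : IsIso h := by
  let g : Y ⟶ X := ⟨inv h.hom, by rw [Functor.map_inv, IsIso.inv_comp_eq, h.comm]⟩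
  exact ⟨g, FrobExt.Hom.ext (IsIso.hom_inv_id h.hom), FrobExt.Hom.ext (IsIso.inv_hom_id h.hom)⟩

lemma FrobExt.cast_eq_zero (X : FrobExt p s) (U : S.Opens) :
    (p : X.F.O.presheaf.obj (op U)) = 0 := by
  have h : (p : X.F.O.presheaf.obj (op ⊤)) = 0 := by
    rw [← map_natCast X.F.base, CharP.cast_eq_zero, map_zero]
  rw [← map_natCast (X.F.rO (le_top : U ≤ ⊤)), h, map_zero]

variable [IsReduced S]

/-- The extension of `S` by `𝒪_S` over `W₂(k)` whose sections are the sections `w - x` of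
`EW₂(S) - F` such that `w` and `x` have the same image in `CW₂(S)`. -/
abbrev FrobExt.liftExt (X : FrobExt p s) : SqZeroExt ((structHom s).comp (W₂.res p)) (𝒪 S) :=
  SqZeroExt.eqExt (wittToCW₂ p s) X.homOver (EW₂_π_surjective p s)
    (isShortExact_frobMap_dMap p (cast_eq_zero_of_over p s))

/-- The inclusion of the lift attached to `(F, f)` in `EW₂(S) - F`. -/
abbrev FrobExt.liftIncl (X : FrobExt p s) :
    SqZeroExt.HomOver (frobMap p S (cast_eq_zero_of_over p s)) X.liftExt
      ((SqZeroExt.baerSub (EW₂ p s)).obj ((FrobExt.toExt p s).obj X)) :=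
  SqZeroExt.eqIncl (wittToCW₂ p s) X.homOver (EW₂_π_surjective p s)
    (isShortExact_frobMap_dMap p (cast_eq_zero_of_over p s))

/-- `p` kills `F` and maps a Witt vector `w` to `(0, w₀ ^ p)`, so it maps `w - x` to the image of
`w₀` in the ideal. -/
lemma FrobExt.isFlatLift_liftExt (X : FrobExt p s) : isFlatLift p s X.liftExt :=
  ⟨X.liftExt.isScheme (isLocalizing_𝒪 S), fun U t =>
    SqZeroExt.natCast_mul_eqExt (EW₂_π_surjective p s)
      (isShortExact_frobMap_dMap p (cast_eq_zero_of_over p s)) (fun a => a)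
      (fun w => W₂.natCast_mul p (WittLift.cast_eq_zero (cast_eq_zero_of_over p s) U) w)
      (X.cast_eq_zero U) t⟩

/-- The morphism of lifts that a morphism of pairs induces. -/
abbrev FrobExt.liftMap {X Y : FrobExt p s} (h : X ⟶ Y) : X.liftExt ⟶ Y.liftExt :=
  SqZeroExt.eqExtMap (EW₂_π_surjective p s)
    (isShortExact_frobMap_dMap p (cast_eq_zero_of_over p s)) (a := wittToCW₂ p s)
    (b := X.homOver) (b' := Y.homOver) ((FrobExt.toExt p s).map h) (FrobExt.Hom.comp_toCW₂ h)

variable (p s) in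
/-- The functor `(F, f) ↦ {w - x | w = f x in CW₂(S)}` to flat lifts. -/
def toFlatLift : FrobExt p s ⥤ FlatLift p s where
  obj X := ⟨X.liftExt, X.isFlatLift_liftExt⟩
  map h := ObjectProperty.homMk (FrobExt.liftMap h)
  map_id X := ObjectProperty.hom_ext _ (SqZeroExt.eqExtMap_id (b := X.homOver) _ _
    (FrobExt.Hom.comp_toCW₂ (𝟙 X)))
  map_comp {X Y Z} f g := ObjectProperty.hom_ext _ (SqZeroExt.eqExtMap_comp (b := X.homOver)
    (b' := Y.homOver) (b'' := Z.homOver) _ _ _ _ (FrobExt.Hom.comp_toCW₂ f)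
    (FrobExt.Hom.comp_toCW₂ g) (FrobExt.Hom.comp_toCW₂ (f ≫ g)))

lemma FrobExt.liftMap_incl_desc {X Y : FrobExt p s} (h : X ⟶ Y) :
    (SqZeroExt.pushforward _).map (FrobExt.liftMap h) ≫ Y.liftIncl.desc =
      X.liftIncl.desc ≫ (SqZeroExt.baerSub (EW₂ p s)).map ((FrobExt.toExt p s).map h) :=
  SqZeroExt.map_eqIncl_desc _ _ _ _

/-- The isomorphism `Frob_* E ≅ EW₂(S) - F` of extensions, for the lift `E` attached to
`(F, f)`. -/
def FrobExt.descIso (X : FrobExt p s) :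
    (SqZeroExt.pushforward (frobMap p S (cast_eq_zero_of_over p s))).obj X.liftExt ≅
      (SqZeroExt.baerSub (EW₂ p s)).obj ((FrobExt.toExt p s).obj X) :=
  asIso X.liftIncl.desc

variable (p s) in
/-- The isomorphism `Frob_* E ≅ EW₂(S) - F`, for the lift `E` attached to `(F, f)`. -/
def frobPushIso : toFlatLift p s ⋙ FlatLift.frobPush p s ≅
    FrobExt.toExt p s ⋙ SqZeroExt.baerSub (EW₂ p s) :=
  NatIso.ofComponents (fun X => FrobExt.descIso X) FrobExt.liftMap_incl_desc

lemma frobPushIso_hom_apply (X : FrobExt p s) {U : S.Opens}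
    (y : X.liftExt.O.presheaf.obj (op U)) :
    ((frobPushIso p s).hom.app X).hom.app (op U)
      ((FlatLift.toFrobPush p s ((toFlatLift p s).obj X)).app (op U) y) =
      X.liftIncl.hom.app (op U) y := X.liftIncl.desc_toPush y

end Psi

/-! ### The equivalence -/

namespace SqZeroExt
variable {R : Type u} [CommRing R] {S : Scheme.{u}} {ρ : R →+* Γ(S, ⊤)} {M N B : S.Modules}
  {φ : M ⟶ N} {ψ : N ⟶ B} {W F F' : SqZeroExt ρ N} {C : SqZeroExt ρ B}
  {a : HomOver ψ W C} {b : HomOver ψ F C} {b' : HomOver ψ F' C}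
  (hW : ∀ U : S.Opens, Function.Surjective (W.π.app (op U))) (H : IsShortExact φ ψ)

section Unit
variable {E E' : SqZeroExt ρ M} (κ : (baerSub W).obj ((pushforward φ).obj E) ⟶ F)
  (κ' : (baerSub W).obj ((pushforward φ).obj E') ⟶ F')

/-- The homomorphism `E → φ_* E ≅ W - (W - φ_* E) → W - F` that a morphism `κ : W - φ_* E → F`
induces. -/
def toSub : HomOver φ E ((baerSub W).obj F) where
  hom := E.toPush φ ≫ (toDouble W hW _ ≫ (baerSub W).map κ).hom
  base r := (toDouble W hW _ ≫ (baerSub W).map κ).base r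
  π := by rw [Category.assoc, Hom.π, toPush_π]
  ι U m := (congrArg _ (toPush_ι φ E U m)).trans ((toDouble W hW _ ≫ (baerSub W).map κ).ι U _)

lemma toSub_apply {U : S.Opens} (w : W.O.presheaf.obj (op U)) (y : E.O.presheaf.obj (op U))
    (h : W.π.app (op U) w = ((pushforward φ).obj E).π.app (op U) ((E.toPush φ).app (op U) y)) :
    (toSub hW κ).hom.app (op U) y = sub W F w
      (κ.hom.app (op U) (sub W ((pushforward φ).obj E) w ((E.toPush φ).app (op U) y) h))
      ((sub_π _ _ h).symm.trans (κ.π_apply _).symm) :=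
  (congrArg (((baerSub W).map κ).hom.app (op U)) (toDouble_apply hW _ _ h)).trans
    (baerSub_map_sub _ _ _ _)

variable {κ κ'}

/-- If `κ : W - φ_* E → F` carries `w - ȳ ↦ a w` to `b`, then `E` maps to the subsheaf
`{w - x | a w = b x}` of `W - F`. -/
def toEqExt (hκ : ∀ (U : S.Opens) w (y : E.O.presheaf.obj (op U)) h, b.hom.app (op U)
      (κ.hom.app (op U) (sub W ((pushforward φ).obj E) w ((E.toPush φ).app (op U) y) h)) =
      a.hom.app (op U) w) : E ⟶ eqExt a b hW H :=
  eqLift hW H (toSub hW κ) fun U y => by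
    obtain ⟨w, hw⟩ := hW U (((pushforward φ).obj E).π.app (op U) ((E.toPush φ).app (op U) y))
    rw [toSub_apply hW κ w y hw, sub_mem_eqSubring]
    exact (hκ U w y hw).symm

lemma toEqExt_naturality (hκ : ∀ (U : S.Opens) w (y : E.O.presheaf.obj (op U)) h, b.hom.app (op U)
      (κ.hom.app (op U) (sub W ((pushforward φ).obj E) w ((E.toPush φ).app (op U) y) h)) =
      a.hom.app (op U) w)
    (hκ' : ∀ (U : S.Opens) w (y : E'.O.presheaf.obj (op U)) h, b'.hom.app (op U)
      (κ'.hom.app (op U) (sub W ((pushforward φ).obj E') w ((E'.toPush φ).app (op U) y) h)) =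
      a.hom.app (op U) w)
    (g : E ⟶ E') (f : F ⟶ F') (hf : f.hom ≫ b'.hom = b.hom)
    (e : (baerSub W).map ((pushforward φ).map g) ≫ κ' = κ ≫ f) :
    g ≫ toEqExt hW H hκ' = toEqExt hW H hκ ≫ eqExtMap hW H f hf :=
  eqExt_hom_ext hW H fun U y => by
    obtain ⟨w, hw⟩ := hW U (((pushforward φ).obj E).π.app (op U) ((E.toPush φ).app (op U) y))
    have hw' : W.π.app (op U) w = ((pushforward φ).obj E').π.app (op U)
        ((E'.toPush φ).app (op U) (g.hom.app (op U) y)) := by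
      rw [hw, toPush_π_apply, toPush_π_apply, g.π_apply]
    refine (toSub_apply hW κ' w (g.hom.app (op U) y) hw').trans ?_
    refine Eq.trans ?_ (congrArg (((baerSub W).map f).hom.app (op U))
      (toSub_apply hW κ w y hw)).symm
    refine Eq.trans ?_ (baerSub_map_sub _ _ _ _).symm
    refine sub_congr _ rfl (Eq.trans (congrArg (κ'.hom.app (op U)) ?_)
      (congrArg (fun q => (Hom.hom q).app (op U) (sub W ((pushforward φ).obj E) w
        ((E.toPush φ).app (op U) y) hw)) e))
    exact ((baerSub_map_sub _ _ _ _).trans (sub_congr _ rfl (toPush_map φ g y))).symm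

end Unit

section Counit

variable (a b) in
/-- The morphism `W - φ_* E → W - (W - F) ≅ F` for the extension `E = {w - x | a w = b x}`. -/
def subEqExt : (baerSub W).obj ((pushforward φ).obj (eqExt a b hW H)) ⟶ F :=
  (baerSub W).map (eqIncl a b hW H).desc ≫ (doubleIso W hW).inv.app F

lemma subEqExt_sub {U : S.Opens} (w : W.O.presheaf.obj (op U)) (x : F.O.presheaf.obj (op U))
    (h : W.π.app (op U) w = F.π.app (op U) x) (y : (eqExt a b hW H).O.presheaf.obj (op U))
    (e : (eqIncl a b hW H).hom.app (op U) y = sub W F w x h)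
    (h' : W.π.app (op U) w = ((pushforward φ).obj (eqExt a b hW H)).π.app (op U)
      (((eqExt a b hW H).toPush φ).app (op U) y)) :
    (subEqExt a b hW H).hom.app (op U) (sub W ((pushforward φ).obj (eqExt a b hW H)) w
      (((eqExt a b hW H).toPush φ).app (op U) y) h') = x := by
  refine (congrArg (((doubleIso W hW).inv.app F).hom.app (op U)) ?_).trans
    (doubleIso_inv_apply hW w x h)
  refine (baerSub_map_sub _ _ _ _).trans (sub_congr _ rfl ?_)
  exact ((eqIncl a b hW H).desc_toPush y).trans e

/-- The morphism `W - φ_* E → F` carries `w - ȳ ↦ a w` to `b`. -/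
lemma map_subEqExt_sub {U : S.Opens} (w : W.O.presheaf.obj (op U))
    (y : (eqExt a b hW H).O.presheaf.obj (op U))
    (h : W.π.app (op U) w = ((pushforward φ).obj (eqExt a b hW H)).π.app (op U)
      (((eqExt a b hW H).toPush φ).app (op U) y)) :
    b.hom.app (op U) ((subEqExt a b hW H).hom.app (op U)
      (sub W ((pushforward φ).obj (eqExt a b hW H)) w
        (((eqExt a b hW H).toPush φ).app (op U) y) h)) = a.hom.app (op U) w := by
  obtain ⟨x, hx, e⟩ := exists_sub_eq w ((eqIncl a b hW H).hom.app (op U) y) (by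
    rw [h, toPush_π_apply, (eqIncl a b hW H).π_apply])
  rw [subEqExt_sub hW H w x hx y e.symm h]
  have hy := eqIncl_mem hW H y
  rw [← e, sub_mem_eqSubring] at hy
  exact hy.symm

lemma subEqExt_naturality (f : F ⟶ F') (hf : f.hom ≫ b'.hom = b.hom) :
    (baerSub W).map ((pushforward φ).map (eqExtMap hW H f hf)) ≫ subEqExt a b' hW H =
      subEqExt a b hW H ≫ f := by
  refine (Category.assoc _ _ _).symm.trans ?_
  rw [← Functor.map_comp, map_eqIncl_desc, Functor.map_comp, Category.assoc]
  refine Eq.trans ?_ (Category.assoc _ _ _).symm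
  exact congrArg ((baerSub W).map (eqIncl a b hW H).desc ≫ ·)
    ((doubleIso W hW).inv.naturality f)

end Counit
end SqZeroExt

section Equivalence
variable {p : ℕ} [hp : Fact p.Prime] {k : Type u} [Field k] [CharP k p] [PerfectField k]
  {S : Scheme.{u}} [IsReduced S] {s : S ⟶ Spec (.of k)}

/-- The morphism from a flat lift `E` to the lift attached to the pair attached to `E`. -/
def FlatLift.unitHom (E : FlatLift p s) : E.obj ⟶ ((toFrobExt p s).obj E).liftExt :=
  SqZeroExt.toEqExt (EW₂_π_surjective p s) (isShortExact_frobMap_dMap p (cast_eq_zero_of_over p s))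
    (κ := (diffIsoToExt p s).hom.app E) fun _ w y h =>
      (toFrobExt_obj_toCW₂ E _).trans (E.diffToCW₂_sub w y h)

/-- A flat lift `E` is isomorphic to the lift attached to the pair attached to `E`. -/
def FlatLift.isoLift (E : FlatLift p s) : E.obj ≅ ((toFrobExt p s).obj E).liftExt :=
  asIso E.unitHom

lemma FlatLift.unitHom_naturality {E E' : FlatLift p s} (g : E ⟶ E') :
    g.hom ≫ E'.unitHom = E.unitHom ≫ FrobExt.liftMap ((toFrobExt p s).map g) :=
  SqZeroExt.toEqExt_naturality (κ := (diffIsoToExt p s).hom.app E)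
    (κ' := (diffIsoToExt p s).hom.app E') _ _ _ _ g.hom _ _ ((diffIsoToExt p s).hom.naturality g)

/-- The morphism `EW₂(S) - Frob_* E → F`, for the lift `E` attached to `(F, f)`. -/
def FrobExt.counitExt (X : FrobExt p s) :
    (FlatLift.diff p s).obj ((toFlatLift p s).obj X) ⟶ (FrobExt.toExt p s).obj X :=
  SqZeroExt.subEqExt (wittToCW₂ p s) X.homOver (EW₂_π_surjective p s)
    (isShortExact_frobMap_dMap p (cast_eq_zero_of_over p s))

lemma FrobExt.counitExt_toCW₂ (X : FrobExt p s) :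
    X.counitExt.hom ≫ X.toCW₂ = (FlatLift.diffToCW₂ ((toFlatLift p s).obj X)).hom :=
  FlatLift.diff_hom_ext (f := X.homOver.precomp X.counitExt) fun _ w y h =>
    (SqZeroExt.map_subEqExt_sub (b := X.homOver) _ _ w y h).trans
      (FlatLift.diffToCW₂_sub ((toFlatLift p s).obj X) w y h).symm

/-- The morphism to a pair `(F, f)` from the pair attached to its lift. -/
def FrobExt.counitHom (X : FrobExt p s) : (toFrobExt p s).obj ((toFlatLift p s).obj X) ⟶ X :=
  FrobExt.homMk ((diffIsoToExt p s).inv.app ((toFlatLift p s).obj X) ≫ X.counitExt) (by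
    have h1 : ((diffIsoToExt p s).hom.app ((toFlatLift p s).obj X)).hom ≫
        ((toFrobExt p s).obj ((toFlatLift p s).obj X)).toCW₂ =
        (FlatLift.diffToCW₂ ((toFlatLift p s).obj X)).hom := by
      ext U t
      exact toFrobExt_obj_toCW₂ _ t
    have h2 := congrArg (fun q => SqZeroExt.Hom.hom q)
      ((diffIsoToExt p s).inv_hom_id_app ((toFlatLift p s).obj X))
    refine (Category.assoc _ _ _).trans ((congrArg (_ ≫ ·)
      (X.counitExt_toCW₂.trans h1.symm)).trans ((Category.assoc _ _ _).symm.trans ?_))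
    exact (congrArg (· ≫ _) h2).trans (Category.id_comp _))

lemma FrobExt.counitHom_naturality {X Y : FrobExt p s} (f : X ⟶ Y) :
    (toFrobExt p s).map ((toFlatLift p s).map f) ≫ Y.counitHom = X.counitHom ≫ f := by
  refine FrobExt.toExt_map_injective ?_
  rw [Functor.map_comp, Functor.map_comp]
  refine (Category.assoc _ _ _).symm.trans ((congrArg (· ≫ Y.counitExt)
    ((diffIsoToExt p s).inv.naturality ((toFlatLift p s).map f))).trans
    ((Category.assoc _ _ _).trans (Eq.trans ?_ (Category.assoc _ _ _).symm)))
  exact congrArg ((diffIsoToExt p s).inv.app ((toFlatLift p s).obj X) ≫ ·)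
    (SqZeroExt.subEqExt_naturality _ _ _ (FrobExt.Hom.comp_toCW₂ f))

variable (p s) in
/-- The unit of the equivalence between flat lifts and pairs `(F, f)`. -/
def unitIso : 𝟭 (FlatLift p s) ≅ toFrobExt p s ⋙ toFlatLift p s :=
  NatIso.ofComponents (fun E => ObjectProperty.isoMk _ E.isoLift)
    (fun g => ObjectProperty.hom_ext _ (FlatLift.unitHom_naturality g))

variable (p s) in
/-- The counit of the equivalence between flat lifts and pairs `(F, f)`. -/
def counitIso : toFlatLift p s ⋙ toFrobExt p s ≅ 𝟭 (FrobExt p s) :=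
  NatIso.ofComponents (fun X => asIso X.counitHom) FrobExt.counitHom_naturality

end Equivalence

end WittLift
end

theorem mainTheorem3 (p : ℕ) [Fact p.Prime] {k : Type u} [Field k] [CharP k p] [PerfectField k]
    {S : Scheme.{u}} [IsReduced S] (s : S ⟶ Spec (.of k)) :
    ∃ (e : WittLift.FlatLift p s ≌ WittLift.FrobExt p s)
      (α : WittLift.FlatLift.frobPush p s ⋙ WittLift.SqZeroExt.baerSub (WittLift.EW₂ p s) ≅
        e.functor ⋙ WittLift.FrobExt.toExt p s)
      (β : e.inverse ⋙ WittLift.FlatLift.frobPush p s ≅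
        WittLift.FrobExt.toExt p s ⋙ WittLift.SqZeroExt.baerSub (WittLift.EW₂ p s)),
      (∀ (E : WittLift.FlatLift p s) (U : S.Opens)
        (w : (WittLift.EW₂ p s).O.presheaf.obj (op U)) (y : E.obj.O.presheaf.obj (op U))
        (h : (WittLift.EW₂ p s).π.app (op U) w =
          ((WittLift.FlatLift.frobPush p s).obj E).π.app (op U)
            ((WittLift.FlatLift.toFrobPush p s E).app (op U) y)),
        (e.functor.obj E).toCW₂.app (op U) ((α.hom.app E).hom.app (op U)
          (WittLift.SqZeroExt.sub (WittLift.EW₂ p s) ((WittLift.FlatLift.frobPush p s).obj E) w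
            ((WittLift.FlatLift.toFrobPush p s E).app (op U) y) h)) =
          (WittLift.toCW₂ p s).app (op U) w) ∧
      (∀ (X : WittLift.FrobExt p s) (U : S.Opens)
        (y : (e.inverse.obj X).obj.O.presheaf.obj (op U))
        (w : (WittLift.EW₂ p s).O.presheaf.obj (op U)) (x : X.F.O.presheaf.obj (op U))
        (h : (WittLift.EW₂ p s).π.app (op U) w = X.F.π.app (op U) x),
        (β.hom.app X).hom.app (op U)
          ((WittLift.FlatLift.toFrobPush p s (e.inverse.obj X)).app (op U) y) =
          WittLift.SqZeroExt.sub (WittLift.EW₂ p s) ((WittLift.FrobExt.toExt p s).obj X) w x h →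
        X.toCW₂.app (op U) x = (WittLift.toCW₂ p s).app (op U) w) := by
  refine ⟨CategoryTheory.Equivalence.mk (WittLift.toFrobExt p s) (WittLift.toFlatLift p s)
    (WittLift.unitIso p s) (WittLift.counitIso p s), WittLift.diffIsoToExt p s,
    WittLift.frobPushIso p s, ?_, ?_⟩
  · intro E U w y h
    exact (WittLift.toFrobExt_obj_toCW₂ E _).trans (E.diffToCW₂_sub w y h)
  · intro X U y w x h e
    have hy := WittLift.SqZeroExt.eqIncl_mem (a := WittLift.wittToCW₂ p s) (b := X.homOver)
      (WittLift.EW₂_π_surjective p s) (WittLift.isShortExact_frobMap_dMap p _) y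
    rw [(WittLift.frobPushIso_hom_apply X y).symm.trans e] at hy
    exact (WittLift.SqZeroExt.sub_mem_eqSubring.1 hy).symm
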